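/- **Setting.** Let $\Bbbk$ be an algebraically closed field of characteristic $0$, let $A=\Bbbk\langle x_1,\dots,x_d\rangle$ be a free associative algebra ($d\ge 0$), and let $\{\!\{-,-\}\!\}:A\otimes A\to A\otimes A$ be a double Poisson bracket on $A$: a bilinear map with $\{\!\{a,b\}\!\}=-\{\!\{b,a\}\!\}^{\mathrm{op}}$ (op swaps the two tensor factors), $\{\!\{a,bc\}\!\}=\{\!\{a,b\}\!\}(1\otimes c)+(b\otimes 1)\{\!\{a,c\}\!\}$, and the double Jacobi identity $\{\!\{a,\{\!\{b,c\}\!\}\}\!\}_L+\zeta\{\!\{b,\{\!\{c,a\}\!\}\}\!\}_L+\zeta^2\{\!\{c,\{\!\{a,b\}\!\}\}\!\}_L=0$, where $\{\!\{a,b'\otimes b''\}\!\}_L=\{\!\{a,b'\}\!\}\otimes b''$ and $\zeta(x'\otimes x''\otimes x''')=x'''\otimes x'\otimes x''$. **The space $\mathcal O(A)$.** Let $A_\natural=A/[A,A]$ (quotient vector space) and $$\mathcal O(A)=\bigoplus_{m\ge0}\mathcal O(A)^{(m)},\qquad \mathcal O(A)^{(m)}=A^{\otimes m}\otimes \mathrm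 S(A_\natural)\otimes\Bbbk[S(m)].$$ A permutation $\sigma\in S(m)$ acts from the left by $\sigma\cdot(a_1\otimes\dots\otimes a_m\otimes f\otimes u)=a_{\sigma^{-1}(1)}\otimes\dots\otimes a_{\sigma^{-1}(m)}\otimes f\otimes\sigma u$. There is a canonical surjection of $\bigoplus_{m}A^{\otimes m}\otimes \mathrm T(A)\otimes\Bbbk[S(m)]$ onto $\mathcal O(A)$, induced by $f_1\otimes\dots\otimes f_s\mapsto \bar f_1\cdots\bar f_s$. **Representation spaces.** For $N\ge1$ let $\mathcal O(\mathrm{Rep}(A,N))=\Bbbk[x_{a,pq}\mid 1\le a\le d,\ 1\le p,q\le N]$. For $a\in A$ let $a_{ij}$ be the $(i,j)$ entry of the image of $a$ under the homomorphism $x_a\mapsto (x_{a,pq})_{p,q}$, and let $\mathrm{tr}(\bar a)=\sum_i a_{ii}$. For $\alpha=a_1\otimes\dots\otimes a_m\otimes \bar f_1\cdots \bar f_s\otimes u$ and $\mathbf i,\mathbf j\in\{1,\dots,N\}^m$ put $$\alpha_{\mathbf i\mathbf j}=\prod_{t=1}^m (a_t)_{i_{u^{-1}(t)}\,j_t}\cdot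 \mathrm{tr}(\bar f_1)\cdots \mathrm{tr}(\bar f_s),$$ extended linearly to $\mathcal O(A)^{(m)}$. The double bracket induces the Poisson bracket on $\mathcal O(\mathrm{Rep}(A,N))$ with $\{(x_a)_{ij},(x_b)_{kl}\}=\{\!\{x_a,x_b\}\!\}'_{kj}\,\{\!\{x_a,x_b\}\!\}''_{il}$. **Admissible graphs and Kontsevich's operators.** A graph $\Gamma\in G_n$ ($n\ge 0$) has the vertices $1,\dots,n,L,R$ and the edges $e_k^1,e_k^2$ ($1\le k\le n$), which start at $k$, do not end at $k$, and have different endpoints. With $J$ ranging over all maps from the set of edges to the set of the coordinates $x_{a,pq}$ (write $\partial_{J(e)}$ for the partial derivative along the coordinate $J(e)$), $$B_\Gamma(F,H)=\sum_{J}\ \prod_{k=1}^n\Bigl(\prod_{e\to k}\partial_{J(e)}\Bigr)\{J(e_k^1),J(e_k^2)\}\cdot\Bigl(\prod_{e\to L}\partial_{J(e)}\Bigr)F\cdot\Bigl(\prod_{e\to R}\partial_{J(e)}\Bigr)H .$$ **Double admissible graphs.** For $l=(l_1,l_2)$, $r=(r_1,r_2)\in\mathbb Z_{\ge0}^2$,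 an element $\mathbb\Gamma$ of $\mathbb G_n^{(l,r)}$ has the numbered vertices $k.1,k.2$ ($1\le k\le n$; the block of $k$), $l_1$ left vertices, $l_2$ left loop vertices, $r_1$ right vertices and $r_2$ right loop vertices. Its edges are: proper edges $e_k^1,e_k^2$, where $e_k^i$ starts at $k.i$; for each proper edge $e$ a reflected edge ${}^*e$, which starts at the endpoint of $e$, where ${}^*e_k^1$ ends at $k.2$ and ${}^*e_k^2$ ends at $k.1$; and one loop at each loop vertex. It is required that merging $k.1,k.2$ into $k$, all left and left loop vertices into $L$, and all right and right loop vertices into $R$ turns the proper edges into the edges of a graph $m_n^{(l,r)}(\mathbb\Gamma)\in G_n$. Let $E(v)$ be the set of proper edges ending at $v$. **Splittings.** Number the left and right vertices $1,\dots,l_1+r_1$, left ones first. A splitting $\mathcal S$ of $\mathbb\Gamma$ consists of oriented paths $\tau_1,\dots,\tau_{l_1+r_1}$ and of a finite set of nonempty oriented cycles, up to rotation, such that: $\tau_t$ starts at the vertex $t$ and ends at a left or right vertex with number $\sigma(t)$; $\tau_t$ has length zero if and only if $E(t)=\emptyset$; $\sigma=\sigma(\mathcal S)$ is a permutation; every edge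 occurs exactly once in total in the paths and cycles; no path or cycle passes a proper edge $e$ and then immediately ${}^*e$; and after a reflected edge ending at a numbered vertex $v$ with $E(v)\ne\emptyset$ a path or cycle continues along a reflected edge. To a vertex $v$ one attaches a word $w_v$ in $E(v)$ as follows. The initial given edge is the first edge of the path starting at $v$ if $v$ is a left or right vertex, the edge next to the loop if $v$ is a loop vertex, and the edge next to the unique reflected edge ending at $v$ if $v$ is a numbered vertex. As long as the given edge exists and is a reflected edge ${}^*e$ with $e\in E(v)$, append $e$ to the word and take as the new given edge the one that follows $e$ in its path or cycle; otherwise stop. The splitting is principal if $w_v$ has $|E(v)|$ letters for every vertex $v$. Let $\mathrm{split}(\mathbb\Gamma)$ be the set of principal splittings. **The operators $\mathbb B_\Gamma$.** Let $\partial_a:A\to A\otimes A$ be the double derivation ($\partial_a(fg)=\partial_a(f)(1\otimes g)+(f\otimes1)\partial_a(g)$) with $\partial_a(x_b)=\delta_{ab}\,1\otimes 1$, and let $\partial_{a_1\dots a_m}=\partial_{a_1}^{(1)}\cdots\partial_{a_m}^{(1)}:A\to A^{\otimes(m+1)}$, where $\partial^{(1)}$ acts on the first tensor factor. Take $\mathcal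 S\in\mathrm{split}(\mathbb\Gamma)$, a map $I$ from the set of proper edges to $\{1,\dots,d\}$, elements $a_1,\dots,a_{l_1},f_1,\dots,f_{l_2},b_1,\dots,b_{r_1},g_1,\dots,g_{r_2}\in A$, and permutations $u\in S(l_1)$, $v\in S(r_1)$. Attach to the left, left loop, right and right loop vertices the elements $a_t,f_p,b_s,g_q$, and to $k.1$, $k.2$ the two Sweedler components of $\{\!\{x_{I(e_k^1)},x_{I(e_k^2)}\}\!\}$. If $z$ is attached to a vertex $y$ and $w_y=e_1\cdots e_m$, put $X(y)=\partial_{I(e_1)\dots I(e_m)}(z)=X^{(0)}(y)\otimes X^{(e_1)}(y)\otimes\dots\otimes X^{(e_m)}(y)$. For a path $\tau\in\mathcal S$ let $X(\tau)\in A$ be the product of $X^{(0)}$ of its starting vertex and, from left to right along $\tau$, one factor for each edge of $\tau$, where an edge ending at $y$ gives $X^{(e)}(y)$ if it is the proper edge $e$, and $X^{(0)}(y)$ if it is reflected or a loop. For a cycle $\gamma$ let $X(\gamma)\in A_\natural$ be the class of the product of the factors of its edges in cyclic order. Put $$\mathbb B_{\mathbb\Gamma,\mathcal S}\bigl((a\otimes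 f\otimes u)\otimes(b\otimes g\otimes v)\bigr)=\sum_I\sigma(\mathcal S)\cdot\Bigl[X(\tau_1)\otimes\dots\otimes X(\tau_{l_1+r_1})\otimes\prod_\gamma X(\gamma)\otimes(u\times v)\Bigr],$$ where $a=a_1\otimes\dots\otimes a_{l_1}$, $f=f_1\otimes\dots\otimes f_{l_2}$, and so on, $u\times v\in S(l_1+r_1)$ is the image of $(u,v)$ under $S(l_1)\times S(r_1)\hookrightarrow S(l_1+r_1)$, and the sum over Sweedler components is understood. For $\Gamma\in G_n$ define $$\mathbb B_\Gamma=\sum_{l,r}\ \sum_{\mathbb\Gamma\in\mathbb G_n^{(l,r)},\ m_n^{(l,r)}(\mathbb\Gamma)=\Gamma}\ \sum_{\mathcal S\in\mathrm{split}(\mathbb\Gamma)}\mathbb B_{\mathbb\Gamma,\mathcal S}:\ \Bigl(\bigoplus_{m}A^{\otimes m}\otimes \mathrm T(A)\otimes\Bbbk[S(m)]\Bigr)^{\otimes 2}\to\mathcal O(A).$$ **Proposition.** For every $n\ge 0$ and $\Gamma\in G_n$ the map $\mathbb B_\Gamma$ factors, in a unique way, through a linear map $\mathcal O(A)\otimes\mathcal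 O(A)\to\mathcal O(A)$, again denoted by $\mathbb B_\Gamma$. Moreover, for all $p,q\ge 0$ and all homogeneous $\alpha\in\mathcal O(A)^{(p)}$, $\beta\in\mathcal O(A)^{(q)}$, the element $\mathbb B_\Gamma(\alpha,\beta)$ lies in $\mathcal O(A)^{(p+q)}$, and for every $N\ge1$ and all tuples $\mathbf i_1,\mathbf j_1\in\{1,\dots,N\}^p$, $\mathbf i_2,\mathbf j_2\in\{1,\dots,N\}^q$, $$B_\Gamma(\alpha_{\mathbf i_1\mathbf j_1},\beta_{\mathbf i_2\mathbf j_2})=\mathbb B_\Gamma(\alpha,\beta)_{\mathbf i_1\sqcup\mathbf i_2,\ \mathbf j_1\sqcup\mathbf j_2},$$ where $\sqcup$ is concatenation of tuples. -/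

import Mathlib

open scoped TensorProduct DirectSum

noncomputable section

namespace DiTwisted

/-! ## Double Poisson brackets -/

/-- The cyclic permutation `x' ⊗ x'' ⊗ x''' ↦ x''' ⊗ x' ⊗ x''`. -/
def cyc3 (k A : Type*) [Field k] [Ring A] [Algebra k A] :
    ((A ⊗[k] A) ⊗[k] A) →ₗ[k] ((A ⊗[k] A) ⊗[k] A) :=
  (TensorProduct.assoc k A A A).symm.toLinearMap ∘ₗ
    (TensorProduct.comm k (A ⊗[k] A) A).toLinearMap

/-- A double Poisson bracket (Van den Bergh) on an associative algebra. The outer bimodule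
structure on `A ⊗ A` is written with the product of the algebra `A ⊗ A`. -/
structure DoublePoissonBracket (k A : Type*) [Field k] [Ring A] [Algebra k A] where
  br : A →ₗ[k] A →ₗ[k] A ⊗[k] A
  skew : ∀ a b, br a b = - TensorProduct.comm k A A (br b a)
  leibniz : ∀ a b c, br a (b * c) =
    br a b * ((1 : A) ⊗ₜ[k] c) + (b ⊗ₜ[k] (1 : A)) * br a c
  jacobi : ∀ a b c,
    (br a).rTensor A (br b c) + cyc3 k A ((br b).rTensor A (br c a)) +
      cyc3 k A (cyc3 k A ((br c).rTensor A (br a b))) = 0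

/-! ## The double coordinate ring `O(A)` -/

/-- The linear span of the commutators `ab - ba`. -/
def commutators (k A : Type*) [Field k] [Ring A] [Algebra k A] : Submodule k A :=
  Submodule.span k {x | ∃ a b : A, x = a * b - b * a}

/-- The vector space `A_♮ = A / [A, A]`. -/
abbrev ANat (k A : Type*) [Field k] [Ring A] [Algebra k A] : Type _ := A ⧸ commutators k A

/-- `A^{⊗ n}`. -/
abbrev TPow (k A : Type*) [Field k] [Ring A] [Algebra k A] (n : ℕ) : Type _ :=
  ⨂[k] _ : Fin n, A

/-- `𝕜[S(n)]`. -/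
abbrev SnAlg (k : Type*) [Field k] (n : ℕ) : Type _ := MonoidAlgebra k (Equiv.Perm (Fin n))

/-- The graded component `O(A)^{(n)} = A^{⊗ n} ⊗ S(A_♮) ⊗ 𝕜[S(n)]`. -/
abbrev OComp (k A : Type*) [Field k] [Ring A] [Algebra k A] (n : ℕ) : Type _ :=
  (TPow k A n ⊗[k] SymmetricAlgebra k (ANat k A)) ⊗[k] SnAlg k n

/-- `O(A) = ⨁ₙ A^{⊗ n} ⊗ S(A_♮) ⊗ 𝕜[S(n)]`. -/
abbrev ORing (k A : Type*) [Field k] [Ring A] [Algebra k A] : Type _ := ⨁ n : ℕ, OComp k A n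

/-- `A^{⊗ l₁} ⊗ A^{⊗ l₂} ⊗ 𝕜[S(l₁)]`. -/
abbrev PreComp (k A : Type*) [Field k] [Ring A] [Algebra k A] (l : ℕ × ℕ) : Type _ :=
  (TPow k A l.1 ⊗[k] TPow k A l.2) ⊗[k] SnAlg k l.1

/-- `⨁_{l₁} A^{⊗ l₁} ⊗ T(A) ⊗ 𝕜[S(l₁)]`, where the tensor algebra `T(A) = ⨁_{l₂} A^{⊗ l₂}` is
written out, so that the sum is over the pairs `(l₁, l₂)`. -/
abbrev PreORing (k A : Type*) [Field k] [Ring A] [Algebra k A] : Type _ :=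
  ⨁ l : ℕ × ℕ, PreComp k A l

section OA

variable {k A : Type*} [Field k] [Ring A] [Algebra k A]

/-- `A^{⊗ m} → S(A_♮)`, `f₁ ⊗ ⋯ ⊗ fₘ ↦ f̄₁ ⋯ f̄ₘ`. -/
def symProd (m : ℕ) : TPow k A m →ₗ[k] SymmetricAlgebra k (ANat k A) :=
  PiTensorProduct.lift
    ((MultilinearMap.mkPiAlgebra k (Fin m) (SymmetricAlgebra k (ANat k A))).compLinearMap
      fun _ => SymmetricAlgebra.ι k (ANat k A) ∘ₗ (commutators k A).mkQ)

/-- The canonical surjection `⨁ A^{⊗ n} ⊗ T(A) ⊗ 𝕜[S(n)] → O(A)`. -/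
def preToO : PreORing k A →ₗ[k] ORing k A :=
  DirectSum.toModule k (ℕ × ℕ) _ fun l =>
    DirectSum.lof k ℕ (OComp k A) l.1 ∘ₗ
      TensorProduct.map (TensorProduct.map LinearMap.id (symProd l.2)) LinearMap.id

/-- The left action of `σ ∈ S(n)` on `O(A)^{(n)}`:
`σ · (a ⊗ f ⊗ τ) = (a_{σ⁻¹(1)} ⊗ ⋯ ⊗ a_{σ⁻¹(n)}) ⊗ f ⊗ στ`. -/
def leftAct {n : ℕ} (σ : Equiv.Perm (Fin n)) : OComp k A n →ₗ[k] OComp k A n :=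
  TensorProduct.map
    (TensorProduct.map (PiTensorProduct.reindex k (fun _ => A) σ).toLinearMap LinearMap.id)
    (LinearMap.mulLeft k (MonoidAlgebra.of k _ σ))

/-- The embedding `S(n) → S(n + m)`, `u ↦ u × id`. -/
def permLeft (n m : ℕ) : Equiv.Perm (Fin n) →* Equiv.Perm (Fin (n + m)) :=
  (finSumFinEquiv.permCongrHom.toMonoidHom.comp (Equiv.Perm.sumCongrHom (Fin n) (Fin m))).comp
    (MonoidHom.inl _ _)

/-- The embedding `S(m) → S(n + m)`, `v ↦ id × v`. -/
def permRight (n m : ℕ) : Equiv.Perm (Fin m) →* Equiv.Perm (Fin (n + m)) :=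
  (finSumFinEquiv.permCongrHom.toMonoidHom.comp (Equiv.Perm.sumCongrHom (Fin n) (Fin m))).comp
    (MonoidHom.inr _ _)

/-- `𝕜[S(n)] ⊗ 𝕜[S(m)] → 𝕜[S(n + m)]`, `u ⊗ v ↦ u × v`. -/
def permProd (n m : ℕ) : SnAlg k n ⊗[k] SnAlg k m →ₗ[k] SnAlg k (n + m) :=
  LinearMap.mul' k (SnAlg k (n + m)) ∘ₗ
    TensorProduct.map (MonoidAlgebra.mapDomainAlgHom k k (permLeft n m)).toLinearMap
      (MonoidAlgebra.mapDomainAlgHom k k (permRight n m)).toLinearMap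

/-- For `y : E → A` and a cyclic word `c` in `E`, the class in `A_♮` of the product of the `y e`
along `c`. -/
def cycProd {E : Type*} (y : E → A) (c : Cycle E) : ANat k A :=
  Quotient.liftOn' c (fun es => (commutators k A).mkQ (es.map y).prod) (by
    rintro es _ ⟨m, rfl⟩
    change (commutators k A).mkQ _ = (commutators k A).mkQ _
    rw [List.rotate_eq_drop_append_take_mod]
    conv_lhs => rw [← List.take_append_drop (m % es.length) es]
    rw [List.map_append, List.map_append, List.prod_append, List.prod_append,
      ← sub_eq_zero, ← map_sub, Submodule.mkQ_apply, Submodule.Quotient.mk_eq_zero]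
    exact Submodule.subset_span ⟨_, _, rfl⟩)

end OA

/-! ## Admissible graphs, double admissible graphs -/

/-- The vertices `1, …, n`, `L`, `R` of an admissible graph. -/
inductive GVertex (n : ℕ)
  | num (k : Fin n)
  | L
  | R
  deriving DecidableEq

/-- The labels `(k, 0)`, `(k, 1)` of the edges `e_k^1`, `e_k^2`. -/
abbrev EdgeLabel (n : ℕ) : Type := Fin n × Fin 2

/-- The set `G_n` of admissible graphs. Such a graph is given by the endpoints of its labelled
edges; the edges `e_k^1` and `e_k^2` start at the vertex `k`. -/
@[ext]
structure AdmissibleGraph (n : ℕ) where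
  target : EdgeLabel n → GVertex n
  no_loop : ∀ k i, target (k, i) ≠ GVertex.num k
  no_multiple : ∀ k, target (k, 0) ≠ target (k, 1)

/-- The vertices of a double admissible graph: `num (k, 0)` and `num (k, 1)` are the numbered
vertices `k.1` and `k.2`. -/
inductive DVertex (n : ℕ) (l r : ℕ × ℕ)
  | num (x : Fin n × Fin 2)
  | left (t : Fin l.1)
  | right (s : Fin r.1)
  | leftLoop (p : Fin l.2)
  | rightLoop (q : Fin r.2)
  deriving DecidableEq, Fintype

/-- The edges of a double admissible graph: the proper edges, the reflected edges, the loops. -/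
inductive DEdge (n : ℕ) (l r : ℕ × ℕ)
  | proper (e : EdgeLabel n)
  | refl (e : EdgeLabel n)
  | leftLoop (p : Fin l.2)
  | rightLoop (q : Fin r.2)
  deriving DecidableEq, Fintype

/-- Merging `k.1` with `k.2` and collapsing the left and left loop vertices to `L`, the right and
right loop vertices to `R`. -/
def DVertex.merge {n : ℕ} {l r : ℕ × ℕ} : DVertex n l r → GVertex n
  | num x => GVertex.num x.1
  | left _ => GVertex.L
  | right _ => GVertex.R
  | leftLoop _ => GVertex.L
  | rightLoop _ => GVertex.R

/-- The set `𝔾_n^{(l,r)}` of double admissible graphs. Such a graph is given by the endpoints of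
its proper edges. The conditions say that neither of the two proper edges of the block
`{k.1, k.2}` ends in this block, and that they end neither in a common block, nor both at left or
left loop vertices, nor both at right or right loop vertices. -/
@[ext]
structure DoubleGraph (n : ℕ) (l r : ℕ × ℕ) where
  target : EdgeLabel n → DVertex n l r
  no_loop : ∀ k i, (target (k, i)).merge ≠ GVertex.num k
  no_multiple : ∀ k, (target (k, 0)).merge ≠ (target (k, 1)).merge

namespace DoubleGraph

variable {n : ℕ} {l r : ℕ × ℕ}

/-- The map `m_n^{(l,r)} : 𝔾_n^{(l,r)} → G_n`. -/
def toAdmissible (G : DoubleGraph n l r) : AdmissibleGraph n where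
  target e := (G.target e).merge
  no_loop := G.no_loop
  no_multiple := G.no_multiple

/-- Starting point of an edge: `e_k^i` starts at `k.i`, and the reflected edge `*e` starts at the
endpoint of `e`. -/
def src (G : DoubleGraph n l r) : DEdge n l r → DVertex n l r
  | .proper e => .num e
  | .refl e => G.target e
  | .leftLoop p => .leftLoop p
  | .rightLoop q => .rightLoop q

/-- Endpoint of an edge: `*e_k^1` ends at `k.2` and `*e_k^2` ends at `k.1`. -/
def tgt (G : DoubleGraph n l r) : DEdge n l r → DVertex n l r
  | .proper e => G.target e
  | .refl e => .num (e.1, e.2.rev)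
  | .leftLoop p => .leftLoop p
  | .rightLoop q => .rightLoop q

/-- The set `E(v)` of proper edges terminating at `v`. -/
def inEdges (G : DoubleGraph n l r) (v : DVertex n l r) : Finset (EdgeLabel n) :=
  Finset.univ.filter fun e => G.target e = v

/-- `G.IsWalk v es w`: the sequence of edges `es` is an oriented path from `v` to `w`. -/
def IsWalk (G : DoubleGraph n l r) : DVertex n l r → List (DEdge n l r) → DVertex n l r → Prop
  | v, [], w => v = w
  | v, e :: es, w => G.src e = v ∧ G.IsWalk (G.tgt e) es w

/-- The restrictions on two consecutive edges `e`, `e'` of a path or cycle of a splitting: it is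
not of the form `e *e` with `e` proper; and if `e` is a reflected edge ending at a numbered vertex
that has outgoing reflected edges, then `e'` is reflected. -/
def Admits (G : DoubleGraph n l r) (e e' : DEdge n l r) : Prop :=
  (∀ x : EdgeLabel n, ¬ (e = .proper x ∧ e' = .refl x)) ∧
  (∀ x : EdgeLabel n, e = .refl x → (G.inEdges (G.tgt e)).Nonempty →
    ∃ x' : EdgeLabel n, e' = .refl x')

end DoubleGraph

/-- The left and right vertices in their linear order `L_1, …, L_{l₁}, R_1, …, R_{r₁}`. -/
def outerVertex (n : ℕ) (l r : ℕ × ℕ) : Fin (l.1 + r.1) → DVertex n l r :=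
  Fin.addCases (fun t => .left t) (fun s => .right s)

/-! ## Splittings -/

/-- A splitting of a double admissible graph: the path `path t` starts at the `t`-th left or right
vertex and ends at the one with number `endIdx t`; the finite set `cycles` consists of cyclic
oriented paths, considered up to rotation. -/
@[ext]
structure Splitting {n : ℕ} {l r : ℕ × ℕ} (G : DoubleGraph n l r) where
  path : Fin (l.1 + r.1) → List (DEdge n l r)
  endIdx : Fin (l.1 + r.1) → Fin (l.1 + r.1)
  cycles : Finset (Cycle (DEdge n l r))
  isWalk_path : ∀ t, G.IsWalk (outerVertex n l r t) (path t) (outerVertex n l r (endIdx t))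
  cycles_ne_nil : ∀ c ∈ cycles, c ≠ Cycle.nil
  isWalk_cycle : ∀ c ∈ cycles, c.Chain fun e e' => G.tgt e = G.src e'
  path_eq_nil_iff : ∀ t, path t = [] ↔ G.inEdges (outerVertex n l r t) = ∅
  endIdx_injective : Function.Injective endIdx
  count_eq_one : ∀ e, ∑ t, (path t).count e + ∑ c ∈ cycles, c.toMultiset.count e = 1
  admits_path : ∀ t, (path t).IsChain G.Admits
  admits_cycle : ∀ c ∈ cycles, c.Chain G.Admits

namespace Splitting

variable {n : ℕ} {l r : ℕ × ℕ} {G : DoubleGraph n l r}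

/-- The permutation `σ(S)`, which maps the number of the starting point of each path to the number
of its endpoint. -/
def perm (S : Splitting G) : Equiv.Perm (Fin (l.1 + r.1)) :=
  Equiv.ofBijective S.endIdx (Finite.injective_iff_bijective.mp S.endIdx_injective)

/-- `S.Follows e e'`: the edge `e'` comes next after the edge `e` in a path or a cycle of `S`. -/
def Follows (S : Splitting G) (e e' : DEdge n l r) : Prop :=
  (∃ t, [e, e'] <:+: S.path t) ∨
  (∃ c ∈ S.cycles, ∃ es : List (DEdge n l r), c = ↑(e :: es) ∧ (es ++ [e]).head? = some e')

open Classical in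
/-- The edge that comes next after `e`, if `e` is not the last edge of a path. -/
def next (S : Splitting G) (e : DEdge n l r) : Option (DEdge n l r) :=
  if h : ∃ e', S.Follows e e' then some h.choose else none

/-- The edge from which the word of the vertex `v` starts: the first edge of the path starting at
`v` for a left or right vertex, the edge next to the loop for a loop vertex, the edge next to the
only reflected edge terminating at `v` for a numbered vertex. -/
def first (S : Splitting G) : DVertex n l r → Option (DEdge n l r)
  | .num x => S.next (.refl (x.1, x.2.rev))
  | .left t => (S.path (Fin.castAdd r.1 t)).head?
  | .right s => (S.path (Fin.natAdd l.1 s)).head?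
  | .leftLoop p => S.next (.leftLoop p)
  | .rightLoop q => S.next (.rightLoop q)

/-- The algorithm: if the given edge exists and is the reflected edge `*e`, append `e` to the word
and pass to the edge that comes next after the proper edge `e`; otherwise break. The number of
steps is bounded by the first argument. -/
def collect (S : Splitting G) : ℕ → Option (DEdge n l r) → List (EdgeLabel n)
  | m + 1, some (.refl e) => e :: S.collect m (S.next (.proper e))
  | _, _ => []

/-- The word `w_v`. Its letters are pairwise distinct, so `2n` steps suffice. -/
def word (S : Splitting G) (v : DVertex n l r) : List (EdgeLabel n) :=
  S.collect (2 * n) (S.first v)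

/-- A splitting is principal if `d_S(v) = |E(v)|` for every vertex `v`. -/
def IsPrincipal (S : Splitting G) : Prop :=
  ∀ v, (S.word v).length = (G.inEdges v).card

end Splitting

/-! ### Finiteness -/

instance {n : ℕ} {l r : ℕ × ℕ} : Finite (DoubleGraph n l r) :=
  Finite.of_injective DoubleGraph.target fun _ _ h => DoubleGraph.ext h

instance {n : ℕ} {l r : ℕ × ℕ} : Fintype (DoubleGraph n l r) := Fintype.ofFinite _

theorem Splitting.nodup_path {n : ℕ} {l r : ℕ × ℕ} {G : DoubleGraph n l r} (S : Splitting G)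
    (t : Fin (l.1 + r.1)) : (S.path t).Nodup := by
  rw [List.nodup_iff_count_le_one]
  intro e
  rw [← S.count_eq_one e]
  exact le_add_right
    (Finset.single_le_sum (f := fun t => (S.path t).count e) (by simp) (Finset.mem_univ t))

theorem Splitting.nodup_cycle {n : ℕ} {l r : ℕ × ℕ} {G : DoubleGraph n l r} (S : Splitting G)
    (c : Cycle (DEdge n l r)) (hc : c ∈ S.cycles) : c.Nodup := by
  have : c.toMultiset.Nodup := by
    rw [Multiset.nodup_iff_count_le_one]
    intro e
    rw [← S.count_eq_one e]
    exact le_add_left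
      (Finset.single_le_sum (f := fun c : Cycle (DEdge n l r) => c.toMultiset.count e)
        (by simp) hc)
  induction c using Cycle.induction_on <;> simp_all

instance {n : ℕ} {l r : ℕ × ℕ} (G : DoubleGraph n l r) : Finite (Splitting G) := by
  refine Finite.of_injective
    (β := (Fin (l.1 + r.1) → {es : List (DEdge n l r) // es.Nodup}) ×
      (Fin (l.1 + r.1) → Fin (l.1 + r.1)) × Set {c : Cycle (DEdge n l r) // c.Nodup})
    (fun S => (fun t => ⟨S.path t, S.nodup_path t⟩, S.endIdx, {c | c.1 ∈ S.cycles})) ?_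
  intro S S' h
  simp only [Prod.mk.injEq] at h
  obtain ⟨h1, h2, h3⟩ := h
  refine Splitting.ext ?_ h2 ?_
  · funext t
    exact congrArg Subtype.val (congrFun h1 t)
  · ext c
    constructor
    · intro hc
      exact (Set.ext_iff.mp h3 ⟨c, S.nodup_cycle c hc⟩).mp hc
    · intro hc
      exact (Set.ext_iff.mp h3 ⟨c, S'.nodup_cycle c hc⟩).mpr hc

instance {n : ℕ} {l r : ℕ × ℕ} (G : DoubleGraph n l r) : Fintype (Splitting G) :=
  Fintype.ofFinite _

/-! ## The building blocks `X_{I,S}` -/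

/-- The free algebra `𝕜⟨x_1, …, x_d⟩`. -/
abbrev NCPoly (k : Type*) [Field k] (d : ℕ) : Type _ := FreeAlgebra k (Fin d)

/-- The algebra homomorphism `f ↦ (f ⊗ 1, ∂_a f; 0, 1 ⊗ f)` to triangular matrices. -/
def triangular (k : Type*) [Field k] {d : ℕ} (a : Fin d) :
    NCPoly k d →ₐ[k] Matrix (Fin 2) (Fin 2) (NCPoly k d ⊗[k] NCPoly k d) :=
  FreeAlgebra.lift k fun b : Fin d =>
    !![FreeAlgebra.ι k b ⊗ₜ[k] 1, if b = a then 1 else 0; 0, 1 ⊗ₜ[k] FreeAlgebra.ι k b]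

/-- The double derivation `∂_a : A → A ⊗ A` with respect to the outer bimodule structure. -/
def dpartial (k : Type*) [Field k] {d : ℕ} (a : Fin d) :
    NCPoly k d →ₗ[k] NCPoly k d ⊗[k] NCPoly k d :=
  Matrix.entryLinearMap k _ 0 1 ∘ₗ (triangular k a).toLinearMap

theorem dpartial_ι (k : Type*) [Field k] {d : ℕ} (a b : Fin d) :
    dpartial k a (FreeAlgebra.ι k b) =
      if b = a then (1 : NCPoly k d) ⊗ₜ[k] (1 : NCPoly k d) else 0 := by
  simp [dpartial, triangular, Algebra.TensorProduct.one_def]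

theorem triangular_diag (k : Type*) [Field k] {d : ℕ} (a : Fin d) (f : NCPoly k d) :
    triangular k a f 0 0 = f ⊗ₜ[k] 1 ∧ triangular k a f 1 0 = 0 ∧
      triangular k a f 1 1 = 1 ⊗ₜ[k] f := by
  induction f using FreeAlgebra.induction with
  | grade0 c =>
    simp [Algebra.algebraMap_eq_smul_one, Algebra.TensorProduct.one_def, TensorProduct.smul_tmul']
  | grade1 b => simp [triangular]
  | mul f g hf hg =>
    simp [Matrix.mul_apply, Fin.sum_univ_two, hf, hg, Algebra.TensorProduct.tmul_mul_tmul]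
  | add f g hf hg => simp [hf, hg, TensorProduct.add_tmul, TensorProduct.tmul_add]

theorem dpartial_mul (k : Type*) [Field k] {d : ℕ} (a : Fin d) (f g : NCPoly k d) :
    dpartial k a (f * g) =
      dpartial k a f * ((1 : NCPoly k d) ⊗ₜ[k] g) +
        (f ⊗ₜ[k] (1 : NCPoly k d)) * dpartial k a g := by
  simp [dpartial, Matrix.mul_apply, Fin.sum_univ_two, triangular_diag, add_comm]

/-- The index set of the Sweedler components of all the `X_{I,S}(v)` together. The component
`X^{(e)}(v)` has the index `inr (proper e)`. The component `X^{(0)}(v)` has as index the vertex `v`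
itself for a left or right vertex, the loop for a loop vertex, and the only reflected edge
terminating at `v` for a numbered vertex. So when a path comes to a vertex along an edge `e`, the
component to multiply with is the one with index `inr e`. -/
abbrev Slot (n : ℕ) (l r : ℕ × ℕ) : Type := Fin (l.1 + r.1) ⊕ DEdge n l r

/-- The index of `X^{(0)}(v)`. -/
def zeroSlot {n : ℕ} {l r : ℕ × ℕ} : DVertex n l r → Slot n l r
  | .num x => .inr (.refl (x.1, x.2.rev))
  | .left t => .inl (Fin.castAdd r.1 t)
  | .right s => .inl (Fin.natAdd l.1 s)
  | .leftLoop p => .inr (.leftLoop p)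
  | .rightLoop q => .inr (.rightLoop q)

/-- The tensor power of `A` whose factors are indexed by the slots. -/
abbrev SlotAlg (k A : Type*) [Field k] [Ring A] [Algebra k A] (n : ℕ) (l r : ℕ × ℕ) : Type _ :=
  ⨂[k] _ : Slot n l r, A

section Contract

variable {k A : Type*} [Field k] [Ring A] [Algebra k A]

/-- The map which puts `a ∈ A` into the tensor factor with index `s`. -/
def atSlot {n : ℕ} {l r : ℕ × ℕ} (s : Slot n l r) : A →ₗ[k] SlotAlg k A n l r :=
  (PiTensorProduct.singleAlgHom (R := k) (A := fun _ : Slot n l r => A) s).toLinearMap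

variable {n : ℕ} {l r : ℕ × ℕ} {G : DoubleGraph n l r}

/-- The element `X(τ)` for the path `τ` with number `t`. -/
def pathProd (S : Splitting G) (y : Slot n l r → A) (t : Fin (l.1 + r.1)) : A :=
  y (.inl t) * ((S.path t).map fun e => y (.inr e)).prod

/-- The element `⨂_τ X(τ) ⊗ ∏_γ X(γ)` of `A^{⊗ (l₁ + r₁)} ⊗ S(A_♮)`. -/
def contractFun (S : Splitting G) (y : Slot n l r → A) :
    TPow k A (l.1 + r.1) ⊗[k] SymmetricAlgebra k (ANat k A) :=
  (PiTensorProduct.tprod k (pathProd S y)) ⊗ₜ[k]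
    ∏ c ∈ S.cycles, SymmetricAlgebra.ι k (ANat k A) (cycProd (fun e => y (.inr e)) c)

theorem map_prod_update {E : Type*} [DecidableEq E] (z : E → A) (e : E) (x : A)
    {es : List E} (h : es.count e = 0) :
    (es.map (Function.update z e x)).prod = (es.map z).prod := by
  congr 1
  refine List.map_congr_left fun e' he' => Function.update_of_ne ?_ _ _
  rintro rfl
  exact List.count_eq_zero.mp h he'

theorem map_prod_update_linear {E : Type*} [DecidableEq E] (z : E → A) (e : E)
    {es : List E} (h : es.count e = 1) :
    ∃ φ : A →ₗ[k] A, ∀ x, (es.map (Function.update z e x)).prod = φ x := by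
  have hm : e ∈ es := List.count_pos_iff.mp (by omega)
  obtain ⟨es₁, es₂, rfl⟩ := List.append_of_mem hm
  rw [List.count_append, List.count_cons_self] at h
  refine ⟨LinearMap.mulLeft k (es₁.map z).prod ∘ₗ LinearMap.mulRight k (es₂.map z).prod,
    fun x => ?_⟩
  have h1 := map_prod_update z e x (es := es₁) (by omega)
  have h2 := map_prod_update z e x (es := es₂) (by omega)
  simp [h1, h2]

theorem cycProd_update {E : Type*} [DecidableEq E] (z : E → A) (e : E) (x : A)
    {c : Cycle E} (h : c.toMultiset.count e = 0) :
    (cycProd (Function.update z e x) c : ANat k A) = cycProd z c := by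
  induction c using Quotient.inductionOn' with
  | h es =>
    replace h : es.count e = 0 := by rw [← h]; exact (Multiset.coe_count e es).symm
    change (commutators k A).mkQ _ = (commutators k A).mkQ _
    rw [map_prod_update z e x h]

theorem cycProd_update_linear {E : Type*} [DecidableEq E] (z : E → A) (e : E)
    {c : Cycle E} (h : c.toMultiset.count e = 1) :
    ∃ φ : A →ₗ[k] ANat k A, ∀ x, cycProd (Function.update z e x) c = φ x := by
  induction c using Quotient.inductionOn' with
  | h es =>
    replace h : es.count e = 1 := by rw [← h]; exact (Multiset.coe_count e es).symm
    obtain ⟨φ, hφ⟩ := map_prod_update_linear (k := k) z e h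
    refine ⟨(commutators k A).mkQ ∘ₗ φ, fun x => ?_⟩
    change (commutators k A).mkQ _ = _
    rw [hφ, LinearMap.comp_apply]

theorem contractFun_update (S : Splitting G) (y : Slot n l r → A) (s : Slot n l r) :
    ∃ φ : A →ₗ[k] TPow k A (l.1 + r.1) ⊗[k] SymmetricAlgebra k (ANat k A),
      ∀ x, contractFun S (Function.update y s x) = φ x := by
  have key : ∀ (t₀ : Fin (l.1 + r.1)) (ψ : A →ₗ[k] A)
      (g : SymmetricAlgebra k (ANat k A)),
      (∀ x, pathProd S (Function.update y s x) =
        Function.update (pathProd S y) t₀ (ψ x)) →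
      (∀ x, ∏ c ∈ S.cycles, SymmetricAlgebra.ι k (ANat k A)
        (cycProd (fun e => Function.update y s x (.inr e)) c) = g) →
      ∃ φ : A →ₗ[k] TPow k A (l.1 + r.1) ⊗[k] SymmetricAlgebra k (ANat k A),
        ∀ x, contractFun S (Function.update y s x) = φ x := by
    intro t₀ ψ g h1 h2
    refine ⟨(TensorProduct.mk k _ _).flip g ∘ₗ
      (PiTensorProduct.tprod k).toLinearMap (pathProd S y) t₀ ∘ₗ ψ, fun x => ?_⟩
    simp only [contractFun, h1, h2]
    rfl
  cases s with
  | inl t₀ =>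
    refine key t₀ (LinearMap.mulRight k ((S.path t₀).map fun e => y (.inr e)).prod)
      (∏ c ∈ S.cycles, SymmetricAlgebra.ι k (ANat k A) (cycProd (fun e => y (.inr e)) c))
      (fun x => ?_) (fun x => ?_)
    · funext t
      rcases eq_or_ne t t₀ with rfl | ht
      · simp [pathProd]
      · simp [pathProd, ht]
    · simp only [Function.update_of_ne (Sum.inr_ne_inl : (Sum.inr _ : Slot n l r) ≠ .inl t₀)]
  | inr e =>
    have hz : ∀ x, (fun e' => Function.update y (.inr e : Slot n l r) x (.inr e')) =
        Function.update (fun e' => y (.inr e')) e x := fun x =>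
      Function.update_comp_eq_of_injective y Sum.inr_injective e x
    have hc := S.count_eq_one e
    by_cases hp : ∃ t₀, (S.path t₀).count e ≠ 0
    · obtain ⟨t₀, ht₀⟩ := hp
      rw [← Finset.add_sum_erase _ _ (Finset.mem_univ t₀)] at hc
      have h1 : (S.path t₀).count e = 1 := by omega
      have h2 : ∑ t ∈ Finset.univ.erase t₀, (S.path t).count e = 0 := by omega
      have h3 : ∑ c ∈ S.cycles, c.toMultiset.count e = 0 := by omega
      rw [Finset.sum_eq_zero_iff] at h2 h3
      obtain ⟨φ, hφ⟩ := map_prod_update_linear (k := k) (fun e' => y (.inr e')) e h1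
      refine key t₀ (LinearMap.mulLeft k (y (.inl t₀)) ∘ₗ φ)
        (∏ c ∈ S.cycles, SymmetricAlgebra.ι k (ANat k A) (cycProd (fun e => y (.inr e)) c))
        (fun x => ?_) (fun x => ?_)
      · funext t
        rcases eq_or_ne t t₀ with rfl | ht
        · rw [Function.update_self, pathProd, hz, hφ, Function.update_of_ne (by simp)]
          rfl
        · rw [Function.update_of_ne ht, pathProd, pathProd, hz,
            map_prod_update _ _ _ (h2 t (by simp [ht])), Function.update_of_ne (by simp)]
      · refine Finset.prod_congr rfl fun c hc' => ?_
        rw [hz, cycProd_update _ _ _ (h3 c hc')]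
    · push Not at hp
      simp only [hp, Finset.sum_const_zero, zero_add] at hc
      obtain ⟨c₀, hc₀, hne⟩ := Finset.exists_ne_zero_of_sum_ne_zero (by omega :
        ∑ c ∈ S.cycles, c.toMultiset.count e ≠ 0)
      rw [← Finset.add_sum_erase _ _ hc₀] at hc
      have h1 : c₀.toMultiset.count e = 1 := by omega
      have h2 : ∑ c ∈ S.cycles.erase c₀, c.toMultiset.count e = 0 := by omega
      rw [Finset.sum_eq_zero_iff] at h2
      obtain ⟨φ, hφ⟩ := cycProd_update_linear (k := k) (fun e' => y (.inr e')) e h1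
      refine ⟨TensorProduct.mk k _ _ (PiTensorProduct.tprod k (pathProd S y)) ∘ₗ
        LinearMap.mulRight k (∏ c ∈ S.cycles.erase c₀, SymmetricAlgebra.ι k (ANat k A)
          (cycProd (fun e => y (.inr e)) c)) ∘ₗ SymmetricAlgebra.ι k (ANat k A) ∘ₗ φ,
        fun x => ?_⟩
      have hpath : pathProd S (Function.update y (.inr e) x) = pathProd S y := by
        funext t
        rw [pathProd, pathProd, hz, map_prod_update _ _ _ (hp t), Function.update_of_ne (by simp)]
      rw [contractFun, hpath, ← Finset.mul_prod_erase _ _ hc₀, hz, hφ,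
        Finset.prod_congr rfl fun c hc' => by rw [cycProd_update _ _ _ (h2 c hc')]]
      rfl

/-- `contractFun` as a multilinear map in the Sweedler components. -/
def contract (S : Splitting G) :
    MultilinearMap k (fun _ : Slot n l r => A)
      (TPow k A (l.1 + r.1) ⊗[k] SymmetricAlgebra k (ANat k A)) :=
  MultilinearMap.mk' (contractFun S)
    (fun y s x x' => by
      obtain ⟨φ, h⟩ := contractFun_update (k := k) S y s
      simp only [h, map_add])
    (fun y s c x => by
      obtain ⟨φ, h⟩ := contractFun_update (k := k) S y s
      simp only [h, map_smul])

end Contract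

section Operators

variable {k : Type*} [Field k] {d : ℕ}
variable {n : ℕ} {l r : ℕ × ℕ} {G : DoubleGraph n l r}

/-- The linear map which sends the element `z` attached to the vertex `v` to
`X_{I,S}(v) = ∂_{I(w_v)}(z)`, put into the tensor factors that belong to `v`. Here
`∂_{I(w)} = ∂_{I(w(1))}^{(1)} ⋯ ∂_{I(w(m))}^{(1)}`, where `∂^{(1)}` is applied to the first tensor
factor; and the tensor factor of `∂_{I(w)}(z)` with number `p ≥ 1` is `X^{(w(p))}(v)`. -/
def vertexMap (S : Splitting G) (I : EdgeLabel n → Fin d) (v : DVertex n l r) :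
    NCPoly k d →ₗ[k] SlotAlg k (NCPoly k d) n l r :=
  (S.word v).foldl
    (fun P e => LinearMap.mul' k _ ∘ₗ TensorProduct.map P (atSlot (.inr (.proper e))) ∘ₗ
      dpartial k (I e))
    (atSlot (zeroSlot v))

/-- `X_{I,S}(k.1) ⊗ X_{I,S}(k.2)`, computed from the two Sweedler components of
`{{x_{I(e_k^1)}, x_{I(e_k^2)}}}`. -/
def blockElt (P : DoublePoissonBracket k (NCPoly k d)) (S : Splitting G)
    (I : EdgeLabel n → Fin d) (b : Fin n) : SlotAlg k (NCPoly k d) n l r :=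
  (LinearMap.mul' k _ ∘ₗ
      TensorProduct.map (vertexMap S I (.num (b, 0))) (vertexMap S I (.num (b, 1))))
    (P.br (FreeAlgebra.ι k (I (b, 0))) (FreeAlgebra.ι k (I (b, 1))))

/-- For linear maps `φ_t : A → B`, the map `a₁ ⊗ ⋯ ⊗ aₘ ↦ φ₁(a₁) ⋯ φₘ(aₘ)`. -/
def tensorProd {A B : Type*} [Ring A] [Algebra k A] [Ring B] [Algebra k B] {m : ℕ}
    (φ : Fin m → A →ₗ[k] B) : TPow k A m →ₗ[k] B :=
  PiTensorProduct.lift ((MultilinearMap.mkPiAlgebraFin k m B).compLinearMap φ)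

/-- `a ⊗ f ↦ ⨂_v X_{I,S}(v)` over the left and left loop vertices `v`. -/
def leftMap (S : Splitting G) (I : EdgeLabel n → Fin d) :
    TPow k (NCPoly k d) l.1 ⊗[k] TPow k (NCPoly k d) l.2 →ₗ[k] SlotAlg k (NCPoly k d) n l r :=
  LinearMap.mul' k _ ∘ₗ TensorProduct.map
    (tensorProd fun t => vertexMap S I (.left t)) (tensorProd fun p => vertexMap S I (.leftLoop p))

/-- `b ⊗ g ↦ ⨂_v X_{I,S}(v)` over the right and right loop vertices `v`. -/
def rightMap (S : Splitting G) (I : EdgeLabel n → Fin d) :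
    TPow k (NCPoly k d) r.1 ⊗[k] TPow k (NCPoly k d) r.2 →ₗ[k] SlotAlg k (NCPoly k d) n l r :=
  LinearMap.mul' k _ ∘ₗ TensorProduct.map
    (tensorProd fun s => vertexMap S I (.right s))
    (tensorProd fun q => vertexMap S I (.rightLoop q))

/-- `(a ⊗ f) ⊗ (b ⊗ g) ↦ ⨂_v X_{I,S}(v)` over all the vertices `v`. -/
def allMap (P : DoublePoissonBracket k (NCPoly k d)) (S : Splitting G)
    (I : EdgeLabel n → Fin d) :
    (TPow k (NCPoly k d) l.1 ⊗[k] TPow k (NCPoly k d) l.2) ⊗[k]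
      (TPow k (NCPoly k d) r.1 ⊗[k] TPow k (NCPoly k d) r.2) →ₗ[k]
      SlotAlg k (NCPoly k d) n l r :=
  LinearMap.mulLeft k (List.ofFn (blockElt P S I)).prod ∘ₗ
    LinearMap.mul' k _ ∘ₗ TensorProduct.map (leftMap S I) (rightMap S I)

/-- The operator `𝔹_{Γ,S}` for a double admissible graph `Γ` and a splitting `S`:
`(a ⊗ f ⊗ u) ⊗ (b ⊗ g ⊗ v) ↦ ∑_I σ(S) · [⨂_τ X_{I,S}(τ) ⊗ ∏_γ X_{I,S}(γ) ⊗ (u × v)]`. -/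
def BBsplit (P : DoublePoissonBracket k (NCPoly k d)) (S : Splitting G) :
    PreComp k (NCPoly k d) l ⊗[k] PreComp k (NCPoly k d) r →ₗ[k]
      OComp k (NCPoly k d) (l.1 + r.1) :=
  ∑ I : EdgeLabel n → Fin d,
    leftAct S.perm ∘ₗ
      TensorProduct.map (PiTensorProduct.lift (contract S) ∘ₗ allMap P S I)
        (permProd l.1 r.1) ∘ₗ
      (TensorProduct.tensorTensorTensorComm k _ _ _ _).toLinearMap

open Classical in
/-- The component of `𝔹_Γ` on `PreComp l ⊗ PreComp r`: the sum over the double admissible graphs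
which are mapped to `Γ` and over their principal splittings. -/
def BBcomp (P : DoublePoissonBracket k (NCPoly k d)) {n : ℕ} (Γ : AdmissibleGraph n)
    (l r : ℕ × ℕ) :
    PreComp k (NCPoly k d) l ⊗[k] PreComp k (NCPoly k d) r →ₗ[k]
      OComp k (NCPoly k d) (l.1 + r.1) :=
  ∑ G : DoubleGraph n l r with G.toAdmissible = Γ,
    ∑ S : Splitting G with S.IsPrincipal, BBsplit P S

/-- The operator `𝔹_Γ`, the sum of the `BBcomp P Γ l r` over all `l`, `r`. -/
def BB (P : DoublePoissonBracket k (NCPoly k d)) {n : ℕ} (Γ : AdmissibleGraph n) :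
    PreORing k (NCPoly k d) ⊗[k] PreORing k (NCPoly k d) →ₗ[k] ORing k (NCPoly k d) :=
  TensorProduct.lift <|
    DirectSum.toModule k (ℕ × ℕ) _ fun l => LinearMap.flip <|
      DirectSum.toModule k (ℕ × ℕ) _ fun r => LinearMap.flip <|
        TensorProduct.curry <|
          DirectSum.lof k ℕ (OComp k (NCPoly k d)) (l.1 + r.1) ∘ₗ BBcomp P Γ l r

end Operators

/-! ## Representation spaces -/

section Rep

variable {k : Type*} [Field k] {d : ℕ}

/-- The coordinate ring `𝕜[x_{a,p,q}]` of the representation space `Rep_N(𝕜⟨x_1, …, x_d⟩)`. -/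
abbrev RepRing (k : Type*) [Field k] (d N : ℕ) : Type _ :=
  MvPolynomial (Fin d × Fin N × Fin N) k

/-- The universal representation, which sends `x_a` to the matrix `(x_{a,p,q})`. The function
`a_{ij}` is the `(i, j)` entry of the image of `a`. -/
def generic (k : Type*) [Field k] (d N : ℕ) :
    NCPoly k d →ₐ[k] Matrix (Fin N) (Fin N) (RepRing k d N) :=
  FreeAlgebra.lift k fun a => Matrix.of fun p q => MvPolynomial.X (a, p, q)

/-- `RepRing` represents the functor `R ↦ Hom(A, Mat_N(R))`. -/
theorem generic_universal (d N : ℕ) {R : Type*} [CommRing R] [Algebra k R]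
    (ρ : NCPoly k d →ₐ[k] Matrix (Fin N) (Fin N) R) :
    ∃! φ : RepRing k d N →ₐ[k] R, φ.mapMatrix.comp (generic k d N) = ρ := by
  refine ⟨MvPolynomial.aeval fun s => ρ (FreeAlgebra.ι k s.1) s.2.1 s.2.2, ?_, fun φ hφ => ?_⟩
  · refine FreeAlgebra.hom_ext (funext fun a => ?_)
    ext p q
    simp [generic]
  · refine MvPolynomial.algHom_ext fun s => ?_
    rw [← hφ]
    simp [generic]

/-- `a ↦ a_{ij}`. -/
def entry (k : Type*) [Field k] (d N : ℕ) (i j : Fin N) : NCPoly k d →ₗ[k] RepRing k d N :=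
  Matrix.entryLinearMap k _ i j ∘ₗ (generic k d N).toLinearMap

/-- `tr : A_♮ → 𝒪(Rep_N(A))`. -/
def trace (k : Type*) [Field k] (d N : ℕ) : ANat k (NCPoly k d) →ₗ[k] RepRing k d N :=
  (commutators k (NCPoly k d)).liftQ
    (Matrix.traceLinearMap (Fin N) k (RepRing k d N) ∘ₗ (generic k d N).toLinearMap) (by
      rw [commutators, Submodule.span_le]
      rintro _ ⟨a, b, rfl⟩
      simp [Matrix.trace_mul_comm (generic k d N a)])

/-- The linear map `α ↦ α_{𝐢𝐣}` on `O(A)^{(m)}`: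
`(a ⊗ f₁ ⋯ fₛ ⊗ u)_{𝐢𝐣} = ∏ₜ (a_t)_{i_{u⁻¹(t)} j_t} · tr(f₁) ⋯ tr(fₛ)`. -/
def indexed {m : ℕ} (N : ℕ) (i j : Fin m → Fin N) :
    OComp k (NCPoly k d) m →ₗ[k] RepRing k d N :=
  TensorProduct.lift <| LinearMap.flip <|
    Finsupp.linearCombination k (fun u : Equiv.Perm (Fin m) =>
      LinearMap.mul' k (RepRing k d N) ∘ₗ TensorProduct.map
        (PiTensorProduct.lift ((MultilinearMap.mkPiAlgebra k (Fin m) (RepRing k d N)).compLinearMap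
          fun t => entry k d N (i (u⁻¹ t)) (j t)))
        (SymmetricAlgebra.lift (trace k d N)).toLinearMap) ∘ₗ
    (MonoidAlgebra.coeffLinearEquiv k).toLinearMap

/-- The map `a ⊗ b ↦ a_{ij} b_{pq}`. -/
def entry₂ (k : Type*) [Field k] (d N : ℕ) (i j p q : Fin N) :
    NCPoly k d ⊗[k] NCPoly k d →ₗ[k] RepRing k d N :=
  LinearMap.mul' k _ ∘ₗ TensorProduct.map (entry k d N i j) (entry k d N p q)

/-- The Poisson bracket on `𝒪(Rep_N(A))` induced by a double Poisson bracket: the biderivation with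
`{(x_a)_{ij}, (x_b)_{pq}} = {{x_a, x_b}}'_{pj} {{x_a, x_b}}''_{iq}`. -/
def repBracket {N : ℕ} (P : DoublePoissonBracket k (NCPoly k d)) (F H : RepRing k d N) :
    RepRing k d N :=
  ∑ s : Fin d × Fin N × Fin N, ∑ t : Fin d × Fin N × Fin N,
    MvPolynomial.pderiv s F * MvPolynomial.pderiv t H *
      entry₂ k d N t.2.1 s.2.2 s.2.1 t.2.2
        (P.br (FreeAlgebra.ι k s.1) (FreeAlgebra.ι k t.1))

/-- `∏_e ∂_{ℐ(e)} F` over the edges `e` of `Γ` terminating at the vertex `v`. -/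
def derivAt {n N : ℕ} (Γ : AdmissibleGraph n)
    (J : EdgeLabel n → Fin d × Fin N × Fin N) (v : GVertex n) (F : RepRing k d N) :
    RepRing k d N :=
  ((List.finRange n ×ˢ List.finRange 2).filter fun e => Γ.target e = v).foldr
    (fun e H => MvPolynomial.pderiv (J e) H) F

/-- Kontsevich's bidifferential operator `B_Γ` for the bracket `repBracket P`. -/
def kontsevichB {n N : ℕ} (P : DoublePoissonBracket k (NCPoly k d)) (Γ : AdmissibleGraph n)
    (F H : RepRing k d N) : RepRing k d N :=
  ∑ J : EdgeLabel n → Fin d × Fin N × Fin N,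
    (∏ b : Fin n, derivAt Γ J (GVertex.num b)
      (repBracket P (MvPolynomial.X (J (b, 0))) (MvPolynomial.X (J (b, 1))))) *
      derivAt Γ J GVertex.L F * derivAt Γ J GVertex.R H

end Rep

end DiTwisted

end

open scoped TensorProduct DirectSum

noncomputable section

namespace DiTwisted

/-! ## Iterated derivatives of matrix entries -/

section DoubleDerivations

variable {k A : Type*} [Field k] [Ring A] [Algebra k A]

/-! On the representation spaces the theorem is a matter of contracting indices. A derivative of an
entry is `∂_{a,pq} f_{ij} = (∂_a f)'_{ip} (∂_a f)''_{qj}` (`pderiv_entry`). Since double derivatives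
coassociate, deriving an entry repeatedly gives the sum, over all orderings of the letters, of the
chains of entries `wordEntry` (`pderiv_wordEntry`). Once the traces in the two arguments are written
as sums of diagonal entries, each factor of `B_Γ` is a product over the vertices of a double graph
that merge into one vertex of `Γ`. The Leibniz rule (`prod_foldr_eq_sum_wordFamilies`) then turns
`B_Γ` into a sum over families of words in which every edge label occurs once, at a vertex lying
over its endpoint.

Such a family is a double admissible graph over `Γ` together with an ordering of each set `E(v)`.
The combinatorial core is that these orderings are the same thing as principal splittings. The words
prescribe what comes next after every Sweedler component (slot). If the end of a path is identified
with the initial slot of the same outer vertex, this successor map is an injective self-map of a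
finite set, so it decomposes into paths and cycles (`exists_splitting_word`). Conversely, a
principal splitting is determined by its words (`Splitting.eq_of_word`). Both directions enter
`sum_wordFamilies`.

In the coordinate `(I e, p, q)` of a proper edge `e`, assign `p` to the reflected edge, `q` to `e`
itself, and the diagonal index of a trace to the loop. Summing over coordinates and trace indices
becomes summing over `I` and over labellings `κ` of all edges (`edgeCoordEquiv`). The row index of a
slot is the label of the edge leading to it and its column index is the label of the next edge, so
the sum over `κ` multiplies matrices along the paths and takes traces along the cycles
(`sum_prod_slots`). This is the function of `𝔹_{Γ,S}`, and the identity holds on representatives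
(`kontsevichB_indexed`).

Consequently the functions of `𝔹_Γ(x, y)` depend only on the images of `x` and `y` in `O(A)`, and
the descent follows once the functions `α_{𝐢𝐣}`, for all `N`, separate `O(A)`
(`eq_zero_of_indexed_eq_zero`). A suitable representation isolates a single coefficient in `S(A_♮)`,
and an arbitrary direct summand may be added to it. Trace functionals are closed under addition and
separate `A_♮` in characteristic zero (`eq_zero_of_forall_traceFunctionals`). They are therefore
Zariski dense with respect to any finite set of coordinates, and the coefficient vanishes
(`eq_zero_of_lift_add_eq_zero`). -/

theorem assoc_mul_one_tmul (s : (A ⊗[k] A) ⊗[k] A) (g : A) :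
    TensorProduct.assoc k _ _ _ (s * (1 ⊗ₜ[k] g)) =
      TensorProduct.assoc k _ _ _ s * ((1 : A) ⊗ₜ[k] ((1 : A) ⊗ₜ[k] g)) := by
  induction s with
  | zero => simp
  | tmul x y =>
    induction x with
    | zero => simp
    | tmul u v => simp [Algebra.TensorProduct.one_def]
    | add u v hu hv => simp only [add_mul, TensorProduct.add_tmul, map_add, hu, hv]
  | add x y hx hy => simp only [add_mul, map_add, hx, hy]

variable {δ ε : A →ₗ[k] A ⊗[k] A}

theorem rTensor_mul_one_tmul (t : A ⊗[k] A) (g : A) :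
    δ.rTensor A (t * (1 ⊗ₜ[k] g)) = δ.rTensor A t * (1 ⊗ₜ[k] g) := by
  induction t with
  | zero => simp
  | tmul x y => simp
  | add x y hx hy => simp only [add_mul, map_add, hx, hy]

theorem rTensor_tmul_one_mul
    (hδ : ∀ f g, δ (f * g) = δ f * ((1 : A) ⊗ₜ[k] g) + (f ⊗ₜ[k] (1 : A)) * δ g)
    (f : A) (t : A ⊗[k] A) :
    TensorProduct.assoc k _ _ _ (δ.rTensor A ((f ⊗ₜ[k] (1 : A)) * t)) =
      TensorProduct.assoc k _ _ _ (δ f ⊗ₜ[k] (1 : A)) * (1 ⊗ₜ[k] t) +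
        (f ⊗ₜ[k] 1) * TensorProduct.assoc k _ _ _ (δ.rTensor A t) := by
  induction t with
  | zero => simp
  | tmul x y =>
    simp only [Algebra.TensorProduct.tmul_mul_tmul, LinearMap.rTensor_tmul, hδ, one_mul,
      TensorProduct.add_tmul, map_add]
    congr 1
    · induction δ f with
      | zero => simp
      | tmul u v => simp
      | add u v hu hv => simp only [add_mul, TensorProduct.add_tmul, map_add, hu, hv]
    · induction δ x with
      | zero => simp
      | tmul u v => simp [Algebra.TensorProduct.one_def]
      | add u v hu hv => simp only [mul_add, TensorProduct.add_tmul, map_add, hu, hv]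
  | add x y hx hy =>
    simp only [mul_add, map_add, hx, hy, TensorProduct.tmul_add]
    abel

theorem lTensor_tmul_one_mul (f : A) (t : A ⊗[k] A) :
    ε.lTensor A ((f ⊗ₜ[k] (1 : A)) * t) = (f ⊗ₜ[k] 1) * ε.lTensor A t := by
  induction t with
  | zero => simp
  | tmul x y => simp
  | add x y hx hy => simp only [mul_add, map_add, hx, hy]

theorem lTensor_mul_one_tmul
    (hε : ∀ f g, ε (f * g) = ε f * ((1 : A) ⊗ₜ[k] g) + (f ⊗ₜ[k] (1 : A)) * ε g)
    (t : A ⊗[k] A) (g : A) :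
    ε.lTensor A (t * ((1 : A) ⊗ₜ[k] g)) =
      ε.lTensor A t * (1 ⊗ₜ[k] (1 ⊗ₜ[k] g)) +
        TensorProduct.assoc k _ _ _ (t ⊗ₜ[k] (1 : A)) * (1 ⊗ₜ[k] ε g) := by
  induction t with
  | zero => simp
  | tmul x y =>
    simp only [Algebra.TensorProduct.tmul_mul_tmul, LinearMap.lTensor_tmul, hε, mul_one,
      TensorProduct.tmul_add, TensorProduct.assoc_tmul]
  | add x y hx hy =>
    simp only [add_mul, map_add, hx, hy, TensorProduct.add_tmul]
    abel

/-- Expanding either side by the Leibniz rules yields the same cross term `(δ f ⊗ 1)(1 ⊗ ε g)`; the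
other terms agree by the hypotheses on `f` and `g`. Hence coassociativity only has to be checked on
generators. -/
theorem coassoc_mul
    (hδ : ∀ f g, δ (f * g) = δ f * ((1 : A) ⊗ₜ[k] g) + (f ⊗ₜ[k] (1 : A)) * δ g)
    (hε : ∀ f g, ε (f * g) = ε f * ((1 : A) ⊗ₜ[k] g) + (f ⊗ₜ[k] (1 : A)) * ε g) {f g : A}
    (hf : TensorProduct.assoc k _ _ _ (δ.rTensor A (ε f)) = ε.lTensor A (δ f))
    (hg : TensorProduct.assoc k _ _ _ (δ.rTensor A (ε g)) = ε.lTensor A (δ g)) :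
    TensorProduct.assoc k _ _ _ (δ.rTensor A (ε (f * g))) = ε.lTensor A (δ (f * g)) := by
  rw [hε, hδ, map_add, map_add, map_add, rTensor_mul_one_tmul, rTensor_tmul_one_mul hδ,
    assoc_mul_one_tmul, hf, hg, lTensor_mul_one_tmul hε, lTensor_tmul_one_mul]
  abel

end DoubleDerivations

/-! ### Partial derivatives of the entries of the universal representation. -/

section Derivatives

variable {k : Type*} [Field k] {d : ℕ}

/-- Double derivatives coassociate: `(∂_a ⊗ 1) ∂_b = (1 ⊗ ∂_b) ∂_a`. -/
theorem dpartial_coassoc (a b : Fin d) (f : NCPoly k d) :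
    TensorProduct.assoc k _ _ _ ((dpartial k a).rTensor (NCPoly k d) (dpartial k b f)) =
      (dpartial k b).lTensor (NCPoly k d) (dpartial k a f) := by
  have h1 : ∀ c : Fin d, dpartial k c (1 : NCPoly k d) = 0 := fun c => by simp [dpartial]
  induction f using FreeAlgebra.induction with
  | grade0 c => simp [Algebra.algebraMap_eq_smul_one, h1]
  | grade1 c =>
    rw [dpartial_ι, dpartial_ι]
    split_ifs <;> simp [h1]
  | mul f g hf hg => exact coassoc_mul (dpartial_mul k a) (dpartial_mul k b) hf hg
  | add f g hf hg => simp only [map_add, hf, hg]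

theorem generic_ι (N : ℕ) (a : Fin d) (p q : Fin N) :
    entry k d N p q (FreeAlgebra.ι k a) = MvPolynomial.X (a, p, q) := by
  simp [entry, generic]

theorem entry_one (N : ℕ) (p q : Fin N) :
    entry k d N p q 1 = if p = q then 1 else 0 := by
  simp [entry, Matrix.one_apply]

theorem entry_mul (N : ℕ) (p q : Fin N) (f g : NCPoly k d) :
    entry k d N p q (f * g) = ∑ c, entry k d N p c f * entry k d N c q g := by
  simp [entry, Matrix.mul_apply]

theorem entry₂_tmul (N : ℕ) (i j p q : Fin N) (f g : NCPoly k d) :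
    entry₂ k d N i j p q (f ⊗ₜ[k] g) = entry k d N i j f * entry k d N p q g := rfl

theorem entry₂_mul_right (N : ℕ) (i j p q : Fin N) (t : NCPoly k d ⊗[k] NCPoly k d)
    (g : NCPoly k d) :
    entry₂ k d N i j p q (t * ((1 : NCPoly k d) ⊗ₜ[k] g)) =
      ∑ c, entry₂ k d N i j p c t * entry k d N c q g := by
  induction t with
  | zero => simp
  | tmul x y => simp [entry₂_tmul, entry_mul, Finset.mul_sum, mul_assoc]
  | add x y hx hy => simp only [add_mul, map_add, hx, hy, Finset.sum_add_distrib]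

theorem entry₂_mul_left (N : ℕ) (i j p q : Fin N) (t : NCPoly k d ⊗[k] NCPoly k d)
    (f : NCPoly k d) :
    entry₂ k d N i j p q ((f ⊗ₜ[k] (1 : NCPoly k d)) * t) =
      ∑ c, entry k d N i c f * entry₂ k d N c j p q t := by
  induction t with
  | zero => simp
  | tmul x y => simp [entry₂_tmul, entry_mul, Finset.sum_mul, mul_assoc]
  | add x y hx hy => simp only [mul_add, map_add, hx, hy, Finset.sum_add_distrib]

/-- The partial derivative of a matrix entry: `∂_{a,pq} f_{ij} = (∂_a f)'_{ip} (∂_a f)''_{qj}`. -/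
theorem pderiv_entry (N : ℕ) (i j p q : Fin N) (a : Fin d) (f : NCPoly k d) :
    MvPolynomial.pderiv (a, p, q) (entry k d N i j f) = entry₂ k d N i p q j (dpartial k a f) := by
  have h1 : dpartial k a (1 : NCPoly k d) = 0 := by simp [dpartial]
  induction f using FreeAlgebra.induction generalizing i j with
  | grade0 c =>
    rw [Algebra.algebraMap_eq_smul_one, map_smul, map_smul (dpartial k a), h1,
      Derivation.map_smul, entry_one]
    split_ifs <;> simp
  | grade1 b =>
    rw [generic_ι, dpartial_ι, MvPolynomial.pderiv_X]
    by_cases hb : b = a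
    · subst hb
      simp only [if_true, entry₂_tmul, entry_one, Pi.single_apply, Prod.mk.injEq, true_and]
      by_cases h2 : i = p <;> by_cases h3 : q = j <;> simp [h2, h3, eq_comm (a := j)]
    · simp [hb]
  | mul f g hf hg =>
    simp only [entry_mul, map_sum, Derivation.leibniz, hf, hg, dpartial_mul, map_add,
      entry₂_mul_left, entry₂_mul_right, smul_eq_mul, Finset.sum_add_distrib]
    rw [add_comm]
    simp only [mul_comm]
  | add f g hf hg => simp only [map_add, hf, hg]

variable {E : Type*} {N : ℕ}

/-- The sum of products `f'_{i p(e₁)} f''_{q(e₁) p(e₂)} ⋯ f^{(m+1)}_{q(eₘ) j}` for the iterated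
double derivative of `f` along the word `e₁ ⋯ eₘ`. -/
def wordEntry (I : E → Fin d) (p q : E → Fin N) :
    List E → Fin N → Fin N → NCPoly k d →ₗ[k] RepRing k d N
  | [], i, j => entry k d N i j
  | e :: w, i, j => LinearMap.mul' k _ ∘ₗ
      TensorProduct.map (entry k d N i (p e)) (wordEntry I p q w (q e) j) ∘ₗ dpartial k (I e)

/-- Peeling off the last letter instead of the first one. -/
theorem wordEntry_concat (I : E → Fin d) (p q : E → Fin N) (w : List E) (e : E) (i j : Fin N) :
    (wordEntry I p q (w ++ [e]) i j : NCPoly k d →ₗ[k] RepRing k d N) =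
      LinearMap.mul' k _ ∘ₗ
        TensorProduct.map (wordEntry I p q w i (p e)) (entry k d N (q e) j) ∘ₗ
          dpartial k (I e) := by
  induction w generalizing i with
  | nil => rfl
  | cons e₁ w ih =>
    ext f
    rw [List.cons_append, wordEntry, ih, wordEntry]
    have h := dpartial_coassoc (I e₁) (I e) f
    -- Both ways of peeling factor through the evaluation `m3` of triple tensors, and
    -- coassociativity identifies its two arguments. Peeling from the right is what matches the left
    -- fold in `vertexMap`.
    let m3 : NCPoly k d ⊗[k] (NCPoly k d ⊗[k] NCPoly k d) →ₗ[k] RepRing k d N :=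
      LinearMap.mul' k _ ∘ₗ TensorProduct.map (entry k d N i (p e₁))
        (LinearMap.mul' k _ ∘ₗ TensorProduct.map (wordEntry I p q w (q e₁) (p e))
          (entry k d N (q e) j))
    have h1 : m3 ∘ₗ (dpartial k (I e)).lTensor (NCPoly k d) =
        LinearMap.mul' k _ ∘ₗ TensorProduct.map (entry k d N i (p e₁))
          (LinearMap.mul' k _ ∘ₗ TensorProduct.map (wordEntry I p q w (q e₁) (p e))
            (entry k d N (q e) j) ∘ₗ dpartial k (I e)) := by
      apply TensorProduct.ext'
      intro x y
      rfl
    have h2 : m3 ∘ₗ (TensorProduct.assoc k _ _ _).toLinearMap ∘ₗ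
        (dpartial k (I e₁)).rTensor (NCPoly k d) =
        LinearMap.mul' k _ ∘ₗ TensorProduct.map (LinearMap.mul' k _ ∘ₗ
          TensorProduct.map (entry k d N i (p e₁)) (wordEntry I p q w (q e₁) (p e)) ∘ₗ
            dpartial k (I e₁)) (entry k d N (q e) j) := by
      apply TensorProduct.ext'
      intro x y
      simp only [LinearMap.comp_apply, LinearMap.rTensor_tmul, TensorProduct.map_tmul,
        LinearEquiv.coe_coe, LinearMap.mul'_apply, m3]
      induction dpartial k (I e₁) x with
      | zero => simp
      | tmul u v => simp [mul_assoc]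
      | add u v hu hv => simp only [TensorProduct.add_tmul, map_add, hu, hv, add_mul]
    have h3 := congrArg m3 h
    have h4 := LinearMap.congr_fun h1 (dpartial k (I e₁) f)
    have h5 := LinearMap.congr_fun h2 (dpartial k (I e) f)
    simp only [LinearMap.comp_apply] at h4 h5 ⊢
    rw [← h4, ← h5, ← h3]
    rfl

/-- Leibniz rule for `wordEntry`: the new letter is inserted at all positions. -/
theorem pderiv_wordEntry (I : E → Fin d) (p q : E → Fin N) (e : E) (w : List E) (i j : Fin N)
    (f : NCPoly k d) :
    MvPolynomial.pderiv (I e, p e, q e) (wordEntry I p q w i j f) =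
      ((List.permutations'Aux e w).map fun w' => wordEntry I p q w' i j f).sum := by
  induction w generalizing i f with
  | nil => simp [wordEntry, pderiv_entry, entry₂]
  | cons e₁ w ih =>
    have h := dpartial_coassoc (I e) (I e₁) f
    -- The derivative hits either the first factor or the rest. In the first case coassociativity
    -- turns the result into the word with `e` put before `e₁`; the second case inserts `e` at the
    -- later positions by induction.
    let m3 : NCPoly k d ⊗[k] (NCPoly k d ⊗[k] NCPoly k d) →ₗ[k] RepRing k d N :=
      LinearMap.mul' k _ ∘ₗ TensorProduct.map (entry k d N i (p e))
        (LinearMap.mul' k _ ∘ₗ TensorProduct.map (entry k d N (q e) (p e₁))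
          (wordEntry I p q w (q e₁) j))
    have h1 : ∀ t, m3 ((dpartial k (I e₁)).lTensor (NCPoly k d) t) =
        LinearMap.mul' k _ (TensorProduct.map (entry k d N i (p e))
          (wordEntry I p q (e₁ :: w) (q e) j) t) := by
      intro t
      induction t with
      | zero => simp
      | tmul x y => rfl
      | add u v hu hv => simp only [map_add, hu, hv]
    have h2 : ∀ t, MvPolynomial.pderiv (I e, p e, q e) (LinearMap.mul' k _
          (TensorProduct.map (entry k d N i (p e₁)) (wordEntry I p q w (q e₁) j) t)) =
        m3 (TensorProduct.assoc k _ _ _ ((dpartial k (I e)).rTensor (NCPoly k d) t)) +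
        ((List.permutations'Aux e w).map fun w' => LinearMap.mul' k _
          (TensorProduct.map (entry k d N i (p e₁)) (wordEntry I p q w' (q e₁) j) t)).sum := by
      intro t
      induction t with
      | zero => simp
      | tmul x y =>
        simp only [TensorProduct.map_tmul, LinearMap.mul'_apply, Derivation.leibniz, ih,
          smul_eq_mul, pderiv_entry, LinearMap.rTensor_tmul, List.sum_map_mul_left]
        rw [add_comm]
        congr 1
        induction dpartial k (I e) x with
        | zero => simp
        | tmul u v =>
          simp only [entry₂_tmul, TensorProduct.assoc_tmul, LinearMap.comp_apply,
            TensorProduct.map_tmul, LinearMap.mul'_apply, m3]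
          ring
        | add u v hu hv =>
          simp only [TensorProduct.add_tmul, map_add, hu, hv, mul_add]
      | add u v hu hv =>
        simp only [map_add, hu, hv, List.sum_map_add]
        abel
    rw [wordEntry, LinearMap.comp_apply, LinearMap.comp_apply, h2, h, h1, List.permutations'Aux,
      List.map_cons, List.sum_cons, List.map_map]
    rfl

end Derivatives

/-! ## Distributing derivatives over the factors of a product -/

section Leibniz

variable {E V B : Type*} [DecidableEq V] [Fintype V] [DecidableEq B]

/-- The families of words in the letters of `l`, indexed by `V`, in which each letter occurs once,
and the letter `e` occurs in the word of some `v` with `m v = T e`. -/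
def wordFamilies (T : E → B) (m : V → B) : List E → List (V → List E)
  | [] => [fun _ => []]
  | e :: l => (wordFamilies T m l).flatMap fun W =>
      ((Finset.univ.filter fun v => m v = T e).toList).flatMap fun v =>
        (List.permutations'Aux e (W v)).map (Function.update W v)

theorem sum_flatMap {α R : Type*} [AddCommMonoid R] (l : List α) (f : α → List R) :
    (l.flatMap f).sum = (l.map fun a => (f a).sum).sum := by
  induction l with
  | nil => rfl
  | cons a l ih => rw [List.flatMap_cons, List.sum_append, ih, List.map_cons, List.sum_cons]

/-- The iterated Leibniz rule, for products of factors in blocks. -/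
theorem prod_foldr_eq_sum_wordFamilies [Fintype B] {R : Type*} [CommRing R] (T : E → B) (m : V → B)
    (D : E → R →+ R) (Ψ : B → (V → List E) → R)
    (hstep : ∀ e W, D e (Ψ (T e) W) = ∑ v with m v = T e,
      ((List.permutations'Aux e (W v)).map fun w => Ψ (T e) (Function.update W v w)).sum)
    (hother : ∀ b W v w, m v ≠ b → Ψ b (Function.update W v w) = Ψ b W)
    (l : List E) (ev : B → R →+ R) :
    ∏ b, ev b ((l.filter fun e => T e = b).foldr (fun e H => D e H) (Ψ b fun _ => [])) =
      ((wordFamilies T m l).map fun W => ∏ b, ev b (Ψ b W)).sum := by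
  induction l generalizing ev with
  | nil => simp [wordFamilies]
  | cons e l ih =>
    -- In the `foldr` the derivative along the first letter is applied last, so it is absorbed into
    -- the outer additive map of its block. The family `ev` is in the statement for this purpose.
    have h := ih (Function.update ev (T e) ((ev (T e)).comp (D e)))
    have h1 : ∀ F : B → R, ∏ b, (Function.update ev (T e) ((ev (T e)).comp (D e))) b (F b) =
        ev (T e) (D e (F (T e))) * ∏ b ∈ Finset.univ.erase (T e), ev b (F b) := by
      intro F
      rw [← Finset.mul_prod_erase _ _ (Finset.mem_univ (T e))]
      congr 1
      · simp
      · exact Finset.prod_congr rfl fun b hb => by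
          rw [Function.update_of_ne (Finset.ne_of_mem_erase hb)]
    rw [h1] at h
    rw [← Finset.mul_prod_erase _ _ (Finset.mem_univ (T e))]
    have h2 : ∏ b ∈ Finset.univ.erase (T e),
        ev b (((e :: l).filter fun e => T e = b).foldr (fun e H => D e H) (Ψ b fun _ => [])) =
        ∏ b ∈ Finset.univ.erase (T e),
          ev b ((l.filter fun e => T e = b).foldr (fun e H => D e H) (Ψ b fun _ => [])) := by
      refine Finset.prod_congr rfl fun b hb => ?_
      rw [List.filter_cons_of_neg (by simpa using (Finset.ne_of_mem_erase hb).symm)]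
    rw [h2, List.filter_cons_of_pos (by simp), List.foldr_cons, h, wordFamilies, List.map_flatMap,
      sum_flatMap]
    congr 1
    refine List.map_congr_left fun W _ => ?_
    rw [h1, hstep, map_sum, Finset.sum_mul, List.map_flatMap, sum_flatMap, Finset.sum_map_toList]
    refine Finset.sum_congr rfl fun v hv => ?_
    have hv' : m v = T e := by simpa using hv
    rw [map_list_sum, List.map_map, ← List.sum_map_mul_right, List.map_map]
    congr 1
    refine List.map_congr_left fun w _ => ?_
    simp only [Function.comp_apply]
    rw [← Finset.mul_prod_erase _ _ (Finset.mem_univ (T e))]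
    congr 1
    refine Finset.prod_congr rfl fun b hb => ?_
    rw [hother]
    rw [hv']
    exact (Finset.ne_of_mem_erase hb).symm

theorem mem_permutations'Aux {e : E} {w w' : List E} :
    w' ∈ List.permutations'Aux e w ↔ ∃ a b, w = a ++ b ∧ w' = a ++ e :: b := by
  induction w generalizing w' with
  | nil => simp [List.permutations'Aux]
  | cons x w ih =>
    simp only [List.permutations'Aux, List.mem_cons, List.mem_map, ih]
    constructor
    · rintro (rfl | ⟨_, ⟨a, b, rfl, rfl⟩, rfl⟩)
      · exact ⟨[], _, rfl, rfl⟩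
      · exact ⟨x :: a, b, rfl, rfl⟩
    · rintro ⟨a, b, h1, rfl⟩
      rcases a with _ | ⟨y, a⟩
      · left
        simp_all
      · right
        simp only [List.cons_append, List.cons.injEq] at h1
        obtain ⟨rfl, rfl⟩ := h1
        exact ⟨_, ⟨a, b, rfl, rfl⟩, rfl⟩

theorem perm_of_mem_permutations'Aux {e : E} {w w' : List E}
    (h : w' ∈ List.permutations'Aux e w) : w'.Perm (e :: w) := by
  obtain ⟨a, b, rfl, rfl⟩ := mem_permutations'Aux.mp h
  exact List.perm_middle

theorem erase_of_mem_permutations'Aux [DecidableEq E] {e : E} {w w' : List E}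
    (h : w' ∈ List.permutations'Aux e w) (he : e ∉ w) : w'.erase e = w := by
  obtain ⟨a, b, rfl, rfl⟩ := mem_permutations'Aux.mp h
  rw [List.erase_append_right _ fun h => he (List.mem_append_left _ h)]
  simp

theorem mem_permutations'Aux_erase [DecidableEq E] {e : E} {w : List E} (h : e ∈ w) :
    w ∈ List.permutations'Aux e (w.erase e) := by
  obtain ⟨a, b, ha, hw, he⟩ := List.exists_erase_eq h
  exact mem_permutations'Aux.mpr ⟨a, b, he, hw⟩

/-- Replaces the recursive construction by an intrinsic description: each letter of `l` occurs
exactly once, in a word of the prescribed block. In this form the families can be compared with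
splittings. -/
theorem mem_wordFamilies [DecidableEq E] {T : E → B} {m : V → B} {l : List E} (hl : l.Nodup) {W : V → List E} :
    W ∈ wordFamilies T m l ↔ (∀ v, (W v).Nodup) ∧ (∀ v, ∀ e ∈ W v, m v = T e ∧ e ∈ l) ∧
      (∀ e ∈ l, ∃ v, e ∈ W v) ∧ ∀ v v' e, e ∈ W v → e ∈ W v' → v = v' := by
  induction l generalizing W with
  | nil =>
    simp only [wordFamilies, List.mem_singleton, List.not_mem_nil, and_false, false_imp_iff,
      implies_true, true_and]
    constructor
    · rintro rfl
      simp
    · rintro ⟨_, h, _⟩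
      exact funext fun v => List.eq_nil_iff_forall_not_mem.mpr (h v)
  | cons e l ih =>
    rw [List.nodup_cons] at hl
    simp only [wordFamilies, List.mem_flatMap, ih hl.2, Finset.mem_toList, Finset.mem_filter,
      Finset.mem_univ, true_and, List.mem_map]
    constructor
    · rintro ⟨W', ⟨h1, h2, h3, h4⟩, v, hv, w, hw, rfl⟩
      have hp := perm_of_mem_permutations'Aux hw
      have he : ∀ u, e ∉ W' u := fun u hu => hl.1 (h2 u e hu).2
      have key : ∀ u x, x ∈ Function.update W' v w u ↔ x ∈ W' u ∨ (x = e ∧ u = v) := by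
        intro u x
        rcases eq_or_ne u v with rfl | hu
        · rw [Function.update_self, hp.mem_iff, List.mem_cons]
          tauto
        · rw [Function.update_of_ne hu]
          tauto
      refine ⟨fun u => ?_, fun u x hx => ?_, fun x hx => ?_, fun u u' x hx hx' => ?_⟩
      · rcases eq_or_ne u v with rfl | hu
        · rw [Function.update_self, hp.nodup_iff, List.nodup_cons]
          exact ⟨he u, h1 u⟩
        · rw [Function.update_of_ne hu]
          exact h1 u
      · rcases (key u x).mp hx with h | ⟨rfl, rfl⟩
        · exact ⟨(h2 u x h).1, List.mem_cons_of_mem _ (h2 u x h).2⟩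
        · exact ⟨hv, List.mem_cons_self⟩
      · rcases List.mem_cons.mp hx with rfl | hx
        · exact ⟨v, (key v x).mpr (Or.inr ⟨rfl, rfl⟩)⟩
        · obtain ⟨u, hu⟩ := h3 x hx
          exact ⟨u, (key u x).mpr (Or.inl hu)⟩
      · rcases (key u x).mp hx with h | ⟨rfl, rfl⟩ <;>
          rcases (key u' x).mp hx' with h' | ⟨h', rfl⟩
        · exact h4 _ _ _ h h'
        · exact absurd (h' ▸ h) (he u)
        · exact absurd h' (he u')
        · rfl
    · rintro ⟨h1, h2, h3, h4⟩
      obtain ⟨v, hv⟩ := h3 e List.mem_cons_self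
      have key : ∀ u x, x ∈ Function.update W v ((W v).erase e) u ↔ x ∈ W u ∧ x ≠ e := by
        intro u x
        rcases eq_or_ne u v with rfl | hu
        · rw [Function.update_self, (h1 u).mem_erase_iff]
          tauto
        · rw [Function.update_of_ne hu]
          exact ⟨fun hx => ⟨hx, fun he => hu (h4 _ _ _ (he ▸ hx) hv)⟩, And.left⟩
      -- The family before the insertion of `e` is recovered by erasing `e` from the only word that
      -- contains it.
      refine ⟨Function.update W v ((W v).erase e), ⟨fun u => ?_, fun u x hx => ?_, fun x hx => ?_,
        fun u u' x hx hx' => ?_⟩, v, (h2 v e hv).1, W v, ?_, by simp⟩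
      · rcases eq_or_ne u v with rfl | hu
        · rw [Function.update_self]
          exact (h1 u).erase e
        · rw [Function.update_of_ne hu]
          exact h1 u
      · obtain ⟨hx, hne⟩ := (key u x).mp hx
        exact ⟨(h2 u x hx).1, List.mem_of_ne_of_mem hne (h2 u x hx).2⟩
      · obtain ⟨u, hu⟩ := h3 x (List.mem_cons_of_mem _ hx)
        exact ⟨u, (key u x).mpr ⟨hu, fun he => hl.1 (he ▸ hx)⟩⟩
      · exact h4 _ _ _ ((key u x).mp hx).1 ((key u' x).mp hx').1
      · rw [Function.update_self]
        exact mem_permutations'Aux_erase hv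

/-- Insertion of a new letter `e` can be undone by erasing it, and the vertex of insertion is the
one whose word contains `e`. So no family is listed twice, and the sum over the list is a sum over a
finite set. -/
theorem nodup_wordFamilies [DecidableEq E] (T : E → B) (m : V → B) {l : List E} (hl : l.Nodup) :
    (wordFamilies T m l).Nodup := by
  induction l with
  | nil => simp [wordFamilies]
  | cons e l ih =>
    rw [List.nodup_cons] at hl
    have he : ∀ W ∈ wordFamilies T m l, ∀ u, e ∉ W u := fun W hW u hu =>
      hl.1 (((mem_wordFamilies hl.2).mp hW).2.1 u e hu).2
    rw [wordFamilies, List.nodup_flatMap]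
    constructor
    · intro W hW
      rw [List.nodup_flatMap]
      constructor
      · intro v _
        exact (List.nodup_permutations'Aux_of_notMem _ _ (he W hW v)).map
          (Function.update_injective W v)
      · refine (Finset.nodup_toList _).imp fun {v v'} hne => ?_
        rw [Function.onFun, List.disjoint_left]
        rintro _ h h'
        obtain ⟨w, hw, rfl⟩ := List.mem_map.mp h
        obtain ⟨w', hw', h2⟩ := List.mem_map.mp h'
        have h3 := congrFun h2 v
        rw [Function.update_self, Function.update_of_ne hne] at h3
        refine he W hW v ?_
        rw [h3, (perm_of_mem_permutations'Aux hw).mem_iff]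
        exact List.mem_cons_self
    · refine (ih hl.2).imp_of_mem fun {W W'} hW hW' hne => ?_
      rw [Function.onFun, List.disjoint_left]
      intro U h h'
      refine hne ?_
      have key : ∀ W ∈ wordFamilies T m l, U ∈ ((Finset.univ.filter fun v => m v = T e).toList.flatMap
          fun v => (List.permutations'Aux e (W v)).map (Function.update W v)) →
          W = fun v => (U v).erase e := by
        intro W hW hU
        obtain ⟨v, _, hU⟩ := List.mem_flatMap.mp hU
        obtain ⟨w, hw, rfl⟩ := List.mem_map.mp hU
        funext u
        rcases eq_or_ne u v with rfl | hu
        · rw [Function.update_self, erase_of_mem_permutations'Aux hw (he W hW u)]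
        · rw [Function.update_of_ne hu, List.erase_of_not_mem (he W hW u)]
      rw [key W hW h, ← key W' hW' h']

end Leibniz

/-! ## Slots, rows and columns -/

section Slots

variable {n : ℕ} {l r : ℕ × ℕ}

/-- The vertex to which a slot belongs. -/
def slotVertex (G : DoubleGraph n l r) : Slot n l r → DVertex n l r
  | .inl t => outerVertex n l r t
  | .inr e => G.tgt e

theorem slotVertex_zeroSlot (G : DoubleGraph n l r) (v : DVertex n l r) :
    slotVertex G (zeroSlot v) = v := by
  cases v <;> simp [slotVertex, zeroSlot, outerVertex, DoubleGraph.tgt]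

/-- The components at a vertex are `X^{(0)}` and the `X^{(e)}` for the proper edges `e` that end
there; every other edge ending at the vertex leads to `X^{(0)}`. -/
theorem eq_zeroSlot_or_proper (G : DoubleGraph n l r) (s : Slot n l r) :
    s = zeroSlot (slotVertex G s) ∨ ∃ e, s = .inr (.proper e) := by
  rcases s with t | e
  · left
    refine Fin.addCases (fun t => ?_) (fun t => ?_) t <;>
      simp [slotVertex, zeroSlot, outerVertex]
  · cases e <;> simp [slotVertex, zeroSlot, DoubleGraph.tgt]

theorem zeroSlot_ne_proper (v : DVertex n l r) (e : EdgeLabel n) :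
    (zeroSlot v : Slot n l r) ≠ .inr (.proper e) := by
  cases v <;> simp [zeroSlot]

/-- The position of a slot in the word of its vertex. -/
def slotPos (G : DoubleGraph n l r) (W : DVertex n l r → List (EdgeLabel n)) : Slot n l r → ℕ
  | .inr (.proper e) => (W (G.target e)).idxOf e + 1
  | _ => 0

theorem slotPos_zeroSlot (G : DoubleGraph n l r) (W : DVertex n l r → List (EdgeLabel n))
    (v : DVertex n l r) : slotPos G W (zeroSlot v) = 0 := by
  cases v <;> rfl

/-- The unreflected edge that starts at a vertex, if there is one. -/
def exitEdge : DVertex n l r → Option (DEdge n l r)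
  | .num x => some (.proper x)
  | .left _ => none
  | .right _ => none
  | .leftLoop p => some (.leftLoop p)
  | .rightLoop q => some (.rightLoop q)

/-- The edge that has to follow a slot when the words of the vertices are given. -/
def nextEdge (G : DoubleGraph n l r) (W : DVertex n l r → List (EdgeLabel n)) (s : Slot n l r) :
    Option (DEdge n l r) :=
  ((W (slotVertex G s))[slotPos G W s]?).elim (exitEdge (slotVertex G s)) fun e => some (.refl e)

/-- The words `W v` are orderings of the sets `E(v)`. -/
def IsOrdering (G : DoubleGraph n l r) (W : DVertex n l r → List (EdgeLabel n)) : Prop :=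
  (∀ v, (W v).Nodup) ∧ ∀ v e, e ∈ W v ↔ G.target e = v

variable {N : ℕ}

/-- The column index at the end of the word of a vertex. -/
def exitIdx (j : Fin (l.1 + r.1) → Fin N) (κ : DEdge n l r → Fin N) : DVertex n l r → Fin N
  | .num x => κ (.proper x)
  | .left t => j (Fin.castAdd r.1 t)
  | .right s => j (Fin.natAdd l.1 s)
  | .leftLoop p => κ (.leftLoop p)
  | .rightLoop q => κ (.rightLoop q)

theorem exitIdx_outerVertex (j : Fin (l.1 + r.1) → Fin N) (κ : DEdge n l r → Fin N)
    (t : Fin (l.1 + r.1)) : exitIdx j κ (outerVertex n l r t) = j t := by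
  refine Fin.addCases (fun t => ?_) (fun t => ?_) t <;> simp [outerVertex, exitIdx]

/-- The row index of a slot. -/
def slotRow (i : Fin (l.1 + r.1) → Fin N) (κ : DEdge n l r → Fin N) : Slot n l r → Fin N :=
  Sum.elim i κ

/-- The column index of a slot: the row index of the edge which comes next. -/
def slotCol (j : Fin (l.1 + r.1) → Fin N) (κ : DEdge n l r → Fin N) (G : DoubleGraph n l r)
    (next : Slot n l r → Option (DEdge n l r)) (s : Slot n l r) : Fin N :=
  (next s).elim (exitIdx j κ (slotVertex G s)) κ

theorem slotCol_nextEdge_of_some {j : Fin (l.1 + r.1) → Fin N} {κ : DEdge n l r → Fin N}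
    {G : DoubleGraph n l r} {W : DVertex n l r → List (EdgeLabel n)} {s : Slot n l r}
    {e : EdgeLabel n} (h : (W (slotVertex G s))[slotPos G W s]? = some e) :
    slotCol j κ G (nextEdge G W) s = κ (.refl e) := by
  simp [slotCol, nextEdge, h]

theorem slotCol_nextEdge_of_none {j : Fin (l.1 + r.1) → Fin N} {κ : DEdge n l r → Fin N}
    {G : DoubleGraph n l r} {W : DVertex n l r → List (EdgeLabel n)} {s : Slot n l r}
    (h : (W (slotVertex G s))[slotPos G W s]? = none) :
    slotCol j κ G (nextEdge G W) s = exitIdx j κ (slotVertex G s) := by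
  simp only [slotCol, nextEdge, h, Option.elim_none]
  cases slotVertex G s <;> rfl

/-- The column indices of the slots along a word, with the last one equal to `c`. -/
def ColChain (col : Slot n l r → Fin N) (κ : DEdge n l r → Fin N) (c : Fin N) :
    Slot n l r → List (EdgeLabel n) → Prop
  | s, [] => col s = c
  | s, e :: w => col s = κ (.refl e) ∧ ColChain col κ c (.inr (.proper e)) w

theorem colChain_concat {col : Slot n l r → Fin N} {κ : DEdge n l r → Fin N} {c : Fin N}
    {s : Slot n l r} {w : List (EdgeLabel n)} {e : EdgeLabel n} :
    ColChain col κ c s (w ++ [e]) ↔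
      ColChain col κ (κ (.refl e)) s w ∧ col (.inr (.proper e)) = c := by
  induction w generalizing s with
  | nil => simp [ColChain]
  | cons x w ih => simp [ColChain, ih, and_assoc]

/-- In an ordering the slot of a letter is followed by the reflected edge of the next letter, and
the last slot by the exit from the vertex. Hence the column indices along the word are those that
`wordEntry` expects. -/
theorem colChain_slotCol {G : DoubleGraph n l r} {W : DVertex n l r → List (EdgeLabel n)}
    (hW : IsOrdering G W) (j : Fin (l.1 + r.1) → Fin N) (κ : DEdge n l r → Fin N)
    (v : DVertex n l r) :
    ColChain (slotCol j κ G (nextEdge G W)) κ (exitIdx j κ v) (zeroSlot v) (W v) := by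
  -- Induction on the part `w` of the word that remains after `pre`. Absence of repetitions
  -- guarantees that the slot reached after `pre` has position `pre.length`.
  have key : ∀ (w pre : List (EdgeLabel n)) (s : Slot n l r), W v = pre ++ w →
      slotVertex G s = v → slotPos G W s = pre.length →
      ColChain (slotCol j κ G (nextEdge G W)) κ (exitIdx j κ v) s w := by
    intro w
    induction w with
    | nil =>
      intro pre s h1 h2 h3
      rw [ColChain, slotCol_nextEdge_of_none, h2]
      rw [h2, h3, h1]
      simp
    | cons e w ih =>
      intro pre s h1 h2 h3
      refine ⟨slotCol_nextEdge_of_some ?_, ih (pre ++ [e]) _ (by simpa using h1) ?_ ?_⟩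
      · rw [h2, h3, h1]
        simp
      · exact (hW.2 v e).mp (by simp [h1])
      · have hv : G.target e = v := (hW.2 v e).mp (by simp [h1])
        have hnd := hW.1 v
        rw [h1, List.nodup_append] at hnd
        simp only [slotPos, hv, h1, List.length_append, List.length_singleton, add_left_inj]
        rw [List.idxOf_append_of_notMem fun h => hnd.2.2 e h e List.mem_cons_self rfl,
          List.idxOf_cons_self, add_zero]
  exact key (W v) [] _ rfl (slotVertex_zeroSlot G v) (slotPos_zeroSlot G W v)

end Slots

/-! ## Evaluating tensors over the slots -/

section Evaluation

variable {k : Type*} [Field k] {d N : ℕ} {n : ℕ} {l r : ℕ × ℕ}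

/-- The linear map `⨂_s y_s ↦ ∏_s (y_s)_{row s, col s}`. -/
def evalSlots (row col : Slot n l r → Fin N) :
    SlotAlg k (NCPoly k d) n l r →ₗ[k] RepRing k d N :=
  PiTensorProduct.lift ((MultilinearMap.mkPiAlgebra k (Slot n l r) (RepRing k d N)).compLinearMap
    fun s => entry k d N (row s) (col s))

/-- The relation between the tensors that are trivial outside the slots in `T` and the values at
these tensors of the products of the matrix entries in the slots of `T`. -/
def evalRel (k : Type*) [Field k] (d : ℕ) (row col : Slot n l r → Fin N)
    (T : Finset (Slot n l r)) :
    Submodule k (SlotAlg k (NCPoly k d) n l r × RepRing k d N) :=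
  Submodule.span k {x | ∃ y : Slot n l r → NCPoly k d, (∀ s, s ∉ T → y s = 1) ∧
    x = (PiTensorProduct.tprod k y, ∏ s ∈ T, entry k d N (row s) (col s) (y s))}

variable {row col : Slot n l r → Fin N}

/-- When no slot is excluded, the second component of a generator is by definition the value of
`evalSlots` at the first. -/
theorem evalSlots_of_mem_evalRel {x : SlotAlg k (NCPoly k d) n l r} {c : RepRing k d N}
    (h : (x, c) ∈ evalRel k d row col Finset.univ) : evalSlots row col x = c := by
  have h1 : evalRel k d row col Finset.univ ≤
      LinearMap.eqLocus (evalSlots row col ∘ₗ LinearMap.fst k _ _) (LinearMap.snd k _ _) := by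
    rw [evalRel, Submodule.span_le]
    rintro _ ⟨y, -, rfl⟩
    simp [evalSlots]
  exact h1 h

theorem atSlot_mem_evalRel (s : Slot n l r) (a : NCPoly k d) :
    (atSlot s a, entry k d N (row s) (col s) a) ∈ evalRel k d row col {s} := by
  refine Submodule.subset_span ⟨Pi.mulSingle s a, fun s' hs' => ?_, ?_⟩
  · exact Pi.mulSingle_eq_of_ne (M := fun _ => NCPoly k d) (Finset.notMem_singleton.mp hs') a
  · simp [atSlot]

theorem one_mem_evalRel :
    ((1 : SlotAlg k (NCPoly k d) n l r), (1 : RepRing k d N)) ∈ evalRel k d row col ∅ :=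
  Submodule.subset_span ⟨1, fun _ _ => rfl, by simp [PiTensorProduct.one_def]⟩

/-- Taking matrix entries is not multiplicative, so neither is `evalSlots`. For disjoint supports,
however, each slot has at most one nontrivial factor, and the product of tensors corresponds to the
product of entries. This is why the relation records the supporting set of slots. -/
theorem mul_mem_evalRel {T T' : Finset (Slot n l r)} (hT : Disjoint T T')
    {x x' : SlotAlg k (NCPoly k d) n l r × RepRing k d N} (h : x ∈ evalRel k d row col T)
    (h' : x' ∈ evalRel k d row col T') : x * x' ∈ evalRel k d row col (T ∪ T') := by
  induction h, h' using Submodule.span_induction₂ with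
  | mem_mem x x' h h' =>
    obtain ⟨y, hy, rfl⟩ := h
    obtain ⟨y', hy', rfl⟩ := h'
    refine Submodule.subset_span ⟨y * y', fun s hs => ?_, ?_⟩
    · rw [Finset.mem_union, not_or] at hs
      simp [hy s hs.1, hy' s hs.2]
    · rw [Finset.prod_union hT, Prod.mk_mul_mk, PiTensorProduct.tprod_mul_tprod]
      congr 1
      congr 1
      · refine Finset.prod_congr rfl fun s hs => ?_
        simp [hy' s (Finset.disjoint_left.mp hT hs)]
      · refine Finset.prod_congr rfl fun s hs => ?_
        simp [hy s (Finset.disjoint_right.mp hT hs)]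
  | zero_left y hy => rw [zero_mul]; exact Submodule.zero_mem _
  | zero_right x hx => rw [mul_zero]; exact Submodule.zero_mem _
  | add_left x y z _ _ _ h1 h2 => rw [add_mul]; exact Submodule.add_mem _ h1 h2
  | add_right x y z _ _ _ h1 h2 => rw [mul_add]; exact Submodule.add_mem _ h1 h2
  | smul_left c x y _ _ h => rw [smul_mul_assoc]; exact Submodule.smul_mem _ c h
  | smul_right c x y _ _ h => rw [mul_smul_comm]; exact Submodule.smul_mem _ c h

theorem mul'_map_mem_evalRel {T T' : Finset (Slot n l r)} (hT : Disjoint T T')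
    {P P' : NCPoly k d →ₗ[k] SlotAlg k (NCPoly k d) n l r}
    {φ φ' : NCPoly k d →ₗ[k] RepRing k d N}
    (h : ∀ z, (P z, φ z) ∈ evalRel k d row col T)
    (h' : ∀ z, (P' z, φ' z) ∈ evalRel k d row col T') (t : NCPoly k d ⊗[k] NCPoly k d) :
    (LinearMap.mul' k _ (TensorProduct.map P P' t), LinearMap.mul' k _ (TensorProduct.map φ φ' t)) ∈
      evalRel k d row col (T ∪ T') := by
  induction t with
  | zero => simp only [map_zero]; exact Submodule.zero_mem _
  | tmul x y => exact mul_mem_evalRel hT (h x) (h' y)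
  | add x y hx hy => simp only [map_add]; exact Submodule.add_mem _ hx hy

theorem ofFn_prod_mem_evalRel {m : ℕ} {T : Fin m → Finset (Slot n l r)}
    (hT : Pairwise (Function.onFun Disjoint T)) {x : Fin m → SlotAlg k (NCPoly k d) n l r}
    {c : Fin m → RepRing k d N} (h : ∀ t, (x t, c t) ∈ evalRel k d row col (T t)) :
    ((List.ofFn x).prod, ∏ t, c t) ∈ evalRel k d row col (Finset.univ.biUnion T) := by
  induction m with
  | zero => simpa using one_mem_evalRel
  | succ m ih =>
    have h1 := ih (T := fun t => T t.succ) (fun t t' ht => hT ((Fin.succ_injective m).ne ht))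
      (fun t => h t.succ)
    have h2 : Finset.univ.biUnion T = T 0 ∪ Finset.univ.biUnion fun t : Fin m => T t.succ := by
      ext s
      simp [Fin.exists_fin_succ]
    rw [List.ofFn_succ, List.prod_cons, Fin.prod_univ_succ, h2]
    refine mul_mem_evalRel ?_ (h 0) h1
    rw [Finset.disjoint_biUnion_right]
    exact fun t _ => hT (Fin.succ_ne_zero t).symm

/-- The entry of the tensor factors that are attached to a vertex by means of the word `w`. -/
theorem foldl_mem_evalRel {κ : DEdge n l r → Fin N} (hrow : ∀ e, row (.inr e) = κ e)
    (I : EdgeLabel n → Fin d) {s : Slot n l r} (hs : ∀ e, s ≠ .inr (.proper e))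
    {w : List (EdgeLabel n)} (hw : w.Nodup) {c : Fin N} (hc : ColChain col κ c s w)
    (z : NCPoly k d) :
    (w.foldl (fun P e => LinearMap.mul' k _ ∘ₗ
        TensorProduct.map P (atSlot (.inr (.proper e))) ∘ₗ dpartial k (I e)) (atSlot s) z,
      wordEntry I (fun e => κ (.refl e)) (fun e => κ (.proper e)) w (row s) c z) ∈
      evalRel k d row col (insert s (w.map fun e => Sum.inr (DEdge.proper e)).toFinset) := by
  -- The last letter is outermost in the fold. For the shorter word the final column becomes the
  -- label of the reflected edge of that letter, hence `c` is generalized.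
  induction w using List.reverseRecOn generalizing z c with
  | nil =>
    rw [ColChain] at hc
    subst hc
    simpa [wordEntry] using atSlot_mem_evalRel s z
  | append_singleton w e ih =>
    rw [colChain_concat] at hc
    rw [List.nodup_append] at hw
    rw [wordEntry_concat, List.foldl_append]
    have h1 : insert s ((w ++ [e]).map fun e => Sum.inr (DEdge.proper e)).toFinset =
        insert s (w.map fun e => Sum.inr (DEdge.proper e)).toFinset ∪
          ({.inr (.proper e)} : Finset (Slot n l r)) := by
      ext s'
      simp only [List.map_append, List.map_cons, List.map_nil, List.toFinset_append,
        Finset.mem_insert, Finset.mem_union, List.mem_toFinset, List.mem_singleton,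
        Finset.mem_singleton]
      tauto
    rw [h1]
    refine mul'_map_mem_evalRel ?_ (fun z => ih hw.1 hc.1 z) (fun z => ?_) _
    · rw [Finset.disjoint_singleton_right, Finset.mem_insert, not_or]
      refine ⟨(hs e).symm, ?_⟩
      simp only [List.mem_toFinset, List.mem_map, Sum.inr.injEq, DEdge.proper.injEq,
        exists_eq_right]
      exact fun h => hw.2.2 e h e List.mem_cons_self rfl
    · rw [← hc.2, ← hrow]
      exact atSlot_mem_evalRel _ z

/-- The matrix entry that the word `w` at the vertex `v` produces. -/
def vertexEntry (I : EdgeLabel n → Fin d) (i j : Fin (l.1 + r.1) → Fin N)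
    (κ : DEdge n l r → Fin N) (v : DVertex n l r) (w : List (EdgeLabel n)) :
    NCPoly k d →ₗ[k] RepRing k d N :=
  wordEntry I (fun e => κ (.refl e)) (fun e => κ (.proper e)) w (slotRow i κ (zeroSlot v))
    (exitIdx j κ v)

/-- The matrix entries that the words at the vertices of the block of `b` produce. -/
def blockEntry (P : DoublePoissonBracket k (NCPoly k d)) (I : EdgeLabel n → Fin d)
    (i j : Fin (l.1 + r.1) → Fin N) (κ : DEdge n l r → Fin N)
    (W : DVertex n l r → List (EdgeLabel n)) (b : Fin n) : RepRing k d N :=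
  LinearMap.mul' k _ (TensorProduct.map
    (vertexEntry I i j κ (.num (b, 0)) (W (.num (b, 0))))
    (vertexEntry I i j κ (.num (b, 1)) (W (.num (b, 1))))
    (P.br (FreeAlgebra.ι k (I (b, 0))) (FreeAlgebra.ι k (I (b, 1)))))

theorem tensorProd_tprod {A B : Type*} [Ring A] [Algebra k A] [Ring B] [Algebra k B] {m : ℕ}
    (φ : Fin m → A →ₗ[k] B) (a : Fin m → A) :
    tensorProd φ (PiTensorProduct.tprod k a) = (List.ofFn fun t => φ t (a t)).prod := by
  simp [tensorProd]

variable {G : DoubleGraph n l r}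

/-- The slots that belong to the vertices in `Vs`. -/
def slotsOf (G : DoubleGraph n l r) (Vs : Finset (DVertex n l r)) : Finset (Slot n l r) :=
  Finset.univ.filter fun s => slotVertex G s ∈ Vs

theorem disjoint_slotsOf {Vs Vs' : Finset (DVertex n l r)} (h : Disjoint Vs Vs') :
    Disjoint (slotsOf G Vs) (slotsOf G Vs') := by
  rw [Finset.disjoint_left]
  intro s hs hs'
  simp only [slotsOf, Finset.mem_filter, Finset.mem_univ, true_and] at hs hs'
  exact Finset.disjoint_left.mp h hs hs'

/-- The ordering hypothesis makes the slots filled by the fold, namely the zero slot and the letters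
of the word, exactly the slots of `v`. -/
theorem vertexMap_mem_evalRel (S : Splitting G) (hS : IsOrdering G S.word)
    (I : EdgeLabel n → Fin d) (i j : Fin (l.1 + r.1) → Fin N) (κ : DEdge n l r → Fin N)
    (v : DVertex n l r) (z : NCPoly k d) :
    (vertexMap S I v z, vertexEntry I i j κ v (S.word v) z) ∈
      evalRel k d (slotRow i κ) (slotCol j κ G (nextEdge G S.word)) (slotsOf G {v}) := by
  have h := foldl_mem_evalRel (row := slotRow i κ) (k := k) (fun e => rfl) I
    (zeroSlot_ne_proper v) (hS.1 v) (colChain_slotCol hS j κ v) z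
  have h1 : slotsOf G {v} =
      insert (zeroSlot v) ((S.word v).map fun e => Sum.inr (DEdge.proper e)).toFinset := by
    ext s
    simp only [slotsOf, Finset.mem_filter, Finset.mem_univ, true_and, Finset.mem_singleton,
      Finset.mem_insert, List.mem_toFinset, List.mem_map]
    constructor
    · intro hs
      rcases eq_zeroSlot_or_proper G s with h | ⟨e, rfl⟩
      · exact Or.inl (hs ▸ h)
      · exact Or.inr ⟨e, (hS.2 v e).mpr hs, rfl⟩
    · rintro (rfl | ⟨e, he, rfl⟩)
      · exact slotVertex_zeroSlot G v
      · exact (hS.2 v e).mp he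
  rw [h1]
  exact h

theorem ofFn_vertexMap_mem_evalRel (S : Splitting G) (hS : IsOrdering G S.word)
    (I : EdgeLabel n → Fin d) (i j : Fin (l.1 + r.1) → Fin N) (κ : DEdge n l r → Fin N) {m : ℕ}
    (v : Fin m → DVertex n l r) (hv : Function.Injective v) (a : Fin m → NCPoly k d) :
    (tensorProd (fun t => vertexMap S I (v t)) (PiTensorProduct.tprod k a),
      ∏ t, vertexEntry I i j κ (v t) (S.word (v t)) (a t)) ∈
      evalRel k d (slotRow i κ) (slotCol j κ G (nextEdge G S.word))
        (slotsOf G (Finset.univ.image v)) := by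
  have h1 : slotsOf G (Finset.univ.image v) =
      Finset.univ.biUnion fun t => slotsOf G {v t} := by
    ext s
    simp [slotsOf, eq_comm]
  rw [tensorProd_tprod, h1]
  refine ofFn_prod_mem_evalRel (fun t t' ht => disjoint_slotsOf ?_)
    fun t => vertexMap_mem_evalRel S hS I i j κ (v t) (a t)
  simpa using hv.ne ht

/-- The slots are partitioned according to their vertices. Multiplying the relations at the
individual vertices therefore gives a relation supported on all slots, where it computes
`evalSlots`. -/
theorem evalSlots_allMap (P : DoublePoissonBracket k (NCPoly k d)) (S : Splitting G)
    (hS : IsOrdering G S.word) (I : EdgeLabel n → Fin d) (i j : Fin (l.1 + r.1) → Fin N)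
    (κ : DEdge n l r → Fin N) (a : Fin l.1 → NCPoly k d) (f : Fin l.2 → NCPoly k d)
    (b : Fin r.1 → NCPoly k d) (g : Fin r.2 → NCPoly k d) :
    evalSlots (slotRow i κ) (slotCol j κ G (nextEdge G S.word))
      (allMap P S I ((PiTensorProduct.tprod k a ⊗ₜ[k] PiTensorProduct.tprod k f) ⊗ₜ[k]
        (PiTensorProduct.tprod k b ⊗ₜ[k] PiTensorProduct.tprod k g))) =
      (∏ b, blockEntry P I i j κ S.word b) *
        (((∏ t, vertexEntry I i j κ (.left t) (S.word (.left t)) (a t)) *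
          ∏ p, vertexEntry I i j κ (.leftLoop p) (S.word (.leftLoop p)) (f p)) *
        ((∏ t, vertexEntry I i j κ (.right t) (S.word (.right t)) (b t)) *
          ∏ q, vertexEntry I i j κ (.rightLoop q) (S.word (.rightLoop q)) (g q))) := by
  have ha := ofFn_vertexMap_mem_evalRel S hS I i j κ DVertex.left
    (fun _ _ h => by simpa using h) a
  have hf := ofFn_vertexMap_mem_evalRel S hS I i j κ DVertex.leftLoop
    (fun _ _ h => by simpa using h) f
  have hb := ofFn_vertexMap_mem_evalRel S hS I i j κ DVertex.right
    (fun _ _ h => by simpa using h) b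
  have hg := ofFn_vertexMap_mem_evalRel S hS I i j κ DVertex.rightLoop
    (fun _ _ h => by simpa using h) g
  have hbl : ((List.ofFn (blockElt P S I)).prod, ∏ b, blockEntry P I i j κ S.word b) ∈
      evalRel k d (slotRow i κ) (slotCol j κ G (nextEdge G S.word))
        (Finset.univ.biUnion fun b => slotsOf G {.num (b, 0)} ∪ slotsOf G {.num (b, 1)}) := by
    refine ofFn_prod_mem_evalRel (fun b b' hb => ?_) fun b => mul'_map_mem_evalRel
      (disjoint_slotsOf (by simp)) (vertexMap_mem_evalRel S hS I i j κ _)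
      (vertexMap_mem_evalRel S hS I i j κ _) _
    simp only [Function.onFun, Finset.disjoint_union_left, Finset.disjoint_union_right]
    refine ⟨⟨?_, ?_⟩, ?_, ?_⟩ <;> exact disjoint_slotsOf (by simp [hb])
  have h1 : Disjoint (slotsOf G (Finset.univ.image DVertex.left))
      (slotsOf G (Finset.univ.image DVertex.leftLoop)) :=
    disjoint_slotsOf (by simp [Finset.disjoint_left])
  have h2 : Disjoint (slotsOf G (Finset.univ.image DVertex.right))
      (slotsOf G (Finset.univ.image DVertex.rightLoop)) :=
    disjoint_slotsOf (by simp [Finset.disjoint_left])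
  have h := mul_mem_evalRel ?_ hbl (mul_mem_evalRel ?_ (mul_mem_evalRel h1 ha hf)
    (mul_mem_evalRel h2 hb hg))
  · refine evalSlots_of_mem_evalRel ?_
    refine (congrArg (_ ∈ evalRel k d _ _ ·) ?_).mp h
    rw [Finset.eq_univ_iff_forall]
    intro s
    simp only [slotsOf, Finset.mem_union, Finset.mem_biUnion, Finset.mem_filter, Finset.mem_univ,
      true_and, Finset.mem_image, Finset.mem_singleton]
    rcases hv : slotVertex G s with ⟨b, c⟩ | t | t | p | q
    · left
      refine ⟨b, ?_⟩
      fin_cases c <;> simp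
    all_goals simp
  · rw [Finset.disjoint_left]
    intro s
    simp only [slotsOf, Finset.mem_union, Finset.mem_biUnion, Finset.mem_filter, Finset.mem_univ,
      true_and, Finset.mem_image, Finset.mem_singleton]
    rintro ⟨b, h | h⟩ <;> simp [h]
  · rw [Finset.disjoint_left]
    intro s
    simp only [slotsOf, Finset.mem_union, Finset.mem_filter, Finset.mem_univ,
      true_and, Finset.mem_image]
    rintro (⟨b, h⟩ | ⟨b, h⟩) <;> simp [← h]

end Evaluation

/-! ## Splittings and the words of their vertices -/

theorem eq_of_nodup_append_cons {α : Type*} {a b a' b' : List α} {e : α}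
    (h : a ++ e :: b = a' ++ e :: b') (hn : (a ++ e :: b).Nodup) : a = a' ∧ b = b' := by
  classical
  have h1 : e ∉ a := fun h => (List.nodup_append.mp hn).2.2 e h e List.mem_cons_self rfl
  have h2 : e ∉ a' := fun h' =>
    (List.nodup_append.mp (h ▸ hn)).2.2 e h' e List.mem_cons_self rfl
  have h3 : a.length = a'.length := by
    have h4 := congrArg (List.idxOf e) h
    rwa [List.idxOf_append_of_notMem h1, List.idxOf_append_of_notMem h2, List.idxOf_cons_self,
      List.idxOf_cons_self] at h4
  have h5 := List.append_inj h h3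
  exact ⟨h5.1, (List.cons.inj h5.2).2⟩

/-- A rotation of a list without repetitions that preserves the first element is trivial. -/
theorem eq_of_cycle_cons_eq {α : Type*} {e : α} {es es' : List α}
    (h : (↑(e :: es) : Cycle α) = ↑(e :: es')) (hn : (e :: es).Nodup) : es = es' := by
  rw [Cycle.coe_eq_coe] at h
  obtain ⟨m, hm⟩ := h
  rw [← List.rotate_mod] at hm
  have hlt : m % (e :: es).length < (e :: es).length := Nat.mod_lt _ (by simp)
  have h1 := List.head?_rotate hlt
  rw [hm, List.head?_cons, List.getElem?_eq_getElem hlt, Option.some_inj] at h1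
  have h2 : m % (e :: es).length = 0 :=
    ((hn.getElem_inj_iff (i := m % (e :: es).length) (hi := hlt) (j := 0)
      (hj := by simp)).mp (by simpa using h1.symm))
  rw [h2, List.rotate_zero] at hm
  exact (List.cons.inj hm).2

theorem exists_coe_cons_of_mem {α : Type*} {c : Cycle α} {e : α} (h : e ∈ c) :
    ∃ es : List α, c = ↑(e :: es) := by
  induction c using Quotient.inductionOn' with
  | h L =>
    obtain ⟨a, b, rfl⟩ := List.append_of_mem (show e ∈ L from h)
    refine ⟨b ++ a, Cycle.coe_eq_coe.mpr ?_⟩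
    simpa using (List.isRotated_append (l := a) (l' := e :: b))

theorem isChain_iff_forall_append {α : Type*} {R : α → α → Prop} {L : List α} :
    L.IsChain R ↔ ∀ a x y b, L = a ++ x :: y :: b → R x y := by
  constructor
  · rintro h a x y b rfl
    exact (List.isChain_append_cons_cons.mp h).2.1
  · intro h
    induction L with
    | nil => simp
    | cons x L ih =>
      rcases L with _ | ⟨y, L⟩
      · simp
      · rw [List.isChain_cons_cons]
        exact ⟨h [] x y L rfl, ih fun a u v b hL => h (x :: a) u v b (by simp [hL])⟩

variable {n : ℕ} {l r : ℕ × ℕ} {G : DoubleGraph n l r}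

theorem DoubleGraph.isWalk_append {v w : DVertex n l r} {a b : List (DEdge n l r)} :
    G.IsWalk v (a ++ b) w ↔ ∃ u, G.IsWalk v a u ∧ G.IsWalk u b w := by
  induction a generalizing v with
  | nil => simp [IsWalk]
  | cons e a ih => simp [IsWalk, ih, and_assoc]

theorem DoubleGraph.IsWalk.unique {v w w' : DVertex n l r} {a : List (DEdge n l r)}
    (h : G.IsWalk v a w) (h' : G.IsWalk v a w') : w = w' := by
  induction a generalizing v with
  | nil => exact h.symm.trans h'
  | cons e a ih => exact ih h.2 h'.2

theorem outerVertex_injective : Function.Injective (outerVertex n l r) := by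
  intro t t'
  refine Fin.addCases (fun t => ?_) (fun t => ?_) t <;>
    refine Fin.addCases (fun t' => ?_) (fun t' => ?_) t' <;> simp [outerVertex]

namespace Splitting

variable (S : Splitting G)

/-- The occurrences of an edge in all paths and cycles add up to one, so a second occurrence would
exceed the total. The next lemmas exploit the same count. -/
theorem mem_path_unique {e : DEdge n l r} {t t' : Fin (l.1 + r.1)} (h : e ∈ S.path t)
    (h' : e ∈ S.path t') : t = t' := by
  by_contra hne
  have h1 := S.count_eq_one e
  have h2 := List.count_pos_iff.mpr h
  have h3 := List.count_pos_iff.mpr h'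
  rw [← Finset.add_sum_erase _ _ (Finset.mem_univ t), ← Finset.add_sum_erase _ _
    (Finset.mem_erase.mpr ⟨Ne.symm hne, Finset.mem_univ t'⟩)] at h1
  omega

theorem count_cycle_pos {e : DEdge n l r} {c : Cycle (DEdge n l r)} (h : e ∈ c) :
    0 < c.toMultiset.count e := by
  induction c using Quotient.inductionOn' with
  | h L => exact Multiset.count_pos.mpr h

theorem not_mem_path_of_mem_cycle {e : DEdge n l r} {c : Cycle (DEdge n l r)} (hc : c ∈ S.cycles)
    (h : e ∈ c) (t : Fin (l.1 + r.1)) : e ∉ S.path t := by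
  intro h'
  have h1 := S.count_eq_one e
  have h2 := count_cycle_pos h
  have h3 := List.count_pos_iff.mpr h'
  rw [← Finset.add_sum_erase _ _ (Finset.mem_univ t), ← Finset.add_sum_erase _ _ hc] at h1
  omega

theorem mem_cycle_unique {e : DEdge n l r} {c c' : Cycle (DEdge n l r)} (hc : c ∈ S.cycles)
    (hc' : c' ∈ S.cycles) (h : e ∈ c) (h' : e ∈ c') : c = c' := by
  by_contra hne
  have h1 := S.count_eq_one e
  have h2 := count_cycle_pos h
  have h3 := count_cycle_pos h'
  rw [← Finset.add_sum_erase _ _ hc, ← Finset.add_sum_erase _ _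
    (Finset.mem_erase.mpr ⟨Ne.symm hne, hc'⟩)] at h1
  omega

theorem mem_path_or_mem_cycle (e : DEdge n l r) :
    (∃ t, e ∈ S.path t) ∨ ∃ c ∈ S.cycles, e ∈ c := by
  by_contra! h
  have h1 := S.count_eq_one e
  rw [Finset.sum_eq_zero fun t _ => List.count_eq_zero.mpr (h.1 t),
    Finset.sum_eq_zero fun c hc => ?_] at h1
  · omega
  · have := h.2 c hc
    induction c using Quotient.inductionOn' with
    | h L => exact Multiset.count_eq_zero.mpr this

variable {S}

/-- Every edge occurs once in the splitting, so it has at most one successor; the choice made in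
`next` is therefore immaterial. -/
theorem follows_right_unique {e e₁ e₂ : DEdge n l r} (h₁ : S.Follows e e₁)
    (h₂ : S.Follows e e₂) : e₁ = e₂ := by
  rcases h₁ with ⟨t, a, b, h₁⟩ | ⟨c, hc, es, rfl, h₁⟩ <;>
    rcases h₂ with ⟨t', a', b', h₂⟩ | ⟨c', hc', es', rfl, h₂⟩
  · have ht := S.mem_path_unique (e := e) (t := t) (t' := t') (by simp [← h₁]) (by simp [← h₂])
    subst ht
    have h3 := eq_of_nodup_append_cons (a := a) (b := e₁ :: b) (a' := a') (b' := e₂ :: b') (e := e)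
      (by simpa using h₁.trans h₂.symm) (by simpa [← h₁] using S.nodup_path t)
    exact (List.cons.inj h3.2).1
  · exact absurd (by simp [← h₁]) (S.not_mem_path_of_mem_cycle (e := e) hc' (by simp) t)
  · exact absurd (by simp [← h₂]) (S.not_mem_path_of_mem_cycle (e := e) hc (by simp) t')
  · have h3 := S.mem_cycle_unique (e := e) hc hc' (by simp) (by simp)
    have h4 := eq_of_cycle_cons_eq h3 (by simpa using S.nodup_cycle _ hc)
    subst h4
    rw [h₁] at h₂
    exact Option.some_inj.mp h₂

theorem next_eq_some_iff {e e' : DEdge n l r} : S.next e = some e' ↔ S.Follows e e' := by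
  unfold next
  split_ifs with h
  · rw [Option.some_inj]
    exact ⟨fun h' => h' ▸ h.choose_spec, fun h' => follows_right_unique h.choose_spec h'⟩
  · simp only [false_iff]
    exact fun h' => h ⟨e', h'⟩

/-- The edge which comes next after a slot. -/
def slotNext (S : Splitting G) : Slot n l r → Option (DEdge n l r)
  | .inl t => (S.path t).head?
  | .inr e => S.next e

theorem first_eq_slotNext (S : Splitting G) (v : DVertex n l r) :
    S.first v = S.slotNext (zeroSlot v) := by
  cases v <;> rfl

theorem slotNext_of_path {t : Fin (l.1 + r.1)} {a b : List (DEdge n l r)} {e : DEdge n l r}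
    (h : S.path t = a ++ e :: b) : S.slotNext (.inr e) = b.head? := by
  change S.next e = _
  rcases b with _ | ⟨e', b⟩
  · rw [List.head?_nil, Option.eq_none_iff_forall_ne_some]
    intro e' h'
    rcases next_eq_some_iff.mp h' with ⟨t', a', b', h₂⟩ | ⟨c', hc', es', rfl, h₂⟩
    · have ht := S.mem_path_unique (e := e) (t := t) (t' := t') (by simp [h]) (by simp [← h₂])
      subst ht
      have h3 := eq_of_nodup_append_cons (a := a) (b := []) (a' := a') (b' := e' :: b') (e := e)
        (by simpa using h.symm.trans h₂.symm) (by simpa [h] using S.nodup_path t)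
      simp at h3
    · exact absurd (by simp [h]) (S.not_mem_path_of_mem_cycle (e := e) hc' (by simp) t)
  · exact next_eq_some_iff.mpr (Or.inl ⟨t, a, b, by simp [h]⟩)

theorem slotNext_of_cycle {c : Cycle (DEdge n l r)} (hc : c ∈ S.cycles) {e : DEdge n l r}
    {es : List (DEdge n l r)} (h : c = ↑(e :: es)) :
    S.slotNext (.inr e) = (es ++ [e]).head? := by
  change S.next e = _
  obtain ⟨e', he'⟩ : ∃ e', (es ++ [e]).head? = some e' := by cases es <;> simp
  rw [he']
  exact next_eq_some_iff.mpr (Or.inr ⟨c, hc, es, h, he'⟩)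

theorem chain_slotNext {c : Cycle (DEdge n l r)} (hc : c ∈ S.cycles) :
    c.Chain fun e e' => S.slotNext (.inr e) = some e' := by
  obtain ⟨e, he⟩ : ∃ e, e ∈ c := by
    by_contra! h
    refine S.cycles_ne_nil c hc ?_
    induction c using Quotient.inductionOn' with
    | h L =>
      exact (Cycle.coe_eq_nil L).mpr (List.eq_nil_iff_forall_not_mem.mpr h)
  obtain ⟨es, rfl⟩ := exists_coe_cons_of_mem he
  rw [Cycle.chain_coe_cons, isChain_iff_forall_append]
  intro a x y b h
  -- If `b` is empty, `y` is the closing copy of `e` and `x` is the last edge of the cycle.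
  -- Otherwise `x` and `y` are adjacent inside the list, which is rotated to begin with `x`.
  rcases List.eq_nil_or_concat b with rfl | ⟨b, z, rfl⟩
  · have h1 : (e :: es) ++ [e] = (a ++ [x]) ++ [y] := by simpa using h
    obtain ⟨h2, h3⟩ := List.append_inj' h1 rfl
    obtain rfl : e = y := by simpa using h3
    rw [slotNext_of_cycle hc (es := a) (Cycle.coe_eq_coe.mpr ?_)]
    · rcases a with _ | ⟨u, a⟩
      · simpa using (List.cons.inj h2).1.symm
      · simpa using (List.cons.inj h2).1.symm
    · rw [h2]
      exact List.isRotated_append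
  · have h1 : (e :: es) ++ [e] = (a ++ x :: y :: b) ++ [z] := by simpa using h
    obtain ⟨h2, h3⟩ := List.append_inj' h1 rfl
    rw [slotNext_of_cycle hc (es := y :: b ++ a) (Cycle.coe_eq_coe.mpr ?_)]
    · simp
    · rw [h2]
      exact List.isRotated_append

/-- The single occurrence of `x` has a single predecessor: the initial slot of a path if `x` is its
first edge, and otherwise the edge just before `x` in its path or cycle. -/
theorem slotNext_inj {s s' : Slot n l r} {x : DEdge n l r} (h : S.slotNext s = some x)
    (h' : S.slotNext s' = some x) : s = s' := by
  -- In the case of a cycle the list is rotated so that `x` comes first and its predecessor last.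
  have key : ∀ s, S.slotNext s = some x →
      (∃ t b, S.path t = x :: b ∧ s = .inl t) ∨
      (∃ t a e b, S.path t = (a ++ [e]) ++ x :: b ∧ s = .inr e) ∨
      ∃ es e es', (↑(es ++ [e]) : Cycle _) ∈ S.cycles ∧ es ++ [e] = x :: es' ∧ s = .inr e := by
    rintro (t | e) h
    · left
      rcases hp : S.path t with _ | ⟨y, b⟩
      · simp [slotNext, hp] at h
      · simp only [slotNext, hp, List.head?_cons, Option.some_inj] at h
        subst h
        exact ⟨t, b, hp, rfl⟩
    · right
      rcases next_eq_some_iff.mp h with ⟨t', a', b', h₂⟩ | ⟨c', hc', es', rfl, h₂⟩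
      · left
        exact ⟨t', a', e, b', by simp [← h₂], rfl⟩
      · right
        rcases hp : es' ++ [e] with _ | ⟨y, b⟩
        · simp at hp
        · rw [hp, List.head?_cons, Option.some_inj] at h₂
          subst h₂
          exact ⟨es', e, b, by rwa [← Cycle.coe_cons_eq_coe_append], hp, rfl⟩
  rcases key s h with ⟨t, b, h1, rfl⟩ | ⟨t, a, e, b, h1, rfl⟩ | ⟨es, e, b, h0, h1, rfl⟩ <;>
  rcases key s' h' with ⟨t', b', h1', rfl⟩ | ⟨t', a', e', b', h1', rfl⟩ | ⟨es', e', b', h0', h1', rfl⟩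
  · rw [S.mem_path_unique (e := x) (t := t) (t' := t') (by simp [h1]) (by simp [h1'])]
  · have ht := S.mem_path_unique (e := x) (t := t) (t' := t') (by simp [h1]) (by simp [h1'])
    subst ht
    have h3 := eq_of_nodup_append_cons (a := []) (b := b) (a' := a' ++ [e']) (b' := b') (e := x)
      (by simpa using h1.symm.trans h1') (by simpa [h1] using S.nodup_path t)
    simp at h3
  · exact absurd (by simp [h1]) (S.not_mem_path_of_mem_cycle (e := x) h0' (by simp [h1']) t)
  · have ht := S.mem_path_unique (e := x) (t := t) (t' := t') (by simp [h1]) (by simp [h1'])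
    subst ht
    have h3 := eq_of_nodup_append_cons (a := []) (b := b') (a' := a ++ [e]) (b' := b) (e := x)
      (by simpa using h1'.symm.trans h1) (by simpa [h1'] using S.nodup_path t)
    simp at h3
  · have ht := S.mem_path_unique (e := x) (t := t) (t' := t') (by simp [h1]) (by simp [h1'])
    subst ht
    have h3 := eq_of_nodup_append_cons (h1.symm.trans h1') (by simpa [h1] using S.nodup_path t)
    have h4 := List.append_inj' h3.1 rfl
    simpa using h4.2
  · exact absurd (by simp [h1]) (S.not_mem_path_of_mem_cycle (e := x) h0' (by simp [h1']) t)
  · exact absurd (by simp [h1']) (S.not_mem_path_of_mem_cycle (e := x) h0 (by simp [h1]) t')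
  · exact absurd (by simp [h1']) (S.not_mem_path_of_mem_cycle (e := x) h0 (by simp [h1]) t')
  · have h3 := S.mem_cycle_unique (e := x) h0 h0' (by simp [h1]) (by simp [h1'])
    rw [h1, h1'] at h3
    have h4 := eq_of_cycle_cons_eq h3 (by simpa [h1] using S.nodup_cycle _ h0)
    rw [h4, ← h1'] at h1
    have h5 := List.append_inj' h1 rfl
    simpa using h5.2

theorem src_of_slotNext {s : Slot n l r} {x : DEdge n l r} (h : S.slotNext s = some x) :
    G.src x = slotVertex G s := by
  rcases s with t | e
  · have h1 := S.isWalk_path t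
    rcases hp : S.path t with _ | ⟨y, b⟩
    · simp [slotNext, hp] at h
    · simp only [slotNext, hp, List.head?_cons, Option.some_inj] at h
      subst h
      rw [hp] at h1
      exact h1.1
  · rcases next_eq_some_iff.mp h with ⟨t', a', b', h₂⟩ | ⟨c', hc', es', rfl, h₂⟩
    · have h1 := S.isWalk_path t'
      rw [← h₂, List.append_assoc, DoubleGraph.isWalk_append] at h1
      obtain ⟨u, _, h1⟩ := h1
      exact h1.2.1
    · have h1 := S.isWalk_cycle _ hc'
      rw [Cycle.chain_coe_cons] at h1
      rcases hp : es' ++ [e] with _ | ⟨y, b⟩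
      · simp at hp
      · rw [hp, List.head?_cons, Option.some_inj] at h₂
        subst h₂
        rw [hp, List.isChain_cons_cons] at h1
        exact h1.1.symm

theorem slotVertex_of_slotNext_eq_none {s : Slot n l r} (h : S.slotNext s = none) :
    ∃ t, slotVertex G s = outerVertex n l r t := by
  rcases s with t | e
  · have h1 := S.isWalk_path t
    rw [List.head?_eq_none_iff.mp h] at h1
    exact ⟨_, h1⟩
  · rcases S.mem_path_or_mem_cycle e with ⟨t, ht⟩ | ⟨c, hc, he⟩
    · obtain ⟨a, b, hp⟩ := List.append_of_mem ht
      rw [slotNext_of_path hp, List.head?_eq_none_iff] at h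
      subst h
      have h1 := S.isWalk_path t
      rw [hp, DoubleGraph.isWalk_append] at h1
      obtain ⟨u, _, h1⟩ := h1
      exact ⟨_, h1.2⟩
    · obtain ⟨es, rfl⟩ := exists_coe_cons_of_mem he
      rw [slotNext_of_cycle hc rfl] at h
      simp at h

end Splitting

/-! ### Principal splittings are determined by their words. -/

variable {n : ℕ} {l r : ℕ × ℕ} {G : DoubleGraph n l r}

namespace Splitting

variable {S : Splitting G}

/-- The slot which precedes the letter with number `p` of a word. -/
def slotBefore (s : Slot n l r) (w : List (EdgeLabel n)) : ℕ → Slot n l r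
  | 0 => s
  | p + 1 => (w[p]?).elim s fun e => .inr (.proper e)

/-- The algorithm passes from a reflected edge `*e` to the proper edge `e` and asks for the
successor of the latter. So each letter is the reflected successor of the slot of the preceding
letter, or of the initial slot for the first letter. -/
theorem slotNext_slotBefore {m : ℕ} {s : Slot n l r} {p : ℕ} {e : EdgeLabel n}
    (h : (S.collect m (S.slotNext s))[p]? = some e) :
    S.slotNext (slotBefore s (S.collect m (S.slotNext s)) p) = some (.refl e) := by
  induction m generalizing s p with
  | zero => simp [collect] at h
  | succ m ih =>
    rcases hs : S.slotNext s with _ | (x | x | x | x)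
    all_goals rw [hs] at h
    case some.refl =>
      simp only [collect] at h ⊢
      rcases p with _ | p
      · simp only [List.getElem?_cons_zero, Option.some_inj] at h
        subst h
        exact hs
      · rw [List.getElem?_cons_succ] at h
        have h1 := ih (s := .inr (.proper x)) h
        rcases p with _ | p
        · exact h1
        · simp only [slotBefore, List.getElem?_cons_succ] at h1 ⊢
          have h2 : (S.collect m (S.next (.proper x)))[p]?.isSome := by
            obtain ⟨h3, -⟩ := List.getElem?_eq_some_iff.mp h
            rw [List.getElem?_eq_getElem (l := S.collect m (S.next (.proper x))) (i := p)
              (by omega), Option.isSome_some]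
          obtain ⟨y, hy⟩ := Option.isSome_iff_exists.mp h2
          change S.slotNext ((S.collect m (S.next (.proper x)))[p]?.elim _ _) = _ at h1
          rw [hy] at h1 ⊢
          exact h1
    all_goals simp [collect] at h

theorem slotNext_word {v : DVertex n l r} {p : ℕ} {e : EdgeLabel n}
    (h : (S.word v)[p]? = some e) :
    S.slotNext (slotBefore (zeroSlot v) (S.word v) p) = some (.refl e) := by
  rw [word, first_eq_slotNext] at h ⊢
  exact slotNext_slotBefore h

theorem slotVertex_slotBefore {v : DVertex n l r} {p : ℕ} (hp : p ≤ (S.word v).length) :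
    slotVertex G (slotBefore (zeroSlot v) (S.word v) p) = v := by
  induction p with
  | zero => exact slotVertex_zeroSlot G v
  | succ p ih =>
    have h1 := List.getElem?_eq_getElem (l := S.word v) (i := p) (by omega)
    have h2 := src_of_slotNext (slotNext_word h1)
    rw [ih (by omega)] at h2
    simp only [slotBefore, h1]
    exact h2

theorem target_of_mem_word {v : DVertex n l r} {e : EdgeLabel n} (h : e ∈ S.word v) :
    G.target e = v := by
  obtain ⟨p, hp⟩ := List.mem_iff_getElem?.mp h
  obtain ⟨hlt, -⟩ := List.getElem?_eq_some_iff.mp hp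
  have h2 := src_of_slotNext (slotNext_word hp)
  rwa [slotVertex_slotBefore hlt.le] at h2

/-- If a letter occurred at two positions, injectivity of the successor map would make the preceding
slots equal. Moving back step by step, one reaches the beginning of the word, where the zero slot
would have to be the slot of a proper edge. -/
theorem nodup_word (v : DVertex n l r) : (S.word v).Nodup := by
  have key : ∀ p q e, (S.word v)[p]? = some e → (S.word v)[p + q + 1]? = some e → False := by
    intro p
    induction p with
    | zero =>
      intro q e h h'
      have h1 := slotNext_inj (slotNext_word h) (slotNext_word h')
      obtain ⟨hlt, -⟩ := List.getElem?_eq_some_iff.mp h'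
      have h2 := List.getElem?_eq_getElem (l := S.word v) (i := 0 + q) (by omega)
      simp only [slotBefore, h2] at h1
      exact zeroSlot_ne_proper v _ h1
    | succ p ih =>
      intro q e h h'
      have h1 := slotNext_inj (slotNext_word h) (slotNext_word h')
      obtain ⟨hlt, -⟩ := List.getElem?_eq_some_iff.mp h'
      have h2 := List.getElem?_eq_getElem (l := S.word v) (i := p) (by omega)
      have h3 := List.getElem?_eq_getElem (l := S.word v) (i := p + 1 + q) (by omega)
      simp only [slotBefore, h2, h3, Option.elim_some, Sum.inr.injEq, DEdge.proper.injEq] at h1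
      refine ih q _ h2 ?_
      rw [show p + q + 1 = p + 1 + q by omega, h3, h1]
  rw [List.nodup_iff_getElem?_ne_getElem?]
  intro p q hpq hq h
  refine key p (q - p - 1) _ (List.getElem?_eq_getElem (by omega)) ?_
  rw [show p + (q - p - 1) + 1 = q by omega, ← h]
  exact List.getElem?_eq_getElem (by omega)

/-- The word has distinct letters, all from `E(v)`; principality says that their number is that of
`E(v)`, so all of `E(v)` is used. -/
theorem isOrdering_word (hS : S.IsPrincipal) : IsOrdering G S.word := by
  refine ⟨nodup_word, fun v e => ⟨target_of_mem_word, fun h => ?_⟩⟩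
  have h1 : (S.word v).toFinset = G.inEdges v := by
    refine Finset.eq_of_subset_of_card_le (fun e he => ?_) ?_
    · simpa [DoubleGraph.inEdges] using target_of_mem_word (List.mem_toFinset.mp he)
    · rw [List.toFinset_card_of_nodup (nodup_word v), hS v]
  rw [← List.mem_toFinset, h1]
  simpa [DoubleGraph.inEdges] using h

theorem slotPos_slotBefore {W : DVertex n l r → List (EdgeLabel n)} (hW : IsOrdering G W) {v : DVertex n l r} {p : ℕ}
    (hp : p ≤ (W v).length) :
    slotPos G W (slotBefore (zeroSlot v) (W v) p) = p := by
  rcases p with _ | p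
  · exact slotPos_zeroSlot G W v
  · have h1 := List.getElem?_eq_getElem (l := W v) (i := p) (by omega)
    have h2 := (hW.2 v _).mp (List.getElem_mem (l := W v) (n := p) (by omega))
    simp only [slotBefore, h1, Option.elim_some, slotPos, h2, add_left_inj]
    exact (hW.1 v).idxOf_getElem p _

theorem slotBefore_slotPos {W : DVertex n l r → List (EdgeLabel n)} (hW : IsOrdering G W) (s : Slot n l r) :
    slotBefore (zeroSlot (slotVertex G s)) (W (slotVertex G s)) (slotPos G W s) = s ∧
      slotPos G W s ≤ (W (slotVertex G s)).length := by
  rcases eq_zeroSlot_or_proper G s with h | ⟨e, rfl⟩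
  · have h1 : slotPos G W s = 0 := by rw [h, slotPos_zeroSlot]
    rw [h1]
    exact ⟨h.symm, Nat.zero_le _⟩
  · have h1 : e ∈ W (G.target e) := (hW.2 _ e).mpr rfl
    have h2 := List.idxOf_lt_length_of_mem h1
    simp only [slotPos, slotVertex, DoubleGraph.tgt, slotBefore]
    rw [List.getElem?_eq_getElem h2, List.getElem_idxOf]
    exact ⟨rfl, h2⟩

/-- In a principal splitting the words of the vertices determine what comes next. -/
theorem slotNext_eq_nextEdge (hS : S.IsPrincipal) : S.slotNext = nextEdge G S.word := by
  have hW := isOrdering_word hS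
  funext s
  obtain ⟨h1, h2⟩ := slotBefore_slotPos hW s
  unfold nextEdge
  rcases hp : (S.word (slotVertex G s))[slotPos G S.word s]? with _ | e
  · rw [Option.elim_none]
    have hlen := List.getElem?_eq_none_iff.mp hp
    rcases hs : S.slotNext s with _ | e
    -- A slot without successor lies at an outer vertex, and these are the vertices without an exit
    -- edge.
    · obtain ⟨t, ht⟩ := slotVertex_of_slotNext_eq_none hs
      rw [ht]
      refine Fin.addCases (fun t => ?_) (fun t => ?_) t <;> simp [outerVertex, exitEdge]
    · have hv := src_of_slotNext hs
      rcases e with x | x | x | x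
      -- A reflected edge starting at the vertex already follows the slot before its letter, whose
      -- position is less than the length of the word. By injectivity it cannot also follow the slot
      -- at the end of the word.
      case refl =>
        exfalso
        obtain ⟨q, hq⟩ := List.mem_iff_getElem?.mp ((hW.2 (slotVertex G s) x).mpr hv)
        obtain ⟨hlt, -⟩ := List.getElem?_eq_some_iff.mp hq
        have h3 := slotNext_inj hs (slotNext_word hq)
        have h4 := slotPos_slotBefore hW hlt.le
        rw [← h3] at h4
        omega
      -- An edge that is not reflected is the exit edge of its source.
      all_goals
        rw [← hv]
        rfl
  · rw [Option.elim_some]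
    have h3 := slotNext_word hp
    rwa [h1] at h3

/-- When the successors are those prescribed by `W`, the algorithm reads each word `W v` back letter
by letter. -/
theorem word_of_slotNext {W : DVertex n l r → List (EdgeLabel n)} (hW : IsOrdering G W)
    (h : S.slotNext = nextEdge G W) : S.word = W := by
  funext v
  have key : ∀ (w pre : List (EdgeLabel n)) (s : Slot n l r) (m : ℕ), W v = pre ++ w →
      slotVertex G s = v → slotPos G W s = pre.length → w.length ≤ m →
      S.collect m (S.slotNext s) = w := by
    intro w
    induction w with
    | nil =>
      intro pre s m h1 h2 h3 _
      rw [h, nextEdge, h2, h3, h1]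
      simp only [List.append_nil, List.getElem?_length, Option.elim_none]
      rcases m with _ | m
      · rfl
      -- At the end of the word comes the exit edge or nothing; as this is never a reflected edge,
      -- the algorithm stops.
      · cases v <;> rfl
    | cons e w ih =>
      intro pre s m h1 h2 h3 hm
      have hv : G.target e = v := (hW.2 v e).mp (by simp [h1])
      rcases m with _ | m
      · simp at hm
      · have h4 : S.slotNext s = some (.refl e) := by
          rw [h, nextEdge, h2, h3, h1]
          simp
        rw [h4, collect]
        congr 1
        refine ih (pre ++ [e]) (.inr (.proper e)) m (by simpa using h1) hv ?_ (by simpa using hm)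
        have hnd := hW.1 v
        rw [h1, List.nodup_append] at hnd
        simp only [slotPos, hv, h1, List.length_append, List.length_singleton, add_left_inj]
        rw [List.idxOf_append_of_notMem fun h => hnd.2.2 e h e List.mem_cons_self rfl,
          List.idxOf_cons_self, add_zero]
  rw [word, first_eq_slotNext]
  refine key (W v) [] _ _ rfl (slotVertex_zeroSlot G v) (slotPos_zeroSlot G W v) ?_
  -- There are `2 * n` edge labels, so a word without repetitions is never cut off by the bound on
  -- the number of steps.
  have := (hW.1 v).length_le_card
  simpa [mul_comm] using this

theorem isPrincipal_of_word {W : DVertex n l r → List (EdgeLabel n)} (hW : IsOrdering G W)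
    (h : S.word = W) : S.IsPrincipal := by
  intro v
  rw [h, ← List.toFinset_card_of_nodup (hW.1 v)]
  congr 1
  ext e
  simp [DoubleGraph.inEdges, hW.2]

/-- The successor map gives the first edge of a path, then each further edge, and also tells where
the path stops. -/
theorem path_eq_of_slotNext {S S' : Splitting G} (h : S.slotNext = S'.slotNext) :
    S.path = S'.path := by
  have key : ∀ (b b' a a' : List (DEdge n l r)) (t : Fin (l.1 + r.1)), S.path t = a ++ b →
      S'.path t = a' ++ b' → b.head? = b'.head? → b = b' := by
    intro b
    induction b with
    | nil =>
      intro b' a a' t _ _ h3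
      exact (List.head?_eq_none_iff.mp h3.symm).symm
    | cons e b ih =>
      intro b' a a' t h1 h2 h3
      rcases b' with _ | ⟨e', b'⟩
      · simp at h3
      · obtain rfl : e = e' := by simpa using h3
        have h4 := slotNext_of_path h1
        rw [h, slotNext_of_path h2] at h4
        rw [ih b' (a ++ [e]) (a' ++ [e]) t (by simpa using h1) (by simpa using h2) h4.symm]
  funext t
  exact key _ _ [] [] t rfl rfl (congrFun h (.inl t))

/-- An edge `e` of a cycle of `S` lies on no path of `S'`, since the paths agree. It lies therefore
on a cycle of `S'`, and both cycles arise by iterating the same successor map from `e`. -/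
theorem cycles_subset_of_slotNext {S S' : Splitting G} (h : S.slotNext = S'.slotNext) :
    S.cycles ⊆ S'.cycles := by
  intro c hc
  obtain ⟨e, he⟩ : ∃ e, e ∈ c := by
    by_contra! h
    refine S.cycles_ne_nil c hc ?_
    induction c using Quotient.inductionOn' with
    | h L => exact (Cycle.coe_eq_nil L).mpr (List.eq_nil_iff_forall_not_mem.mpr h)
  rcases S'.mem_path_or_mem_cycle e with ⟨t, ht⟩ | ⟨c', hc', he'⟩
  · rw [← path_eq_of_slotNext h] at ht
    exact absurd ht (S.not_mem_path_of_mem_cycle hc he t)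
  · obtain ⟨es, rfl⟩ := exists_coe_cons_of_mem he
    obtain ⟨es', rfl⟩ := exists_coe_cons_of_mem he'
    have h1 := chain_slotNext hc
    have h2 := chain_slotNext hc'
    rw [Cycle.chain_coe_cons] at h1 h2
    rw [← h] at h2
    have hn := S.nodup_cycle _ hc
    have hn' := S'.nodup_cycle _ hc'
    simp only [Cycle.nodup_coe_iff, List.nodup_cons] at hn hn'
    -- Both lists are followed until the first return to `e`. As neither contains `e` in its
    -- interior, they return at the same time.
    have key : ∀ (es es' : List (DEdge n l r)) (x : DEdge n l r), e ∉ es → e ∉ es' →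
        (x :: (es ++ [e])).IsChain (fun e e' => S.slotNext (.inr e) = some e') →
        (x :: (es' ++ [e])).IsChain (fun e e' => S.slotNext (.inr e) = some e') → es = es' := by
      intro es
      induction es with
      | nil =>
        intro es' x _ h1 h2 h3
        rcases es' with _ | ⟨y, es'⟩
        · rfl
        · simp only [List.nil_append, List.isChain_cons_cons, List.cons_append] at h2 h3
          rw [h2.1, Option.some_inj] at h3
          simp [h3.1] at h1
      | cons z es ih =>
        intro es' x h0 h1 h2 h3
        rcases es' with _ | ⟨y, es'⟩
        · simp only [List.nil_append, List.isChain_cons_cons, List.cons_append] at h2 h3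
          rw [h2.1, Option.some_inj] at h3
          simp [h3.1] at h0
        · simp only [List.isChain_cons_cons, List.cons_append] at h2 h3
          have h4 := h3.1
          rw [h2.1, Option.some_inj] at h4
          subst h4
          rw [ih es' z (fun h => h0 (List.mem_cons_of_mem _ h))
            (fun h => h1 (List.mem_cons_of_mem _ h)) h2.2 h3.2]
    rwa [key es es' e hn.1 hn'.1 h1 h2]

theorem eq_of_slotNext {S S' : Splitting G} (h : S.slotNext = S'.slotNext) : S = S' := by
  have hp := path_eq_of_slotNext h
  refine Splitting.ext hp ?_
    (subset_antisymm (cycles_subset_of_slotNext h) (cycles_subset_of_slotNext h.symm))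
  funext t
  have h1 := S.isWalk_path t
  rw [hp] at h1
  exact outerVertex_injective (h1.unique (S'.isWalk_path t))

theorem eq_of_word {S S' : Splitting G} (hS : S.IsPrincipal) (hS' : S'.IsPrincipal)
    (h : S.word = S'.word) : S = S' :=
  eq_of_slotNext (by rw [slotNext_eq_nextEdge hS, slotNext_eq_nextEdge hS', h])

end Splitting

/-! ## The splitting with given words -/

section Trajectories

variable {T E : Type*} {π : T ⊕ E → T ⊕ E}

/-- Iterating `π` from `s` yields the elements of `L` and then the end `t`. -/
def Trajectory (π : T ⊕ E → T ⊕ E) : T ⊕ E → List E → T → Prop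
  | s, [], t => π s = .inl t
  | s, e :: L, t => π s = .inr e ∧ Trajectory π (.inr e) L t

theorem exists_trajectory (m : ℕ) {s : T ⊕ E} {t : T} (h : π^[m + 1] s = .inl t) :
    ∃ L t', Trajectory π s L t' := by
  induction m generalizing s with
  | zero => exact ⟨[], t, h⟩
  | succ m ih =>
    rcases hs : π s with t' | e
    · exact ⟨[], t', hs⟩
    · rw [Function.iterate_succ_apply, hs] at h
      obtain ⟨L, t', hL⟩ := ih h
      exact ⟨e :: L, t', hs, hL⟩

/-- The last one of the elements `s`, `a`. -/
def lastOf (s : T ⊕ E) (a : List E) : T ⊕ E := (a.getLast?).elim s .inr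

theorem Trajectory.apply_lastOf {s : T ⊕ E} {L : List E} {t : T} (h : Trajectory π s L t) :
    π (lastOf s L) = .inl t := by
  induction L generalizing s with
  | nil => exact h
  | cons e L ih =>
    rw [← ih h.2]
    rcases L with _ | ⟨x, L⟩
    · rfl
    · simp [lastOf, List.getLast?_cons]

theorem Trajectory.of_append {s : T ⊕ E} {a b : List E} {t : T} (h : Trajectory π s (a ++ b) t) :
    Trajectory π (lastOf s a) b t := by
  induction a generalizing s with
  | nil => exact h
  | cons e a ih =>
    have h1 := ih h.2
    rcases a with _ | ⟨x, a⟩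
    · exact h1
    · simpa [lastOf, List.getLast?_cons] using h1

theorem lastOf_concat (s : T ⊕ E) (a : List E) (e : E) : lastOf s (a ++ [e]) = .inr e := by
  simp [lastOf]

/-- Injectivity determines the history of `e` backwards, up to the starting point; the start is
recognized because it lies in `T` and not in `E`. -/
theorem Trajectory.unique (hπ : Function.Injective π) {t t' u u' : T} {a a' b b' : List E} {e : E}
    (h : Trajectory π (.inl t) (a ++ e :: b) u) (h' : Trajectory π (.inl t') (a' ++ e :: b') u') :
    t = t' ∧ a = a' := by
  induction a using List.reverseRecOn generalizing a' e b b' with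
  | nil =>
    rcases List.eq_nil_or_concat a' with rfl | ⟨a', x, rfl⟩
    · exact ⟨Sum.inl_injective (hπ (h.1.trans h'.1.symm)), rfl⟩
    · have h2 := h'.of_append.1
      rw [List.concat_eq_append, lastOf_concat] at h2
      exact absurd (hπ (h.1.trans h2.symm)) (by simp)
  | append_singleton a x ih =>
    have h1 := h.of_append.1
    rw [lastOf_concat] at h1
    rcases List.eq_nil_or_concat a' with rfl | ⟨a', y, rfl⟩
    · exact absurd (hπ (h1.trans h'.1.symm)) (by simp)
    · have h2 := h'.of_append.1
      rw [List.concat_eq_append, lastOf_concat] at h2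
      obtain rfl : x = y := Sum.inr_injective (hπ (h1.trans h2.symm))
      have h3 := ih (b := e :: b) (b' := e :: b') (e := x) (a' := a') (by simpa using h)
        (by simpa using h')
      exact ⟨h3.1, by rw [h3.2, List.concat_eq_append]⟩

/-- A repeated element would have two histories of different lengths. -/
theorem Trajectory.nodup (hπ : Function.Injective π) {t u : T} {L : List E}
    (h : Trajectory π (.inl t) L u) : L.Nodup := by
  classical
  rw [List.nodup_iff_count_le_one]
  intro e
  by_contra! hc
  obtain ⟨a, b, rfl⟩ := List.append_of_mem (List.count_pos_iff.mp (by omega : 0 < L.count e))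
  have h1 : e ∈ a ∨ e ∈ b := by
    by_contra! hn
    rw [List.count_append, List.count_cons_self, List.count_eq_zero.mpr hn.1,
      List.count_eq_zero.mpr hn.2] at hc
    omega
  rcases h1 with h1 | h1
  · obtain ⟨a₁, a₂, rfl⟩ := List.append_of_mem h1
    have h2 := Trajectory.unique hπ h (a' := a₁) (b' := a₂ ++ e :: b) (by simpa using h)
    simp at h2
  · obtain ⟨b₁, b₂, rfl⟩ := List.append_of_mem h1
    have h2 := Trajectory.unique hπ h (a' := a ++ e :: b₁) (b' := b₂) (by simpa using h)
    simp at h2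

/-- An injective map on the finite set `T ⊔ E` decomposes into trajectories between elements of
`T` and cycles in `E`. -/
theorem exists_trajectory_decomposition [Fintype T] [Fintype E] [DecidableEq E]
    (hπ : Function.Injective π) :
    ∃ (path : T → List E) (σ : T → T) (cycles : Finset (Cycle E)),
      (∀ t, Trajectory π (.inl t) (path t) (σ t)) ∧ Function.Injective σ ∧
      (∀ c ∈ cycles, c ≠ Cycle.nil) ∧
      (∀ c ∈ cycles, c.Chain fun e e' => π (.inr e) = .inr e') ∧
      ∀ e, ∑ t, (path t).count e + ∑ c ∈ cycles, c.toMultiset.count e = 1 := by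
  classical
  have h0 : ∀ t : T, ∃ L t', Trajectory π (.inl t) L t' := by
    intro t
    -- All points of an injective self-map of a finite set are periodic. The orbit of `t` returns to
    -- `t`, so it meets `T` again.
    obtain ⟨m, hm, h⟩ := hπ.mem_periodicPts (.inl t)
    obtain ⟨m, rfl⟩ := Nat.exists_eq_succ_of_ne_zero hm.ne'
    exact exists_trajectory m h
  choose path σ hpath using h0
  have hdisj : ∀ t t' e, e ∈ path t → e ∈ path t' → t = t' := by
    intro t t' e h h'
    obtain ⟨a, b, hab⟩ := List.append_of_mem h
    obtain ⟨a', b', hab'⟩ := List.append_of_mem h'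
    exact (Trajectory.unique hπ (hab ▸ hpath t) (hab' ▸ hpath t')).1
  have hlast : ∀ t, lastOf (.inl t) (path t) = .inl t ∨
      ∃ e ∈ path t, lastOf (.inl t) (path t) = .inr e := by
    intro t
    rcases List.eq_nil_or_concat (path t) with h | ⟨a, e, h⟩
    · left
      rw [h]
      rfl
    · right
      refine ⟨e, by simp [h], ?_⟩
      rw [h, List.concat_eq_append, lastOf_concat]
  have hσ : Function.Injective σ := by
    intro t t' h
    have h1 : lastOf (.inl t) (path t) = lastOf (.inl t') (path t') :=
      hπ ((hpath t).apply_lastOf.trans ((congrArg _ h).trans (hpath t').apply_lastOf.symm))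
    rcases hlast t with h2 | ⟨e, he, h2⟩ <;> rcases hlast t' with h3 | ⟨e', he', h3⟩ <;>
      rw [h2, h3] at h1
    · exact Sum.inl_injective h1
    · simp at h1
    · simp at h1
    · rw [Sum.inr_injective h1] at he
      exact hdisj _ _ _ he he'
  have hout : ∀ e, (∀ t, e ∉ path t) → ∃ e', π (.inr e) = .inr e' ∧ ∀ t, e' ∉ path t := by
    intro e he
    rcases h : π (.inr e) with t' | e'
    · exfalso
      -- Every element of `T` is the end of some path. Its only preimage is then the start or the
      -- last element of that path, and `e` is neither.
      obtain ⟨t, rfl⟩ := (Finite.injective_iff_surjective.mp hσ) t'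
      have h1 := hπ (h.trans (hpath t).apply_lastOf.symm)
      rcases hlast t with h2 | ⟨x, hx, h2⟩ <;> rw [h2] at h1
      · simp at h1
      · exact he t (Sum.inr_injective h1 ▸ hx)
    · refine ⟨e', rfl, fun t ht => ?_⟩
      obtain ⟨a, b, hab⟩ := List.append_of_mem ht
      have h1 := hπ (h.trans (hab ▸ hpath t).of_append.1.symm)
      rcases List.eq_nil_or_concat a with rfl | ⟨a, x, rfl⟩
      · simp [lastOf] at h1
      · rw [List.concat_eq_append, lastOf_concat] at h1
        refine he t ?_
        rw [hab, Sum.inr_injective h1]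
        simp
  choose! g hg hg' using hout
  -- Outside the paths `f` follows `π`; it is the identity on the paths, which makes it an injective
  -- self-map of all of `E`. The cycles are its orbits outside the paths.
  let f : E → E := fun e => if ∀ t, e ∉ path t then g e else e
  have hf : ∀ e, (∀ t, e ∉ path t) → f e = g e := fun e he => if_pos he
  have hf' : ∀ e, ¬ (∀ t, e ∉ path t) → f e = e := fun e he => if_neg he
  have hfinj : Function.Injective f := by
    intro e e' h
    by_cases he : ∀ t, e ∉ path t <;> by_cases he' : ∀ t, e' ∉ path t
    · rw [hf e he, hf e' he'] at h
      exact Sum.inr_injective (hπ ((hg e he).trans ((congrArg _ h).trans (hg e' he').symm)))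
    · rw [hf e he, hf' e' he'] at h
      exact absurd (h ▸ hg' e he) he'
    · rw [hf' e he, hf e' he'] at h
      exact absurd (h ▸ hg' e' he') he
    · rwa [hf' e he, hf' e' he'] at h
  have hper : ∀ e, e ∈ Function.periodicPts f := hfinj.mem_periodicPts
  have hiter : ∀ e, (∀ t, e ∉ path t) → ∀ m, ∀ t, f^[m] e ∉ path t := by
    intro e he m
    induction m with
    | zero => exact he
    | succ m ih =>
      rw [Function.iterate_succ_apply', hf _ ih]
      exact hg' _ ih
  -- Points of the same orbit give the same cyclic list, so taking the image as a finite set counts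
  -- each cycle once.
  refine ⟨path, σ, (Finset.univ.filter fun e => ∀ t, e ∉ path t).image (Function.periodicOrbit f),
    hpath, hσ, ?_, ?_, ?_⟩
  · intro c hc
    obtain ⟨e, -, rfl⟩ := Finset.mem_image.mp hc
    rw [Ne, Function.periodicOrbit_eq_nil_iff_not_periodic_pt, not_not]
    exact hper e
  · intro c hc
    obtain ⟨e, he, rfl⟩ := Finset.mem_image.mp hc
    rw [Function.periodicOrbit_chain]
    intro m _
    have h1 := hiter e (Finset.mem_filter.mp he).2 m
    rw [Function.iterate_succ_apply', hf _ h1]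
    exact hg _ h1
  · intro e
    have hcount : ∀ x, (Function.periodicOrbit f x).toMultiset.count e =
        if e ∈ Function.periodicOrbit f x then 1 else 0 := by
      intro x
      have h1 := Function.nodup_periodicOrbit (f := f) (x := x)
      revert h1
      induction Function.periodicOrbit f x using Quotient.inductionOn' with
      | h L =>
        intro h1
        exact (Multiset.coe_count e L).trans (List.Nodup.count h1)
    by_cases he : ∀ t, e ∉ path t
    · rw [Finset.sum_eq_zero fun t _ => List.count_eq_zero.mpr (he t), zero_add,
        Finset.sum_eq_single (Function.periodicOrbit f e)]
      · rw [hcount, if_pos (Function.self_mem_periodicOrbit (hper e))]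
      · intro c hc hne
        obtain ⟨x, -, rfl⟩ := Finset.mem_image.mp hc
        rw [hcount, if_neg]
        rintro hx
        obtain ⟨m, rfl⟩ := (Function.mem_periodicOrbit_iff (hper x)).mp hx
        exact hne (Function.periodicOrbit_apply_iterate_eq (hper x) m).symm
      · intro h
        exact absurd (Finset.mem_image_of_mem _ (Finset.mem_filter.mpr ⟨Finset.mem_univ e, he⟩)) h
    · rw [Finset.sum_eq_zero (s := Finset.image _ _), add_zero]
      · push Not at he
        obtain ⟨t, ht⟩ := he
        rw [Finset.sum_eq_single t]
        · exact List.count_eq_one_of_mem ((hpath t).nodup hπ) ht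
        · exact fun t' _ hne => List.count_eq_zero.mpr fun h => hne (hdisj _ _ _ h ht)
        · simp
      · intro c hc
        obtain ⟨x, hx, rfl⟩ := Finset.mem_image.mp hc
        rw [hcount, if_neg]
        intro h
        obtain ⟨m, rfl⟩ := (Function.mem_periodicOrbit_iff (hper x)).mp h
        exact he (hiter x (Finset.mem_filter.mp hx).2 m)

end Trajectories

/-! ### The successor map on slots defined by given words. -/

variable {n : ℕ} {l r : ℕ × ℕ} {G : DoubleGraph n l r}

/-- The slot that comes after the end of the word of a vertex; the end of a path is identified
with the slot of the outer vertex where it ends. -/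
def exitSlot : DVertex n l r → Slot n l r
  | .num x => .inr (.proper x)
  | .left t => .inl (Fin.castAdd r.1 t)
  | .right s => .inl (Fin.natAdd l.1 s)
  | .leftLoop p => .inr (.leftLoop p)
  | .rightLoop q => .inr (.rightLoop q)

theorem exitSlot_injective : Function.Injective (exitSlot : DVertex n l r → Slot n l r) := by
  intro v v' h
  cases v <;> cases v' <;> simp_all [exitSlot, Fin.ext_iff] <;> omega

theorem exitSlot_ne_refl (v : DVertex n l r) (e : EdgeLabel n) :
    (exitSlot v : Slot n l r) ≠ .inr (.refl e) := by
  cases v <;> simp [exitSlot]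

/-- The slot which has to follow a slot when the words of the vertices are given. -/
def stepSlot (G : DoubleGraph n l r) (W : DVertex n l r → List (EdgeLabel n)) (s : Slot n l r) :
    Slot n l r :=
  ((W (slotVertex G s))[slotPos G W s]?).elim (exitSlot (slotVertex G s)) fun e => .inr (.refl e)

/-- Landing in the left summand means that the path has ended, and then there is no next edge. -/
theorem nextEdge_eq_getRight? (W : DVertex n l r → List (EdgeLabel n)) (s : Slot n l r) :
    nextEdge G W s = (stepSlot G W s).getRight? := by
  unfold nextEdge stepSlot
  rcases (W (slotVertex G s))[slotPos G W s]? with _ | e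
  · cases slotVertex G s <;> rfl
  · rfl

/-- A slot is determined by its vertex and its position in the word. A value `*e` reveals both,
because `e` has a single place in the words; an exit value reveals the vertex, and the position is
then the length of the word. -/
theorem stepSlot_injective {W : DVertex n l r → List (EdgeLabel n)} (hW : IsOrdering G W) :
    Function.Injective (stepSlot G W) := by
  intro s s' h
  obtain ⟨h1, h2⟩ := Splitting.slotBefore_slotPos hW s
  obtain ⟨h1', h2'⟩ := Splitting.slotBefore_slotPos hW s'
  unfold stepSlot at h
  have key : slotVertex G s = slotVertex G s' → slotPos G W s = slotPos G W s' → s = s' := by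
    intro hv hp
    rw [← h1, ← h1', hv, hp]
  rcases hs : (W (slotVertex G s))[slotPos G W s]? with _ | e <;>
    rcases hs' : (W (slotVertex G s'))[slotPos G W s']? with _ | e' <;>
    rw [hs, hs'] at h
  · have hv := exitSlot_injective h
    refine key hv ?_
    rw [List.getElem?_eq_none_iff] at hs hs'
    rw [hv] at hs h2
    omega
  · exact absurd h (exitSlot_ne_refl _ _)
  · exact absurd h.symm (exitSlot_ne_refl _ _)
  · simp only [Option.elim_some, Sum.inr.injEq, DEdge.refl.injEq] at h
    subst h
    have hv : slotVertex G s = slotVertex G s' :=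
      ((hW.2 _ e).mp (List.mem_of_getElem? hs)).symm.trans
        ((hW.2 _ e).mp (List.mem_of_getElem? hs'))
    refine key hv ?_
    rw [hv] at hs
    exact (List.getElem?_inj (List.getElem?_eq_some_iff.mp hs).1 (hW.1 _)).mp (hs.trans hs'.symm)

theorem src_of_stepSlot {W : DVertex n l r → List (EdgeLabel n)} (hW : IsOrdering G W)
    {s : Slot n l r} {e : DEdge n l r} (h : stepSlot G W s = .inr e) :
    G.src e = slotVertex G s := by
  unfold stepSlot at h
  rcases hs : (W (slotVertex G s))[slotPos G W s]? with _ | x <;> rw [hs] at h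
  · rw [Option.elim_none] at h
    generalize slotVertex G s = v at h
    cases v <;> simp only [exitSlot, Sum.inr.injEq, reduceCtorEq] at h <;> subst h <;> rfl
  · obtain rfl : DEdge.refl x = e := by simpa using h
    exact (hW.2 _ x).mp (List.mem_of_getElem? hs)

theorem slotVertex_of_stepSlot {W : DVertex n l r → List (EdgeLabel n)}
    {s : Slot n l r} {t : Fin (l.1 + r.1)} (h : stepSlot G W s = .inl t) :
    slotVertex G s = outerVertex n l r t ∧ (W (slotVertex G s))[slotPos G W s]? = none := by
  unfold stepSlot at h
  rcases hs : (W (slotVertex G s))[slotPos G W s]? with _ | x <;> rw [hs] at h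
  · refine ⟨?_, rfl⟩
    rw [Option.elim_none] at h
    generalize slotVertex G s = v at h
    cases v <;> simp only [exitSlot, Sum.inl.injEq, reduceCtorEq] at h <;> subst h <;>
      simp [outerVertex]
  · simp at h

/-- If `e` were followed by `*e`, the letter `e` would stand at two consecutive places of a word. A
reflected edge leads to position `0`, so a nonempty word at its endpoint forces the next edge to be
reflected. -/
theorem admits_of_stepSlot {W : DVertex n l r → List (EdgeLabel n)} (hW : IsOrdering G W)
    {e e' : DEdge n l r} (h : stepSlot G W (.inr e) = .inr e') : G.Admits e e' := by
  unfold stepSlot at h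
  constructor
  · rintro x ⟨rfl, rfl⟩
    rcases hs : (W (slotVertex G (.inr (.proper x))))[slotPos G W (.inr (.proper x))]? with _ | y <;>
      rw [hs] at h
    · exact exitSlot_ne_refl _ _ h
    · obtain rfl : y = x := by simpa using h
      have hx : y ∈ W (G.target y) := (hW.2 _ y).mpr rfl
      have h1 := List.idxOf_lt_length_of_mem hx
      have h2 : (W (G.target y))[(W (G.target y)).idxOf y]? = some y := by
        rw [List.getElem?_eq_getElem h1, List.getElem_idxOf]
      have h3 : (W (G.target y))[(W (G.target y)).idxOf y + 1]? = some y := hs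
      have h4 := (List.getElem?_inj h1 (hW.1 _)).mp (h2.trans h3.symm)
      omega
  · rintro x rfl ⟨y, hy⟩
    have hy' : y ∈ W (G.tgt (.refl x)) := (hW.2 _ y).mpr (by simpa [DoubleGraph.inEdges] using hy)
    have h1 : 0 < (W (G.tgt (.refl x))).length := List.length_pos_of_mem hy'
    simp only [slotVertex, slotPos] at h
    rw [List.getElem?_eq_getElem h1] at h
    exact ⟨_, (Sum.inr_injective h).symm⟩

theorem isWalk_of_trajectory {W : DVertex n l r → List (EdgeLabel n)} (hW : IsOrdering G W)
    {s : Slot n l r} {L : List (DEdge n l r)} {t : Fin (l.1 + r.1)}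
    (h : Trajectory (stepSlot G W) s L t) :
    G.IsWalk (slotVertex G s) L (outerVertex n l r t) := by
  induction L generalizing s with
  | nil => exact (slotVertex_of_stepSlot h).1
  | cons e L ih => exact ⟨src_of_stepSlot hW h.1, ih h.2⟩

theorem isChain_of_trajectory {W : DVertex n l r → List (EdgeLabel n)} (hW : IsOrdering G W)
    {s : Slot n l r} {L : List (DEdge n l r)} {t : Fin (l.1 + r.1)}
    (h : Trajectory (stepSlot G W) s L t) : L.IsChain G.Admits := by
  induction L generalizing s with
  | nil => simp
  | cons e L ih =>
    have h1 := ih h.2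
    rcases L with _ | ⟨x, L⟩
    · simp
    · rw [List.isChain_cons_cons]
      exact ⟨admits_of_stepSlot hW h.2.1, h1⟩

/-- There is a principal splitting with any given words. -/
theorem exists_splitting_word {W : DVertex n l r → List (EdgeLabel n)} (hW : IsOrdering G W) :
    ∃ S : Splitting G, S.IsPrincipal ∧ S.word = W := by
  obtain ⟨path, σ, cycles, h1, h2, h3, h4, h5⟩ :=
    exists_trajectory_decomposition (stepSlot_injective hW)
  have hhead : ∀ {s L t}, Trajectory (stepSlot G W) s L t →
      L.head? = nextEdge G W s := by
    intro s L t h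
    rw [nextEdge_eq_getRight?]
    rcases L with _ | ⟨e, L⟩
    · rw [h]
      rfl
    · rw [h.1]
      rfl
  let S : Splitting G :=
    { path := path
      endIdx := σ
      cycles := cycles
      isWalk_path := fun t => isWalk_of_trajectory hW (h1 t)
      cycles_ne_nil := h3
      isWalk_cycle := fun c hc =>
        (h4 c hc).imp fun e e' h => (src_of_stepSlot (s := .inr e) hW h).symm
      -- The slot that starts a path has position `0`, so the path ends immediately exactly when the
      -- word of the outer vertex is empty.
      path_eq_nil_iff := fun t => by
        have h6 : (W (outerVertex n l r t) = []) ↔ G.inEdges (outerVertex n l r t) = ∅ := by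
          rw [List.eq_nil_iff_forall_not_mem, Finset.eq_empty_iff_forall_notMem]
          simp [DoubleGraph.inEdges, hW.2]
        rw [← h6]
        constructor
        · intro h
          have h7 := h1 t
          rw [h] at h7
          have h8 := (slotVertex_of_stepSlot h7).2
          rw [List.getElem?_eq_none_iff] at h8
          exact List.eq_nil_of_length_eq_zero (Nat.le_zero.mp h8)
        · intro h
          have h7 := hhead (h1 t)
          have h8 : nextEdge G W (.inl t) = none := by
            simp only [nextEdge, slotVertex, h, List.getElem?_nil, Option.elim_none]
            refine Fin.addCases (fun t => ?_) (fun t => ?_) t <;> simp [outerVertex, exitEdge]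
          rw [h8] at h7
          exact List.head?_eq_none_iff.mp h7
      endIdx_injective := h2
      count_eq_one := h5
      admits_path := fun t => isChain_of_trajectory hW (h1 t)
      admits_cycle := fun c hc => (h4 c hc).imp fun e e' h => admits_of_stepSlot hW h }
  -- The decomposition was made from the successor map, so following the paths and cycles returns
  -- that map.
  have hnext : S.slotNext = nextEdge G W := by
    funext s
    rcases s with t | e
    · exact hhead (h1 t)
    · rcases S.mem_path_or_mem_cycle e with ⟨t, ht⟩ | ⟨c, hc, he⟩
      · obtain ⟨a, b, hab⟩ := List.append_of_mem ht
        rw [Splitting.slotNext_of_path hab]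
        have h6 := h1 t
        change path t = _ at hab
        rw [hab] at h6
        exact hhead h6.of_append.2
      · obtain ⟨es, rfl⟩ := exists_coe_cons_of_mem he
        rw [Splitting.slotNext_of_cycle hc rfl]
        have h6 := h4 _ hc
        rw [Cycle.chain_coe_cons] at h6
        rcases hp : es ++ [e] with _ | ⟨y, b⟩
        · simp at hp
        · rw [hp, List.isChain_cons_cons] at h6
          rw [nextEdge_eq_getRight?, h6.1]
          rfl
  have hword := Splitting.word_of_slotNext hW hnext
  exact ⟨S, Splitting.isPrincipal_of_word hW hword, hword⟩

/-! ## Summing over the indices of the edges -/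

section IndexSums

/-- A list that represents a cycle. -/
def cycleList {α : Type*} (c : Cycle α) : List α := Quotient.out c

theorem coe_cycleList {α : Type*} (c : Cycle α) : (cycleList c : Cycle α) = c :=
  Quotient.out_eq c

section

variable {E X R : Type*} [CommRing R]

/-- The product `M₀_{x κ(e₁)} (M_{e₁})_{κ(e₁) κ(e₂)} ⋯ (M_{eₘ})_{κ(eₘ) z}`. -/
def chainVal (M : E → Matrix X X R) (κ : E → X) : X → Matrix X X R → List E → X → R
  | x, M₀, [], z => M₀ x z
  | x, M₀, e :: es, z => M₀ x (κ e) * chainVal M κ (κ e) (M e) es z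

theorem chainVal_congr (M : E → Matrix X X R) {κ κ' : E → X} {es : List E}
    (h : ∀ e ∈ es, κ e = κ' e) (x : X) (M₀ : Matrix X X R) (z : X) :
    chainVal M κ x M₀ es z = chainVal M κ' x M₀ es z := by
  induction es generalizing x M₀ with
  | nil => rfl
  | cons e es ih =>
    rw [chainVal, chainVal, h e List.mem_cons_self, ih fun e' he' => h e' (List.mem_cons_of_mem _ he')]

end

variable {E X R : Type*} [Fintype E] [DecidableEq E] [Fintype X] [DecidableEq X] [CommRing R]

/-- The sum of `f κ` over the `κ` that agree with `κ₀` outside `L`. -/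
def agreeSum (L : List E) (κ₀ : E → X) (f : (E → X) → R) : R :=
  ∑ κ : E → X with ∀ e, e ∉ L → κ e = κ₀ e, f κ

theorem agreeSum_congr {L : List E} {κ₀ : E → X} {f g : (E → X) → R}
    (h : ∀ κ, (∀ e, e ∉ L → κ e = κ₀ e) → f κ = g κ) : agreeSum L κ₀ f = agreeSum L κ₀ g :=
  Finset.sum_congr rfl fun κ hκ => h κ (Finset.mem_filter.mp hκ).2

theorem agreeSum_mul_left (L : List E) (κ₀ : E → X) (c : R) (f : (E → X) → R) :
    agreeSum L κ₀ (fun κ => c * f κ) = c * agreeSum L κ₀ f :=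
  (Finset.mul_sum _ _ _).symm

theorem agreeSum_nil (κ₀ : E → X) (f : (E → X) → R) : agreeSum [] κ₀ f = f κ₀ := by
  rw [agreeSum, Finset.sum_eq_single κ₀]
  · intro κ hκ hne
    exact absurd (funext fun e => (Finset.mem_filter.mp hκ).2 e (by simp)) hne
  · simp

theorem agreeSum_of_forall_mem {L : List E} (h : ∀ e, e ∈ L) (κ₀ : E → X) (f : (E → X) → R) :
    agreeSum L κ₀ f = ∑ κ, f κ := by
  rw [agreeSum, Finset.filter_true_of_mem]
  exact fun κ _ e he => absurd (h e) he

theorem agreeSum_cons {L : List E} {e : E} (he : e ∉ L) (κ₀ : E → X) (f : (E → X) → R) :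
    agreeSum (e :: L) κ₀ f = ∑ x, agreeSum L (Function.update κ₀ e x) f := by
  rw [agreeSum, ← Finset.sum_fiberwise _ (fun κ => κ e)]
  refine Finset.sum_congr rfl fun x _ => ?_
  rw [agreeSum]
  refine Finset.sum_congr ?_ fun _ _ => rfl
  ext κ
  simp only [List.mem_cons, not_or, Finset.mem_filter, Finset.mem_univ, true_and]
  constructor
  · rintro ⟨h1, rfl⟩ e' he'
    rcases eq_or_ne e' e with rfl | hne
    · rw [Function.update_self]
    · rw [Function.update_of_ne hne]
      exact h1 e' ⟨hne, he'⟩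
  · intro h
    refine ⟨fun e' he' => ?_, ?_⟩
    · rw [h e' he'.2, Function.update_of_ne he'.1]
    · rw [h e he, Function.update_self]

theorem agreeSum_append {L L' : List E} (hL : (L ++ L').Nodup) (κ₀ : E → X) (f : (E → X) → R) :
    agreeSum (L ++ L') κ₀ f = agreeSum L κ₀ fun κ => agreeSum L' κ f := by
  induction L generalizing κ₀ with
  | nil => rw [List.nil_append, agreeSum_nil]
  | cons e L ih =>
    rw [List.cons_append, List.nodup_cons] at hL
    rw [List.cons_append, agreeSum_cons hL.1, agreeSum_cons fun h => hL.1 (by simp [h])]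
    exact Finset.sum_congr rfl fun x _ => ih hL.2 _

/-- The factor `f` does not see the labels on `L'`, and the sum of `g` over the labels on `L'` does
not depend on the other labels. The double sum thus splits into a product. -/
theorem agreeSum_append_mul {L L' : List E} (hL : (L ++ L').Nodup) {f g : (E → X) → R} {a b : R}
    (hf : ∀ κ κ', (∀ e ∈ L, κ e = κ' e) → f κ = f κ') (ha : ∀ κ₀, agreeSum L κ₀ f = a)
    (hb : ∀ κ₀, agreeSum L' κ₀ g = b) (κ₀ : E → X) :
    agreeSum (L ++ L') κ₀ (fun κ => f κ * g κ) = a * b := by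
  rw [agreeSum_append hL, ← ha κ₀, mul_comm, ← agreeSum_mul_left]
  refine agreeSum_congr fun κ _ => ?_
  rw [← hb κ, mul_comm, ← agreeSum_mul_left]
  refine agreeSum_congr fun κ' hκ' => ?_
  rw [hf κ' κ fun e he => hκ' e fun he' => (List.nodup_append.mp hL).2.2 e he e he' rfl]

theorem agreeSum_flatMap {ι : Type*} {cs : List ι} {L : ι → List E} (hL : (cs.flatMap L).Nodup)
    {f : ι → (E → X) → R} {a : ι → R}
    (hf : ∀ c ∈ cs, ∀ κ κ', (∀ e ∈ L c, κ e = κ' e) → f c κ = f c κ')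
    (ha : ∀ c ∈ cs, ∀ κ₀, agreeSum (L c) κ₀ (f c) = a c) (κ₀ : E → X) :
    agreeSum (cs.flatMap L) κ₀ (fun κ => (cs.map fun c => f c κ).prod) = (cs.map a).prod := by
  induction cs generalizing κ₀ with
  | nil => simp [agreeSum_nil]
  | cons c cs ih =>
    rw [List.flatMap_cons] at hL ⊢
    simp only [List.map_cons, List.prod_cons]
    exact agreeSum_append_mul hL (hf c List.mem_cons_self) (ha c List.mem_cons_self)
      (ih (List.nodup_append.mp hL).2.1 (fun c' hc' => hf c' (List.mem_cons_of_mem _ hc'))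
        fun c' hc' => ha c' (List.mem_cons_of_mem _ hc')) κ₀

/-- Each intermediate index is a column of one matrix and a row of the next; summing it out is
matrix multiplication. -/
theorem agreeSum_chainVal (M : E → Matrix X X R) {es : List E} (hes : es.Nodup) (κ₀ : E → X)
    (x : X) (M₀ : Matrix X X R) (z : X) :
    agreeSum es κ₀ (fun κ => chainVal M κ x M₀ es z) = (M₀ * (es.map M).prod) x z := by
  induction es generalizing κ₀ x M₀ with
  | nil => simp [agreeSum_nil, chainVal]
  | cons e es ih =>
    rw [List.nodup_cons] at hes
    rw [agreeSum_cons hes.1, List.map_cons, List.prod_cons, Matrix.mul_apply]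
    refine Finset.sum_congr rfl fun y _ => ?_
    rw [← ih hes.2 (Function.update κ₀ e y), ← agreeSum_mul_left]
    refine agreeSum_congr fun κ hκ => ?_
    rw [chainVal, hκ e hes.1, Function.update_self]

/-- On a cycle the label of the first edge is both the initial row and the final column, so its
summation produces a trace. -/
theorem agreeSum_chainVal_trace (M : E → Matrix X X R) {e : E} {es : List E}
    (hes : (e :: es).Nodup) (κ₀ : E → X) :
    agreeSum (e :: es) κ₀ (fun κ => chainVal M κ (κ e) (M e) es (κ e)) =
      Matrix.trace ((e :: es).map M).prod := by
  rw [List.nodup_cons] at hes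
  rw [agreeSum_cons hes.1, Matrix.trace]
  refine Finset.sum_congr rfl fun y _ => ?_
  rw [List.map_cons, List.prod_cons, Matrix.diag_apply,
    ← agreeSum_chainVal M hes.2 (Function.update κ₀ e y)]
  refine agreeSum_congr fun κ hκ => ?_
  rw [hκ e hes.1, Function.update_self]

end IndexSums

/-! ### Contraction of indices along the paths and cycles of a splitting. -/

section SlotSums

variable {k : Type*} [Field k] {d N : ℕ} {n : ℕ} {l r : ℕ × ℕ} {G : DoubleGraph n l r}

theorem prod_edges_eq {R : Type*} [CommRing R] (S : Splitting G) (g : DEdge n l r → R) :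
    ∏ e, g e = (∏ t, ((S.path t).map g).prod) * ∏ c ∈ S.cycles, (c.toMultiset.map g).prod := by
  have h : (Finset.univ : Finset (DEdge n l r)).val =
      ∑ t, (S.path t : Multiset (DEdge n l r)) + ∑ c ∈ S.cycles, c.toMultiset := by
    ext e
    rw [Multiset.count_eq_one_of_mem Finset.univ.nodup (Finset.mem_univ e), Multiset.count_add,
      Multiset.count_sum', Multiset.count_sum', ← S.count_eq_one e]
    simp
  rw [Finset.prod_eq_multiset_prod, h, ← Multiset.coe_mapAddMonoidHom, map_add, map_sum, map_sum,
    Multiset.prod_add, Multiset.prod_sum, Multiset.prod_sum]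
  simp

variable (i j : Fin (l.1 + r.1) → Fin N)

/-- The column index of each slot is the label of the next edge, which is the row index of the next
slot. At the end of the path the column is the index `j` of the vertex where the path arrives. -/
theorem path_eq_chainVal {R : Type*} [CommRing R] (S : Splitting G)
    (M : Slot n l r → Matrix (Fin N) (Fin N) R) (κ : DEdge n l r → Fin N) (t : Fin (l.1 + r.1)) :
    M (.inl t) (i t) (slotCol j κ G S.slotNext (.inl t)) * ((S.path t).map fun e =>
      M (.inr e) (κ e) (slotCol j κ G S.slotNext (.inr e))).prod =
      chainVal (fun e => M (.inr e)) κ (i t) (M (.inl t)) (S.path t) (j (S.endIdx t)) := by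
  have key : ∀ (b a : List (DEdge n l r)) (s : Slot n l r) (x : Fin N), S.path t = a ++ b →
      S.slotNext s = b.head? → G.IsWalk (slotVertex G s) b (outerVertex n l r (S.endIdx t)) →
      M s x (slotCol j κ G S.slotNext s) * (b.map fun e =>
        M (.inr e) (κ e) (slotCol j κ G S.slotNext (.inr e))).prod =
      chainVal (fun e => M (.inr e)) κ x (M s) b (j (S.endIdx t)) := by
    intro b
    induction b with
    | nil =>
      intro a s x _ h2 h3
      rw [chainVal, slotCol, h2]
      simp only [List.head?_nil, Option.elim_none, List.map_nil, List.prod_nil, mul_one]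
      rw [show slotVertex G s = _ from h3, exitIdx_outerVertex]
    | cons e b ih =>
      intro a s x h1 h2 h3
      rw [chainVal, List.map_cons, List.prod_cons,
        ih (a ++ [e]) (.inr e) (κ e) (by simpa using h1) (Splitting.slotNext_of_path h1) h3.2]
      congr 2
      simp [slotCol, h2]
  exact key _ [] _ _ rfl rfl (S.isWalk_path t)

theorem cycle_eq_chainVal {R : Type*} [CommRing R] (S : Splitting G)
    (M : Slot n l r → Matrix (Fin N) (Fin N) R) (κ : DEdge n l r → Fin N) {e : DEdge n l r}
    {es : List (DEdge n l r)} (h : (↑(e :: es) : Cycle (DEdge n l r)) ∈ S.cycles) :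
    ((e :: es).map fun e => M (.inr e) (κ e) (slotCol j κ G S.slotNext (.inr e))).prod =
      chainVal (fun e => M (.inr e)) κ (κ e) (M (.inr e)) es (κ e) := by
  have key : ∀ (es : List (DEdge n l r)) (x z : DEdge n l r),
      (x :: (es ++ [z])).IsChain (fun e e' => S.slotNext (.inr e) = some e') →
      ((x :: es).map fun e => M (.inr e) (κ e) (slotCol j κ G S.slotNext (.inr e))).prod =
      chainVal (fun e => M (.inr e)) κ (κ x) (M (.inr x)) es (κ z) := by
    intro es
    induction es with
    | nil =>
      intro x z h
      simp only [List.nil_append, List.isChain_cons_cons] at h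
      simp [chainVal, slotCol, h.1]
    | cons e es ih =>
      intro x z h
      rw [List.cons_append, List.isChain_cons_cons] at h
      rw [List.map_cons, List.prod_cons, ih e z h.2, chainVal]
      simp [slotCol, h.1]
  have h1 := Splitting.chain_slotNext h
  rw [Cycle.chain_coe_cons] at h1
  exact key es e e h1

theorem trace_cycProd (y : DEdge n l r → NCPoly k d) (L : List (DEdge n l r)) :
    trace k d N (cycProd y (L : Cycle (DEdge n l r))) =
      Matrix.trace (L.map fun e => generic k d N (y e)).prod := by
  have h1 : (cycProd y (L : Cycle (DEdge n l r)) : ANat k (NCPoly k d)) =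
    (commutators k (NCPoly k d)).mkQ (L.map y).prod := rfl
  rw [h1, trace, Submodule.mkQ_apply, Submodule.liftQ_apply]
  simp [map_list_prod, List.map_map, Function.comp_def]

/-- The contraction of all index pairs along the paths and cycles of a splitting. -/
theorem sum_prod_slots (S : Splitting G) (y : Slot n l r → NCPoly k d) :
    ∑ κ : DEdge n l r → Fin N, ∏ s, entry k d N (slotRow i κ s) (slotCol j κ G S.slotNext s) (y s) =
      (∏ t, entry k d N (i t) (j (S.endIdx t)) (pathProd S y t)) *
        ∏ c ∈ S.cycles, trace k d N (cycProd (fun e => y (.inr e)) c) := by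
  -- There are no labellings only if `N = 0` and there is an edge. The left side is then an empty
  -- sum. On the right, an edge on a path contradicts the existence of `i t : Fin 0`, and an edge on
  -- a cycle gives the trace of an empty matrix.
  rcases isEmpty_or_nonempty (DEdge n l r → Fin N) with hemp | ⟨⟨κ₀⟩⟩
  · obtain ⟨e⟩ : Nonempty (DEdge n l r) := by
      by_contra h
      rw [not_nonempty_iff] at h
      exact hemp.elim fun e => h.elim e
    have hN : IsEmpty (Fin N) := by
      by_contra h
      rw [not_isEmpty_iff] at h
      obtain ⟨x⟩ := h
      exact hemp.elim fun _ => x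
    rw [Finset.univ_eq_empty, Finset.sum_empty]
    symm
    rcases S.mem_path_or_mem_cycle e with ⟨t, -⟩ | ⟨c, hc, -⟩
    · exact hN.elim (i t)
    · rw [Finset.prod_eq_zero hc, mul_zero]
      induction c using Quotient.inductionOn' with
      | h L =>
        refine (trace_cycProd _ L).trans ?_
        simp [Matrix.trace]
  let M : Slot n l r → Matrix (Fin N) (Fin N) (RepRing k d N) := fun s => generic k d N (y s)
  have hrep : ∀ c ∈ S.cycles, ∃ e es, cycleList c = e :: es := by
    intro c hc
    rcases h : cycleList c with _ | ⟨e, es⟩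
    · refine absurd ?_ (S.cycles_ne_nil c hc)
      rw [← coe_cycleList c, h, Cycle.coe_nil]
    · exact ⟨e, es, rfl⟩
  have hout : ∀ c : Cycle (DEdge n l r), (cycleList c : Cycle (DEdge n l r)) = c :=
    fun c => coe_cycleList c
  let fp : Fin (l.1 + r.1) → (DEdge n l r → Fin N) → RepRing k d N := fun t κ =>
    chainVal (fun e => M (.inr e)) κ (i t) (M (.inl t)) (S.path t) (j (S.endIdx t))
  -- The product of entries is taken in a commutative ring, so any list representing the cycle may
  -- be used.
  let fc : Cycle (DEdge n l r) → (DEdge n l r → Fin N) → RepRing k d N := fun c κ =>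
    ((cycleList c).map fun e => M (.inr e) (κ e) (slotCol j κ G S.slotNext (.inr e))).prod
  have hfc : ∀ c ∈ S.cycles, ∀ e es, cycleList c = e :: es → ∀ κ, fc c κ =
      chainVal (fun e => M (.inr e)) κ (κ e) (M (.inr e)) es (κ e) := by
    intro c hc e es h κ
    have h1 : (↑(e :: es) : Cycle (DEdge n l r)) ∈ S.cycles := by rwa [← h, hout]
    simp only [fc, h]
    exact cycle_eq_chainVal j S M κ h1
  have hnodup : ((List.finRange (l.1 + r.1)).flatMap S.path ++
      S.cycles.toList.flatMap cycleList).Nodup := by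
    rw [List.nodup_append, List.nodup_flatMap, List.nodup_flatMap]
    refine ⟨⟨fun t _ => S.nodup_path t, ?_⟩, ⟨fun c hc => ?_, ?_⟩, ?_⟩
    · refine (List.nodup_finRange _).imp fun {t t'} hne => ?_
      rw [Function.onFun, List.disjoint_left]
      exact fun e h h' => hne (S.mem_path_unique h h')
    · have h1 := S.nodup_cycle c (Finset.mem_toList.mp hc)
      rwa [← hout c, Cycle.nodup_coe_iff] at h1
    · refine (Finset.nodup_toList _).imp_of_mem fun {c c'} hc hc' hne => ?_
      rw [Function.onFun, List.disjoint_left]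
      intro e h h'
      refine hne (S.mem_cycle_unique (e := e) (Finset.mem_toList.mp hc) (Finset.mem_toList.mp hc')
        ?_ ?_)
      · rwa [← hout c, Cycle.mem_coe_iff]
      · rwa [← hout c', Cycle.mem_coe_iff]
    · rintro e he e' he' rfl
      obtain ⟨t, -, ht⟩ := List.mem_flatMap.mp he
      obtain ⟨c, hc, hce⟩ := List.mem_flatMap.mp he'
      refine S.not_mem_path_of_mem_cycle (Finset.mem_toList.mp hc) ?_ t ht
      rwa [← hout c, Cycle.mem_coe_iff]
  have hall : ∀ e, e ∈ (List.finRange (l.1 + r.1)).flatMap S.path ++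
      S.cycles.toList.flatMap cycleList := by
    intro e
    rw [List.mem_append, List.mem_flatMap, List.mem_flatMap]
    rcases S.mem_path_or_mem_cycle e with ⟨t, ht⟩ | ⟨c, hc, he⟩
    · exact Or.inl ⟨t, List.mem_finRange t, ht⟩
    · refine Or.inr ⟨c, Finset.mem_toList.mpr hc, ?_⟩
      rwa [← hout c, Cycle.mem_coe_iff] at he
  have hsplit : ∀ κ : DEdge n l r → Fin N,
      ∏ s, entry k d N (slotRow i κ s) (slotCol j κ G S.slotNext s) (y s) =
        ((List.finRange (l.1 + r.1)).map fun t => fp t κ).prod *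
          (S.cycles.toList.map fun c => fc c κ).prod := by
    intro κ
    rw [Fintype.prod_sum_type, prod_edges_eq S, ← mul_assoc, ← Finset.prod_mul_distrib,
      Finset.prod_map_toList, ← List.ofFn_eq_map, List.prod_ofFn]
    congr 1
    · exact Finset.prod_congr rfl fun t _ => path_eq_chainVal i j S M κ t
    · refine Finset.prod_congr rfl fun c hc => ?_
      conv_lhs => rw [← hout c]
      rw [Cycle.coe_toMultiset, Multiset.map_coe, Multiset.prod_coe]
      rfl
  -- All edges, each once, are listed along the paths and the chosen representatives of the cycles.
  -- The sum over all labellings therefore factors along these lists.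
  rw [Finset.sum_congr rfl fun κ _ => hsplit κ, ← agreeSum_of_forall_mem hall κ₀]
  rw [agreeSum_append_mul hnodup (a := ((List.finRange (l.1 + r.1)).map fun t =>
      entry k d N (i t) (j (S.endIdx t)) (pathProd S y t)).prod)
    (b := (S.cycles.toList.map fun c => trace k d N (cycProd (fun e => y (.inr e)) c)).prod)]
  · rw [Finset.prod_map_toList, ← List.ofFn_eq_map, List.prod_ofFn]
  · intro κ κ' h
    congr 1
    refine List.map_congr_left fun t _ => chainVal_congr _ (fun e he => h e ?_) _ _ _
    exact List.mem_flatMap.mpr ⟨t, List.mem_finRange t, he⟩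
  · refine agreeSum_flatMap (List.nodup_append.mp hnodup).1 (fun t _ κ κ' h =>
      chainVal_congr _ h _ _ _) fun t _ κ => ?_
    rw [agreeSum_chainVal _ (S.nodup_path t)]
    simp [M, pathProd, entry, map_list_prod, List.map_map, Function.comp_def]
  · refine agreeSum_flatMap (List.nodup_append.mp hnodup).2.1 (fun c hc κ κ' h => ?_)
      fun c hc κ => ?_
    · obtain ⟨e, es, hes⟩ := hrep c (Finset.mem_toList.mp hc)
      rw [hfc c (Finset.mem_toList.mp hc) e es hes, hfc c (Finset.mem_toList.mp hc) e es hes,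
        h e (by simp [hes])]
      exact chainVal_congr _ (fun e' he' => h e' (by simp [hes, he'])) _ _ _
    · obtain ⟨e, es, hes⟩ := hrep c (Finset.mem_toList.mp hc)
      have hn : (e :: es).Nodup := by
        have h1 := S.nodup_cycle c (Finset.mem_toList.mp hc)
        rwa [← hout c, Cycle.nodup_coe_iff, hes] at h1
      conv_rhs => rw [← hout c, trace_cycProd]
      rw [agreeSum_congr fun κ _ => hfc c (Finset.mem_toList.mp hc) e es hes κ, hes,
        agreeSum_chainVal_trace _ hn]

end SlotSums

/-! ## The identity between the two operators on representatives -/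

/-- The vertices of an admissible graph, listed. -/
def GVertex.equivOption (n : ℕ) : GVertex n ≃ Option (Option (Fin n)) where
  toFun
    | .num b => some (some b)
    | .L => none
    | .R => some none
  invFun
    | some (some b) => .num b
    | none => .L
    | some none => .R
  left_inv v := by cases v <;> rfl
  right_inv v := by rcases v with _ | _ | v <;> rfl

instance (n : ℕ) : Fintype (GVertex n) := Fintype.ofEquiv _ (GVertex.equivOption n).symm

theorem GVertex.prod_eq {n : ℕ} {R : Type*} [CommRing R] (f : GVertex n → R) :
    ∏ v, f v = (∏ b, f (.num b)) * f .L * f .R := by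
  rw [← (GVertex.equivOption n).symm.prod_comp, Fintype.prod_option, Fintype.prod_option]
  change f .L * (f .R * ∏ b, f (.num b)) = _
  ring

/-! ### Families of words as double graphs with principal splittings. -/

section WordSums

variable {n : ℕ} {l r : ℕ × ℕ}

/-- The list of all edge labels. -/
abbrev edgeList (n : ℕ) : List (EdgeLabel n) := List.finRange n ×ˢ List.finRange 2

theorem nodup_edgeList (n : ℕ) : (edgeList n).Nodup :=
  (List.nodup_finRange n).product (List.nodup_finRange 2)

theorem mem_edgeList {n : ℕ} (e : EdgeLabel n) : e ∈ edgeList n :=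
  List.mem_product.mpr ⟨List.mem_finRange _, List.mem_finRange _⟩

open Classical in
/-- The families of words are the words of the principal splittings of the double admissible
graphs over a given admissible graph. -/
theorem sum_wordFamilies {R : Type*} [AddCommMonoid R] (Γ : AdmissibleGraph n)
    (Θ : (DVertex n l r → List (EdgeLabel n)) → R) :
    ((wordFamilies Γ.target (DVertex.merge (l := l) (r := r)) (edgeList n)).map Θ).sum =
      ∑ G : DoubleGraph n l r with G.toAdmissible = Γ,
        ∑ S : Splitting G with S.IsPrincipal, Θ S.word := by
  rw [← List.sum_toFinset Θ (nodup_wordFamilies _ _ (nodup_edgeList n)), Finset.sum_sigma']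
  symm
  refine Finset.sum_bij (fun x _ => x.2.word) ?_ ?_ ?_ ?_
  · rintro ⟨G, S⟩ h
    simp only [Finset.mem_sigma, Finset.mem_filter, Finset.mem_univ, true_and] at h
    have hW := Splitting.isOrdering_word h.2
    rw [List.mem_toFinset, mem_wordFamilies (nodup_edgeList n)]
    refine ⟨hW.1, fun v e he => ⟨?_, mem_edgeList e⟩, fun e _ => ⟨G.target e, (hW.2 _ e).mpr rfl⟩,
      fun v v' e he he' => ((hW.2 v e).mp he).symm.trans ((hW.2 v' e).mp he')⟩
    rw [← (hW.2 v e).mp he, ← h.1]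
    rfl
  · rintro ⟨G, S⟩ h ⟨G', S'⟩ h' hw
    simp only [Finset.mem_sigma, Finset.mem_filter, Finset.mem_univ, true_and] at h h'
    have hW := Splitting.isOrdering_word h.2
    have hW' := Splitting.isOrdering_word h'.2
    simp only at hw
    -- The endpoint of `e` is the vertex whose word contains `e`, so the words determine the double
    -- graph before they determine the splitting.
    obtain rfl : G = G' := by
      refine DoubleGraph.ext (funext fun e => ?_)
      have h1 := (hW.2 _ e).mpr rfl
      rw [hw] at h1
      exact ((hW'.2 _ e).mp h1).symm
    rw [Splitting.eq_of_word h.2 h'.2 hw]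
  · intro W hW
    rw [List.mem_toFinset, mem_wordFamilies (nodup_edgeList n)] at hW
    obtain ⟨h1, h2, h3, h4⟩ := hW
    -- The double graph is built by letting each edge end at the vertex in whose word it occurs.
    choose target htarget using fun e => h3 e (mem_edgeList e)
    have hm : ∀ e, (target e).merge = Γ.target e := fun e => (h2 _ e (htarget e)).1
    let G : DoubleGraph n l r :=
      { target := target
        no_loop := fun k i => by rw [hm]; exact Γ.no_loop k i
        no_multiple := fun k => by rw [hm, hm]; exact Γ.no_multiple k }
    have hW : IsOrdering G W := ⟨h1, fun v e =>
      ⟨fun he => h4 _ _ e (htarget e) he, fun he => he ▸ htarget e⟩⟩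
    obtain ⟨S, hS, hw⟩ := exists_splitting_word hW
    refine ⟨⟨G, S⟩, ?_, hw⟩
    simp only [Finset.mem_sigma, Finset.mem_filter, Finset.mem_univ, true_and]
    exact ⟨AdmissibleGraph.ext (funext hm), hS⟩
  · intros
    rfl

end WordSums

/-! ### The Leibniz rule for the factors of Kontsevich's operator. -/

section Identity

variable {k : Type*} [Field k] {d N : ℕ} {n : ℕ} {l r : ℕ × ℕ}

theorem derivation_prod {R : Type*} [CommRing R] [Algebra k R] (D : Derivation k R R) {ι : Type*}
    [DecidableEq ι] (s : Finset ι) (f : ι → R) :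
    D (∏ v ∈ s, f v) = ∑ v ∈ s, D (f v) * ∏ v' ∈ s.erase v, f v' := by
  induction s using Finset.induction_on with
  | empty => simp
  | insert a s ha ih =>
    rw [Finset.prod_insert ha, Derivation.leibniz, ih, Finset.sum_insert ha,
      Finset.erase_insert ha, add_comm, smul_eq_mul, smul_eq_mul, mul_comm, Finset.mul_sum]
    congr 1
    refine Finset.sum_congr rfl fun v hv => ?_
    rw [Finset.erase_insert_of_ne (by rintro rfl; exact ha hv), Finset.prod_insert (by simp [ha])]
    ring

theorem derivation_mul'_map {A R : Type*} [Ring A] [Algebra k A] [CommRing R] [Algebra k R]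
    (D : Derivation k R R) (φ ψ : A →ₗ[k] R) (t : A ⊗[k] A) :
    D (LinearMap.mul' k _ (TensorProduct.map φ ψ t)) =
      LinearMap.mul' k _ (TensorProduct.map (D.toLinearMap ∘ₗ φ) ψ t) +
        LinearMap.mul' k _ (TensorProduct.map φ (D.toLinearMap ∘ₗ ψ) t) := by
  induction t with
  | zero => simp
  | tmul x y =>
    simp only [TensorProduct.map_tmul, LinearMap.mul'_apply, Derivation.leibniz, smul_eq_mul,
      LinearMap.comp_apply]
    change φ x * D (ψ y) + ψ y * D (φ x) = D (φ x) * ψ y + φ x * D (ψ y)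
    ring
  | add x y hx hy =>
    simp only [map_add, hx, hy]
    abel

/-- The coordinate of an edge label. -/
def edgeCoord (I : EdgeLabel n → Fin d) (κ : DEdge n l r → Fin N) (e : EdgeLabel n) :
    Fin d × Fin N × Fin N :=
  (I e, κ (.refl e), κ (.proper e))

variable (I : EdgeLabel n → Fin d) (i j : Fin (l.1 + r.1) → Fin N) (κ : DEdge n l r → Fin N)

theorem pderiv_vertexEntry (e : EdgeLabel n) (v : DVertex n l r) (w : List (EdgeLabel n))
    (z : NCPoly k d) :
    MvPolynomial.pderiv (edgeCoord I κ e) (vertexEntry I i j κ v w z) =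
      ((List.permutations'Aux e w).map fun w' => vertexEntry I i j κ v w' z).sum :=
  pderiv_wordEntry I (fun e => κ (.refl e)) (fun e => κ (.proper e)) e w _ _ z

/-- The product of the entries at the vertices that merge to a given vertex. -/
def outerEntry (z : DVertex n l r → NCPoly k d) (b : GVertex n)
    (W : DVertex n l r → List (EdgeLabel n)) : RepRing k d N :=
  ∏ v : DVertex n l r with v.merge = b, vertexEntry I i j κ v (W v) (z v)

theorem pderiv_outerEntry (z : DVertex n l r → NCPoly k d) (e : EdgeLabel n) (b : GVertex n)
    (W : DVertex n l r → List (EdgeLabel n)) :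
    MvPolynomial.pderiv (edgeCoord I κ e) (outerEntry I i j κ z b W) =
      ∑ v : DVertex n l r with v.merge = b, ((List.permutations'Aux e (W v)).map fun w =>
        outerEntry I i j κ z b (Function.update W v w)).sum := by
  rw [outerEntry, derivation_prod]
  refine Finset.sum_congr rfl fun v hv => ?_
  rw [pderiv_vertexEntry, ← List.sum_map_mul_right]
  congr 1
  refine List.map_congr_left fun w _ => ?_
  rw [outerEntry, ← Finset.mul_prod_erase _ _ hv, Function.update_self]
  congr 1
  exact Finset.prod_congr rfl fun v' hv' => by
    rw [Function.update_of_ne (Finset.ne_of_mem_erase hv')]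

theorem outerEntry_update (z : DVertex n l r → NCPoly k d) (b : GVertex n)
    (W : DVertex n l r → List (EdgeLabel n)) (v : DVertex n l r) (w : List (EdgeLabel n))
    (hv : v.merge ≠ b) :
    outerEntry I i j κ z b (Function.update W v w) = outerEntry I i j κ z b W := by
  refine Finset.prod_congr rfl fun v' hv' => ?_
  rw [Function.update_of_ne]
  rintro rfl
  exact hv (Finset.mem_filter.mp hv').2

theorem filter_merge_num (b : Fin n) :
    (Finset.univ.filter fun v : DVertex n l r => v.merge = GVertex.num b) =
      {.num (b, 0), .num (b, 1)} := by
  ext v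
  rw [Finset.mem_filter]
  rcases v with ⟨c, s⟩ | t | t | p | q
  · fin_cases s <;> simp [DVertex.merge]
  all_goals simp [DVertex.merge]

theorem filter_merge_L :
    (Finset.univ.filter fun v : DVertex n l r => v.merge = GVertex.L) =
      Finset.univ.image DVertex.left ∪ Finset.univ.image DVertex.leftLoop := by
  ext v
  rw [Finset.mem_filter]
  cases v <;> simp [DVertex.merge]

theorem filter_merge_R :
    (Finset.univ.filter fun v : DVertex n l r => v.merge = GVertex.R) =
      Finset.univ.image DVertex.right ∪ Finset.univ.image DVertex.rightLoop := by
  ext v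
  rw [Finset.mem_filter]
  cases v <;> simp [DVertex.merge]

variable (P : DoublePoissonBracket k (NCPoly k d))

theorem map_sum_comp_vertexEntry (e : EdgeLabel n) (v : DVertex n l r) (w : List (EdgeLabel n)) :
    (MvPolynomial.pderiv (edgeCoord I κ e)).toLinearMap ∘ₗ vertexEntry (k := k) I i j κ v w =
      ((List.permutations'Aux e w).map fun w' => vertexEntry I i j κ v w').sum := by
  refine LinearMap.ext fun z => ?_
  refine (pderiv_vertexEntry I i j κ e v w z).trans ?_
  induction List.permutations'Aux e w with
  | nil => simp
  | cons w' ws ih => rw [List.map_cons, List.sum_cons, ih, List.map_cons, List.sum_cons]; rfl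

theorem pderiv_blockEntry (e : EdgeLabel n) (b : Fin n)
    (W : DVertex n l r → List (EdgeLabel n)) :
    MvPolynomial.pderiv (edgeCoord I κ e) (blockEntry P I i j κ W b) =
      ∑ v : DVertex n l r with v.merge = GVertex.num b,
        ((List.permutations'Aux e (W v)).map fun w =>
          blockEntry P I i j κ (Function.update W v w) b).sum := by
  rw [filter_merge_num, Finset.sum_pair (by simp), blockEntry, derivation_mul'_map,
    map_sum_comp_vertexEntry, map_sum_comp_vertexEntry]
  congr 1
  · induction List.permutations'Aux e (W (.num (b, 0))) with
    | nil => simp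
    | cons w ws ih =>
      rw [List.map_cons, List.sum_cons, TensorProduct.map_add_left, LinearMap.add_apply, map_add,
        ih, List.map_cons, List.sum_cons]
      simp [blockEntry]
  · induction List.permutations'Aux e (W (.num (b, 1))) with
    | nil => simp
    | cons w ws ih =>
      rw [List.map_cons, List.sum_cons, TensorProduct.map_add_right, LinearMap.add_apply, map_add,
        ih, List.map_cons, List.sum_cons]
      simp [blockEntry]

theorem blockEntry_update (b : Fin n) (W : DVertex n l r → List (EdgeLabel n))
    (v : DVertex n l r) (w : List (EdgeLabel n)) (hv : v.merge ≠ GVertex.num b) :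
    blockEntry P I i j κ (Function.update W v w) b = blockEntry P I i j κ W b := by
  rw [blockEntry, blockEntry, Function.update_of_ne, Function.update_of_ne]
  all_goals
    rintro rfl
    exact hv rfl

/-- Since `*e_k^2` ends at `k.1` and `*e_k^1` at `k.2`, the two components carry the indices
(`*e_k^2`, `e_k^1`) and (`*e_k^1`, `e_k^2`). This crossing is the one in the formula for the bracket
of two coordinates. -/
theorem blockEntry_nil (b : Fin n) :
    blockEntry P I i j κ (fun _ => []) b =
      repBracket P (MvPolynomial.X (edgeCoord I κ (b, 0)))
        (MvPolynomial.X (edgeCoord I κ (b, 1))) := by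
  rw [repBracket, Finset.sum_eq_single (edgeCoord I κ (b, 0)),
    Finset.sum_eq_single (edgeCoord I κ (b, 1))]
  · simp [edgeCoord, blockEntry, vertexEntry, wordEntry, entry₂, zeroSlot, slotRow, exitIdx,
      Fin.rev]
  · intro s _ hs
    rw [MvPolynomial.pderiv_X_of_ne hs.symm]
    simp
  · simp
  · intro s _ hs
    rw [MvPolynomial.pderiv_X_of_ne hs.symm]
    simp
  · simp

/-- The product of the factors in all blocks, differentiated, as a sum over families of words. -/
theorem prod_derivAt_eq_sum (Γ : AdmissibleGraph n) (z : DVertex n l r → NCPoly k d) :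
    (∏ b : Fin n, derivAt Γ (edgeCoord I κ) (GVertex.num b)
      (repBracket P (MvPolynomial.X (edgeCoord I κ (b, 0)))
        (MvPolynomial.X (edgeCoord I κ (b, 1))))) *
      derivAt Γ (edgeCoord I κ) GVertex.L (outerEntry I i j κ z .L fun _ => []) *
      derivAt Γ (edgeCoord I κ) GVertex.R (outerEntry I i j κ z .R fun _ => []) =
    ((wordFamilies Γ.target (DVertex.merge (l := l) (r := r)) (edgeList n)).map fun W =>
      (∏ b, blockEntry P I i j κ W b) * outerEntry I i j κ z .L W *
        outerEntry I i j κ z .R W).sum := by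
  -- The blocks of the Leibniz rule are the vertices of `Γ`; a word inserted at a vertex of the
  -- double graph affects only the block to which that vertex merges.
  let Ψ : GVertex n → (DVertex n l r → List (EdgeLabel n)) → RepRing k d N
    | .num b, W => blockEntry P I i j κ W b
    | .L, W => outerEntry I i j κ z .L W
    | .R, W => outerEntry I i j κ z .R W
  have h := prod_foldr_eq_sum_wordFamilies Γ.target (DVertex.merge (l := l) (r := r))
    (fun e => (MvPolynomial.pderiv (R := k) (edgeCoord I κ e)).toLinearMap.toAddMonoidHom) Ψ
    ?_ ?_ (edgeList n) (fun _ => AddMonoidHom.id _)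
  · simp only [AddMonoidHom.id_apply, GVertex.prod_eq] at h
    rw [← h]
    simp only [← blockEntry_nil I i j κ P]
    rfl
  · intro e W
    rcases hT : Γ.target e with b | _ | _
    · exact pderiv_blockEntry I i j κ P e b W
    · exact pderiv_outerEntry I i j κ z e _ W
    · exact pderiv_outerEntry I i j κ z e _ W
  · rintro (b | _ | _) W v w hv
    · exact blockEntry_update I i j κ P b W v w hv
    · exact outerEntry_update I i j κ z _ W v w hv
    · exact outerEntry_update I i j κ z _ W v w hv

end Identity

/-! ### The functions on representation spaces given by elements of `O(A)`. -/

section Indexed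

variable {k A : Type*} [Field k] [Ring A] [Algebra k A]

/-- The components of the canonical surjection onto `O(A)`. -/
def preToOComp (l : ℕ × ℕ) : PreComp k A l →ₗ[k] OComp k A l.1 :=
  TensorProduct.map (TensorProduct.map LinearMap.id (symProd l.2)) LinearMap.id

theorem preToO_lof (l : ℕ × ℕ) (x : PreComp k A l) :
    preToO (DirectSum.lof k (ℕ × ℕ) (PreComp k A) l x) =
      DirectSum.lof k ℕ (OComp k A) l.1 (preToOComp l x) := by
  rw [preToO, DirectSum.toModule_lof]
  rfl

theorem PreComp.hom_ext {M : Type*} [AddCommMonoid M] [Module k M] {l : ℕ × ℕ}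
    {φ ψ : PreComp k A l →ₗ[k] M}
    (h : ∀ a f u, φ ((PiTensorProduct.tprod k a ⊗ₜ[k] PiTensorProduct.tprod k f) ⊗ₜ[k]
        MonoidAlgebra.of k _ u) =
      ψ ((PiTensorProduct.tprod k a ⊗ₜ[k] PiTensorProduct.tprod k f) ⊗ₜ[k]
        MonoidAlgebra.of k _ u)) : φ = ψ := by
  ext a f u
  exact h a f u

theorem symProd_tprod {m : ℕ} (f : Fin m → A) :
    symProd m (PiTensorProduct.tprod k f) =
      ∏ p, SymmetricAlgebra.ι k (ANat k A) ((commutators k A).mkQ (f p)) := by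
  simp [symProd]

theorem permProd_of (n m : ℕ) (u : Equiv.Perm (Fin n)) (v : Equiv.Perm (Fin m)) :
    permProd (k := k) n m (MonoidAlgebra.of k _ u ⊗ₜ[k] MonoidAlgebra.of k _ v) =
      MonoidAlgebra.of k _ (permLeft n m u * permRight n m v) := by
  simp [permProd]

theorem permLeft_mul_permRight_inv_castAdd {n m : ℕ} (u : Equiv.Perm (Fin n))
    (v : Equiv.Perm (Fin m)) (t : Fin n) :
    (permLeft n m u * permRight n m v)⁻¹ (Fin.castAdd m t) = Fin.castAdd m (u⁻¹ t) := by
  rw [Equiv.Perm.inv_eq_iff_eq]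
  simp [permLeft, permRight]

theorem permLeft_mul_permRight_inv_natAdd {n m : ℕ} (u : Equiv.Perm (Fin n))
    (v : Equiv.Perm (Fin m)) (t : Fin m) :
    (permLeft n m u * permRight n m v)⁻¹ (Fin.natAdd n t) = Fin.natAdd n (v⁻¹ t) := by
  rw [Equiv.Perm.inv_eq_iff_eq]
  simp [permLeft, permRight]

variable {d N : ℕ}

/-- The map `a ⊗ f₁ ⋯ fₛ ↦ ∏ₜ (a_t)_{i_t j_t} · tr(f₁) ⋯ tr(fₛ)`. -/
def indexedId {m : ℕ} (i j : Fin m → Fin N) :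
    TPow k (NCPoly k d) m ⊗[k] SymmetricAlgebra k (ANat k (NCPoly k d)) →ₗ[k] RepRing k d N :=
  LinearMap.mul' k (RepRing k d N) ∘ₗ TensorProduct.map
    (PiTensorProduct.lift ((MultilinearMap.mkPiAlgebra k (Fin m) (RepRing k d N)).compLinearMap
      fun t => entry k d N (i t) (j t)))
    (SymmetricAlgebra.lift (trace k d N)).toLinearMap

theorem indexedId_tmul {m : ℕ} (i j : Fin m → Fin N) (a : Fin m → NCPoly k d)
    (g : SymmetricAlgebra k (ANat k (NCPoly k d))) :
    indexedId i j (PiTensorProduct.tprod k a ⊗ₜ[k] g) =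
      (∏ t, entry k d N (i t) (j t) (a t)) * SymmetricAlgebra.lift (trace k d N) g := by
  simp [indexedId]

theorem indexed_tmul_of {m : ℕ} (i j : Fin m → Fin N)
    (x : TPow k (NCPoly k d) m ⊗[k] SymmetricAlgebra k (ANat k (NCPoly k d)))
    (u : Equiv.Perm (Fin m)) :
    indexed N i j (x ⊗ₜ[k] MonoidAlgebra.of k _ u) = indexedId (fun t => i (u⁻¹ t)) j x := by
  simp [indexed, indexedId]

/-- Substituting `σ t` for `t` cancels `σ` in the row index `i ((σ u)⁻¹ (σ t))` and leaves it in the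
column index. A path from `t` thus gets the column index of its endpoint `σ t`. -/
theorem indexed_leftAct {m : ℕ} (i j : Fin m → Fin N) (σ u : Equiv.Perm (Fin m))
    (x : TPow k (NCPoly k d) m ⊗[k] SymmetricAlgebra k (ANat k (NCPoly k d))) :
    indexed N i j (leftAct σ (x ⊗ₜ[k] MonoidAlgebra.of k _ u)) =
      indexedId (fun t => i (u⁻¹ t)) (fun t => j (σ t)) x := by
  have h : leftAct σ (x ⊗ₜ[k] MonoidAlgebra.of k _ u) =
      TensorProduct.map (PiTensorProduct.reindex k (fun _ => NCPoly k d) σ).toLinearMap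
        LinearMap.id x ⊗ₜ[k] MonoidAlgebra.of k _ (σ * u) := by
    rw [leftAct, TensorProduct.map_tmul, LinearMap.mulLeft_apply, map_mul]
  rw [h, indexed_tmul_of]
  have : indexedId (fun t => i ((σ * u)⁻¹ t)) j ∘ₗ
      TensorProduct.map (PiTensorProduct.reindex k (fun _ => NCPoly k d) σ).toLinearMap
        LinearMap.id = indexedId (k := k) (d := d) (fun t => i (u⁻¹ t)) (fun t => j (σ t)) := by
    refine TensorProduct.ext (PiTensorProduct.ext (MultilinearMap.ext fun a =>
      LinearMap.ext fun g => ?_))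
    change indexedId _ j (PiTensorProduct.reindex k (fun _ => NCPoly k d) σ
      (PiTensorProduct.tprod k a) ⊗ₜ[k] g) = indexedId _ _ (PiTensorProduct.tprod k a ⊗ₜ[k] g)
    rw [PiTensorProduct.reindex_tprod, indexedId_tmul, indexedId_tmul, ← Equiv.prod_comp σ]
    simp
  exact LinearMap.congr_fun this x

theorem trace_mkQ (f : NCPoly k d) :
    trace k d N ((commutators k (NCPoly k d)).mkQ f) = ∑ c, entry k d N c c f := by
  simp [trace, entry, Matrix.trace]

/-- Expanding each trace over its diagonal introduces the indices `c p`, which later become the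
labels of the loops. -/
theorem indexed_preToOComp {l : ℕ × ℕ} (i j : Fin l.1 → Fin N) (a : Fin l.1 → NCPoly k d)
    (f : Fin l.2 → NCPoly k d) (u : Equiv.Perm (Fin l.1)) :
    indexed N i j (preToOComp l ((PiTensorProduct.tprod k a ⊗ₜ[k] PiTensorProduct.tprod k f) ⊗ₜ[k]
        MonoidAlgebra.of k _ u)) =
      ∑ c : Fin l.2 → Fin N, (∏ t, entry k d N (i (u⁻¹ t)) (j t) (a t)) *
        ∏ p, entry k d N (c p) (c p) (f p) := by
  rw [preToOComp, TensorProduct.map_tmul, LinearMap.id_apply, indexed_tmul_of,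
    TensorProduct.map_tmul, LinearMap.id_apply, indexedId_tmul, symProd_tprod, map_prod,
    ← Finset.mul_sum]
  simp only [SymmetricAlgebra.lift_ι_apply, trace_mkQ]
  rw [Finset.prod_univ_sum, Fintype.piFinset_univ]

variable {n : ℕ} {l r : ℕ × ℕ} {G : DoubleGraph n l r}

/-- Linear extension of `sum_prod_slots` from pure tensors to all elements of the slot algebra. -/
theorem indexedId_contract (S : Splitting G) (i j : Fin (l.1 + r.1) → Fin N)
    (z : SlotAlg k (NCPoly k d) n l r) :
    indexedId i (fun t => j (S.endIdx t)) (PiTensorProduct.lift (contract S) z) =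
      ∑ κ : DEdge n l r → Fin N, evalSlots (slotRow i κ) (slotCol j κ G S.slotNext) z := by
  have : indexedId i (fun t => j (S.endIdx t)) ∘ₗ PiTensorProduct.lift (contract S) =
      ∑ κ : DEdge n l r → Fin N, evalSlots (k := k) (d := d) (slotRow i κ)
        (slotCol j κ G S.slotNext) := by
    refine PiTensorProduct.ext (MultilinearMap.ext fun y => ?_)
    have h1 : contract (k := k) S y = contractFun S y := rfl
    simp only [LinearMap.compMultilinearMap_apply, LinearMap.comp_apply,
      PiTensorProduct.lift.tprod, h1, contractFun, indexedId_tmul, map_prod,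
      SymmetricAlgebra.lift_ι_apply, LinearMap.sum_apply]
    rw [← sum_prod_slots]
    simp [evalSlots]
  rw [← LinearMap.sum_apply, ← this, LinearMap.comp_apply]

theorem indexed_BBsplit (P : DoublePoissonBracket k (NCPoly k d)) (S : Splitting G)
    (hS : S.IsPrincipal) (i j : Fin (l.1 + r.1) → Fin N)
    (a : Fin l.1 → NCPoly k d) (f : Fin l.2 → NCPoly k d) (u : Equiv.Perm (Fin l.1))
    (b : Fin r.1 → NCPoly k d) (g : Fin r.2 → NCPoly k d) (v : Equiv.Perm (Fin r.1)) :
    indexed N i j (BBsplit P S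
      (((PiTensorProduct.tprod k a ⊗ₜ[k] PiTensorProduct.tprod k f) ⊗ₜ[k]
          MonoidAlgebra.of k _ u) ⊗ₜ[k]
        ((PiTensorProduct.tprod k b ⊗ₜ[k] PiTensorProduct.tprod k g) ⊗ₜ[k]
          MonoidAlgebra.of k _ v))) =
      ∑ I : EdgeLabel n → Fin d, ∑ κ : DEdge n l r → Fin N,
        evalSlots (slotRow (fun t => i ((permLeft l.1 r.1 u * permRight l.1 r.1 v)⁻¹ t)) κ)
          (slotCol j κ G (nextEdge G S.word))
          (allMap P S I ((PiTensorProduct.tprod k a ⊗ₜ[k] PiTensorProduct.tprod k f) ⊗ₜ[k]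
            (PiTensorProduct.tprod k b ⊗ₜ[k] PiTensorProduct.tprod k g))) := by
  rw [BBsplit, LinearMap.sum_apply, map_sum]
  refine Finset.sum_congr rfl fun I _ => ?_
  rw [LinearMap.comp_apply, LinearMap.comp_apply, LinearEquiv.coe_coe,
    TensorProduct.tensorTensorTensorComm_tmul, TensorProduct.map_tmul, permProd_of,
    LinearMap.comp_apply, indexed_leftAct, ← S.slotNext_eq_nextEdge hS, ← indexedId_contract]
  rfl

end Indexed

/-! ### Comparison of the two operators. -/

section Kontsevich

variable {k : Type*} [Field k] {d N : ℕ} {n : ℕ} {l r : ℕ × ℕ}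

/-- The iterated partial derivative `derivAt` as a linear map. -/
def derivAtMap (Γ : AdmissibleGraph n) (J : EdgeLabel n → Fin d × Fin N × Fin N)
    (v : GVertex n) : RepRing k d N →ₗ[k] RepRing k d N where
  toFun := derivAt Γ J v
  map_add' F H := by
    unfold derivAt
    induction (List.finRange n ×ˢ List.finRange 2).filter fun e => Γ.target e = v with
    | nil => rfl
    | cons e es ih => rw [List.foldr_cons, ih, map_add]; rfl
  map_smul' c F := by
    unfold derivAt
    induction (List.finRange n ×ˢ List.finRange 2).filter fun e => Γ.target e = v with
    | nil => rfl
    | cons e es ih => rw [List.foldr_cons, ih, RingHom.id_apply, Derivation.map_smul]; rfl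

variable (P : DoublePoissonBracket k (NCPoly k d))

/-- Kontsevich's operator as a bilinear map. -/
def kontsevichMap (Γ : AdmissibleGraph n) :
    RepRing k d N →ₗ[k] RepRing k d N →ₗ[k] RepRing k d N :=
  ∑ J : EdgeLabel n → Fin d × Fin N × Fin N,
    (LinearMap.mul k (RepRing k d N)).compl₁₂
      (LinearMap.mulLeft k (∏ b : Fin n, derivAt Γ J (GVertex.num b)
        (repBracket P (MvPolynomial.X (J (b, 0))) (MvPolynomial.X (J (b, 1))))) ∘ₗ
          derivAtMap Γ J .L) (derivAtMap Γ J .R)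

theorem kontsevichMap_apply (Γ : AdmissibleGraph n) (F H : RepRing k d N) :
    kontsevichMap P Γ F H = kontsevichB P Γ F H := by
  simp only [kontsevichMap, LinearMap.sum_apply]
  rfl

/-- The edge labels and the indices at the edges of a double admissible graph are the coordinates
at the proper edges and the indices at the loops. -/
def edgeCoordEquiv (n : ℕ) (l r : ℕ × ℕ) (d N : ℕ) :
    (EdgeLabel n → Fin d) × (DEdge n l r → Fin N) ≃
      (EdgeLabel n → Fin d × Fin N × Fin N) × (Fin l.2 → Fin N) × (Fin r.2 → Fin N) where
  toFun x := (edgeCoord x.1 x.2, fun p => x.2 (.leftLoop p), fun q => x.2 (.rightLoop q))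
  invFun y := (fun e => (y.1 e).1, fun
    | .refl e => (y.1 e).2.1
    | .proper e => (y.1 e).2.2
    | .leftLoop p => y.2.1 p
    | .rightLoop q => y.2.2 q)
  left_inv x := by
    refine Prod.ext rfl (funext fun e => ?_)
    cases e <;> rfl
  right_inv y := rfl

/-- The elements attached to the left, left loop, right and right loop vertices. -/
def attach (a : Fin l.1 → NCPoly k d) (f : Fin l.2 → NCPoly k d) (b : Fin r.1 → NCPoly k d)
    (g : Fin r.2 → NCPoly k d) : DVertex n l r → NCPoly k d
  | .num _ => 0
  | .left t => a t
  | .leftLoop p => f p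
  | .right s => b s
  | .rightLoop q => g q

variable (I : EdgeLabel n → Fin d) (i j : Fin (l.1 + r.1) → Fin N) (κ : DEdge n l r → Fin N)

theorem outerEntry_L (z : DVertex n l r → NCPoly k d) (W : DVertex n l r → List (EdgeLabel n)) :
    outerEntry I i j κ z .L W =
      (∏ t, vertexEntry I i j κ (.left t) (W (.left t)) (z (.left t))) *
        ∏ p, vertexEntry I i j κ (.leftLoop p) (W (.leftLoop p)) (z (.leftLoop p)) := by
  rw [outerEntry, filter_merge_L, Finset.prod_union, Finset.prod_image, Finset.prod_image]
  · exact fun p _ p' _ h => DVertex.leftLoop.inj h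
  · exact fun p _ p' _ h => DVertex.left.inj h
  · simp [Finset.disjoint_left]

theorem outerEntry_R (z : DVertex n l r → NCPoly k d) (W : DVertex n l r → List (EdgeLabel n)) :
    outerEntry I i j κ z .R W =
      (∏ t, vertexEntry I i j κ (.right t) (W (.right t)) (z (.right t))) *
        ∏ p, vertexEntry I i j κ (.rightLoop p) (W (.rightLoop p)) (z (.rightLoop p)) := by
  rw [outerEntry, filter_merge_R, Finset.prod_union, Finset.prod_image, Finset.prod_image]
  · exact fun p _ p' _ h => DVertex.rightLoop.inj h
  · exact fun p _ p' _ h => DVertex.right.inj h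
  · simp [Finset.disjoint_left]

/-- Trace expansion, the Leibniz rule, the bijection of words with splittings and the contraction of
indices come together here, on generators. -/
theorem kontsevichB_tprod (Γ : AdmissibleGraph n) (i₁ j₁ : Fin l.1 → Fin N)
    (i₂ j₂ : Fin r.1 → Fin N)
    (a : Fin l.1 → NCPoly k d) (f : Fin l.2 → NCPoly k d) (u : Equiv.Perm (Fin l.1))
    (b : Fin r.1 → NCPoly k d) (g : Fin r.2 → NCPoly k d) (v : Equiv.Perm (Fin r.1)) :
    kontsevichB P Γ
      (indexed N i₁ j₁ (preToOComp l
        ((PiTensorProduct.tprod k a ⊗ₜ[k] PiTensorProduct.tprod k f) ⊗ₜ[k]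
          MonoidAlgebra.of k _ u)))
      (indexed N i₂ j₂ (preToOComp r
        ((PiTensorProduct.tprod k b ⊗ₜ[k] PiTensorProduct.tprod k g) ⊗ₜ[k]
          MonoidAlgebra.of k _ v))) =
      indexed N (Fin.append i₁ i₂) (Fin.append j₁ j₂) (BBcomp P Γ l r
        (((PiTensorProduct.tprod k a ⊗ₜ[k] PiTensorProduct.tprod k f) ⊗ₜ[k]
            MonoidAlgebra.of k _ u) ⊗ₜ[k]
          ((PiTensorProduct.tprod k b ⊗ₜ[k] PiTensorProduct.tprod k g) ⊗ₜ[k]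
            MonoidAlgebra.of k _ v))) := by
  classical
  -- The permutation `u × v` enters only through the row indices, so it is built into `i` from the
  -- start.
  let i : Fin (l.1 + r.1) → Fin N := fun t =>
    Fin.append i₁ i₂ ((permLeft l.1 r.1 u * permRight l.1 r.1 v)⁻¹ t)
  let j := Fin.append j₁ j₂
  let z : DVertex n l r → NCPoly k d := attach a f b g
  have hleft : ∀ (I : EdgeLabel n → Fin d) (κ : DEdge n l r → Fin N),
      outerEntry I i j κ z .L (fun _ => []) =
        (∏ t, entry k d N (i₁ (u⁻¹ t)) (j₁ t) (a t)) *
          ∏ p, entry k d N (κ (.leftLoop p)) (κ (.leftLoop p)) (f p) := by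
    intro I κ
    rw [outerEntry_L]
    refine congrArg₂ (· * ·) (Finset.prod_congr rfl fun t _ => ?_) rfl
    change entry k d N (i (Fin.castAdd r.1 t)) (j (Fin.castAdd r.1 t)) _ = _
    simp only [i, j, permLeft_mul_permRight_inv_castAdd, Fin.append_left]
    rfl
  have hright : ∀ (I : EdgeLabel n → Fin d) (κ : DEdge n l r → Fin N),
      outerEntry I i j κ z .R (fun _ => []) =
        (∏ t, entry k d N (i₂ (v⁻¹ t)) (j₂ t) (b t)) *
          ∏ p, entry k d N (κ (.rightLoop p)) (κ (.rightLoop p)) (g p) := by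
    intro I κ
    rw [outerEntry_R]
    refine congrArg₂ (· * ·) (Finset.prod_congr rfl fun t _ => ?_) rfl
    change entry k d N (i (Fin.natAdd l.1 t)) (j (Fin.natAdd l.1 t)) _ = _
    simp only [i, j, permLeft_mul_permRight_inv_natAdd, Fin.append_right]
    rfl
  calc
    _ = ∑ x : (EdgeLabel n → Fin d × Fin N × Fin N) × (Fin l.2 → Fin N) × (Fin r.2 → Fin N),
        (∏ b : Fin n, derivAt Γ x.1 (GVertex.num b)
          (repBracket P (MvPolynomial.X (x.1 (b, 0))) (MvPolynomial.X (x.1 (b, 1))))) *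
          derivAtMap Γ x.1 .L ((∏ t, entry k d N (i₁ (u⁻¹ t)) (j₁ t) (a t)) *
            ∏ p, entry k d N (x.2.1 p) (x.2.1 p) (f p)) *
          derivAtMap Γ x.1 .R ((∏ t, entry k d N (i₂ (v⁻¹ t)) (j₂ t) (b t)) *
            ∏ p, entry k d N (x.2.2 p) (x.2.2 p) (g p)) := by
      rw [Fintype.sum_prod_type]
      refine Finset.sum_congr rfl fun J _ => ?_
      change _ * derivAtMap Γ J .L _ * derivAtMap Γ J .R _ = _
      rw [indexed_preToOComp, indexed_preToOComp, map_sum, map_sum, mul_assoc,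
        Finset.sum_mul_sum, Finset.mul_sum, Fintype.sum_prod_type]
      refine Finset.sum_congr rfl fun c _ => ?_
      rw [Finset.mul_sum]
      exact Finset.sum_congr rfl fun c' _ => (mul_assoc _ _ _).symm
    _ = ∑ x : (EdgeLabel n → Fin d) × (DEdge n l r → Fin N),
        ((wordFamilies Γ.target (DVertex.merge (l := l) (r := r)) (edgeList n)).map fun W =>
          (∏ b, blockEntry P x.1 i j x.2 W b) * outerEntry x.1 i j x.2 z .L W *
            outerEntry x.1 i j x.2 z .R W).sum := by
      -- Change of variables from coordinates and trace indices to `I` and labels of all edges.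
      rw [← (edgeCoordEquiv n l r d N).sum_comp]
      refine Finset.sum_congr rfl fun x _ => ?_
      rw [← prod_derivAt_eq_sum, hleft, hright]
      rfl
    _ = ∑ x : (EdgeLabel n → Fin d) × (DEdge n l r → Fin N),
        ∑ G : DoubleGraph n l r with G.toAdmissible = Γ,
          ∑ S : Splitting G with S.IsPrincipal,
            evalSlots (slotRow i x.2) (slotCol j x.2 G (nextEdge G S.word))
              (allMap P S x.1 ((PiTensorProduct.tprod k a ⊗ₜ[k] PiTensorProduct.tprod k f) ⊗ₜ[k]
                (PiTensorProduct.tprod k b ⊗ₜ[k] PiTensorProduct.tprod k g))) := by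
      refine Finset.sum_congr rfl fun x _ => ?_
      -- The summand depends only on the words, so families may be replaced by double graphs with
      -- principal splittings.
      rw [sum_wordFamilies]
      refine Finset.sum_congr rfl fun G _ => Finset.sum_congr rfl fun S hS => ?_
      rw [evalSlots_allMap P S (Splitting.isOrdering_word (Finset.mem_filter.mp hS).2),
        outerEntry_L, outerEntry_R, mul_assoc]
      rfl
    _ = _ := by
      rw [BBcomp, LinearMap.sum_apply, map_sum, Finset.sum_comm]
      refine Finset.sum_congr rfl fun G _ => ?_
      rw [LinearMap.sum_apply, map_sum, Finset.sum_comm]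
      refine Finset.sum_congr rfl fun S hS => ?_
      rw [indexed_BBsplit P S (Finset.mem_filter.mp hS).2, Fintype.sum_prod_type]

/-- The identity between the two operators on representatives. -/
theorem kontsevichB_indexed (Γ : AdmissibleGraph n) (i₁ j₁ : Fin l.1 → Fin N)
    (i₂ j₂ : Fin r.1 → Fin N) (x : PreComp k (NCPoly k d) l) (y : PreComp k (NCPoly k d) r) :
    kontsevichB P Γ (indexed N i₁ j₁ (preToOComp l x)) (indexed N i₂ j₂ (preToOComp r y)) =
      indexed N (Fin.append i₁ i₂) (Fin.append j₁ j₂) (BBcomp P Γ l r (x ⊗ₜ[k] y)) := by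
  have h : (kontsevichMap P Γ).compl₁₂ (indexed N i₁ j₁ ∘ₗ preToOComp l)
      (indexed N i₂ j₂ ∘ₗ preToOComp r) =
      (TensorProduct.mk k _ _).compr₂
        (indexed N (Fin.append i₁ i₂) (Fin.append j₁ j₂) ∘ₗ BBcomp P Γ l r) := by
    refine PreComp.hom_ext fun a f u => PreComp.hom_ext fun b g v => ?_
    exact (kontsevichMap_apply P Γ _ _).trans (kontsevichB_tprod P Γ i₁ j₁ i₂ j₂ a f u b g v)
  rw [← kontsevichMap_apply]
  exact LinearMap.congr_fun₂ h x y

end Kontsevich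

/-! ## Functionals on symmetric algebras -/

section Symmetric

variable {k V : Type*} [Field k] [AddCommGroup V] [Module k V]

/-- If the values at `v` of elements of `D` did not fill `ι → k`, a nonzero functional would vanish
on them. Its coefficients give a combination of the `v i` killed by `D`; it is zero since `D`
separates points, against linear independence. -/
theorem exists_mem_forall_apply_eq (D : Submodule k (Module.Dual k V))
    (hD : ∀ x, (∀ φ ∈ D, φ x = 0) → x = 0) {ι : Type*} [Finite ι] {v : ι → V}
    (hv : LinearIndependent k v) (y : ι → k) : ∃ φ ∈ D, ∀ i, φ (v i) = y i := by
  classical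
  cases nonempty_fintype ι
  let R : Module.Dual k V →ₗ[k] (ι → k) := LinearMap.pi fun i => Module.Dual.eval k V (v i)
  have hR : D.map R = ⊤ := by
    by_contra h
    obtain ⟨f, hf, hle⟩ := Submodule.exists_le_ker_of_lt_top _ (lt_top_iff_ne_top.mpr h)
    refine hf (LinearMap.ext fun x => ?_)
    have h1 : ∑ i, f (fun j => if i = j then 1 else 0) • v i = 0 := hD _ fun φ hφ => by
      have h2 : f (R φ) = 0 := hle ⟨φ, hφ, rfl⟩
      rw [LinearMap.pi_apply_eq_sum_univ] at h2
      rw [map_sum]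
      refine Eq.trans ?_ h2
      refine Finset.sum_congr rfl fun i _ => ?_
      rw [map_smul, smul_eq_mul, smul_eq_mul, mul_comm]
      rfl
    rw [LinearMap.pi_apply_eq_sum_univ]
    exact Finset.sum_eq_zero fun i _ => by
      rw [Fintype.linearIndependent_iff.mp hv _ h1 i, smul_zero]
  obtain ⟨φ, hφ, h⟩ : y ∈ D.map R := hR ▸ Submodule.mem_top
  exact ⟨φ, hφ, fun i => congrFun h i⟩

/-- The value is a polynomial in `c`. It vanishes at all natural numbers, which are infinitely many
elements of `k` in characteristic zero. -/
theorem lift_add_smul_eq_zero [CharZero k] (g : SymmetricAlgebra k V) (φ χ : V →ₗ[k] k)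
    (h : ∀ n : ℕ, SymmetricAlgebra.lift (φ + (n : k) • χ) g = 0) (c : k) :
    SymmetricAlgebra.lift (φ + c • χ) g = 0 := by
  let q : Polynomial k := SymmetricAlgebra.lift
    (Algebra.linearMap k (Polynomial k) ∘ₗ φ +
      LinearMap.mulLeft k Polynomial.X ∘ₗ Algebra.linearMap k (Polynomial k) ∘ₗ χ) g
  have hq : ∀ c : k, Polynomial.aeval c q = SymmetricAlgebra.lift (φ + c • χ) g := by
    intro c
    rw [← AlgHom.comp_apply]
    congr 1
    refine SymmetricAlgebra.algHom_ext (LinearMap.ext fun x => ?_)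
    simp
    ring
  have h0 : q = 0 := by
    refine Polynomial.eq_zero_of_infinite_isRoot q
      ((Set.infinite_range_of_injective (Nat.cast_injective (R := k))).mono ?_)
    rintro _ ⟨n, rfl⟩
    have := hq n
    rw [h n] at this
    simpa [Polynomial.IsRoot] using this
  rw [← hq, h0, map_zero]

/-- The set `T` of base points is stable under translation by `Φ`. The polynomial argument extends
this from natural to arbitrary multiples, hence to the span. -/
theorem lift_add_eq_zero_of_mem_span [CharZero k] (Φ : AddSubmonoid (Module.Dual k V))
    (φ₀ : V →ₗ[k] k) (g : SymmetricAlgebra k V)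
    (h : ∀ φ ∈ Φ, SymmetricAlgebra.lift (φ₀ + φ) g = 0) {φ : Module.Dual k V}
    (hφ : φ ∈ Submodule.span k (Φ : Set (Module.Dual k V))) :
    SymmetricAlgebra.lift (φ₀ + φ) g = 0 := by
  let T : Set (Module.Dual k V) := {χ | ∀ ψ ∈ Φ, SymmetricAlgebra.lift (χ + ψ) g = 0}
  have key : ∀ χ ∈ T, χ + φ ∈ T := by
    induction hφ using Submodule.span_induction with
    | mem x hx =>
      intro χ hχ ψ hψ
      rw [add_assoc]
      exact hχ _ (Φ.add_mem hx hψ)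
    | zero =>
      intro χ hχ
      rwa [add_zero]
    | add x y _ _ hx hy =>
      intro χ hχ
      rw [← add_assoc]
      exact hy _ (hx _ hχ)
    | smul c x _ hx =>
      intro χ hχ ψ hψ
      -- Natural multiples are reached by repeated translation; `lift_add_smul_eq_zero` then passes
      -- to the scalar `c`.
      have hn : ∀ n : ℕ, χ + (n : k) • x ∈ T := by
        intro n
        induction n with
        | zero => simpa using hχ
        | succ n ih =>
          have := hx _ ih
          rwa [add_assoc, show (n : k) • x + x = ((n + 1 : ℕ) : k) • x by
            push_cast
            rw [add_smul, one_smul]] at this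
      rw [add_right_comm]
      refine lift_add_smul_eq_zero g (χ + ψ) x (fun n => ?_) c
      rw [add_right_comm]
      exact hn n ψ hψ
  have h1 := key φ₀ h 0 Φ.zero_mem
  rwa [add_zero] at h1

/-- A Zariski density argument: `g` is a polynomial in finitely many basis vectors, at which the
functionals `φ₀ + φ` with `φ` in the span of `Φ` take all possible values. -/
theorem eq_zero_of_lift_add_eq_zero [CharZero k] (Φ : AddSubmonoid (Module.Dual k V))
    (hΦ : ∀ x, (∀ φ ∈ Φ, φ x = 0) → x = 0) (φ₀ : V →ₗ[k] k) (g : SymmetricAlgebra k V)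
    (h : ∀ φ ∈ Φ, SymmetricAlgebra.lift (φ₀ + φ) g = 0) : g = 0 := by
  let b := Module.Basis.ofVectorSpace k V
  let e := SymmetricAlgebra.equivMvPolynomial b
  have he : ∀ φ : V →ₗ[k] k, SymmetricAlgebra.lift φ g =
      MvPolynomial.eval (fun i => φ (b i)) (e g) := by
    intro φ
    have : SymmetricAlgebra.lift φ =
        (MvPolynomial.aeval fun i => φ (b i)).comp e.toAlgHom := by
      refine SymmetricAlgebra.algHom_ext (b.ext fun i => ?_)
      simp [e]
    rw [this]
    rfl
  refine (map_eq_zero_iff e e.injective).mp (MvPolynomial.funext fun x => ?_)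
  -- The values are chosen so that `φ₀ + φ` agrees with the given point `x` on the variables that
  -- occur in `g`.
  obtain ⟨φ, hφ, hx⟩ := exists_mem_forall_apply_eq (Submodule.span k (Φ : Set (Module.Dual k V)))
    (fun x hx => hΦ x fun φ hφ => hx φ (Submodule.subset_span hφ))
    (v := fun i : (e g).vars => b i) (b.linearIndependent.comp _ Subtype.val_injective)
    (fun i => x i - φ₀ (b i))
  rw [map_zero, ← lift_add_eq_zero_of_mem_span Φ φ₀ g h hφ, he]
  refine MvPolynomial.eval₂Hom_congr' rfl (fun i hi _ => ?_) rfl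
  have := hx ⟨i, hi⟩
  simp only at this
  simp [this]

end Symmetric

/-! ## Finite-dimensional representations of the free algebra -/

section Representations

variable {k : Type*} [Field k] {d : ℕ}

/-- The monomial of a word. -/
def wordElt (k : Type*) [Field k] {d : ℕ} (w : List (Fin d)) : NCPoly k d :=
  (w.map (FreeAlgebra.ι k)).prod

/-- The words form a basis of the free algebra. -/
def wordBasis (k : Type*) [Field k] (d : ℕ) : Module.Basis (List (Fin d)) k (NCPoly k d) :=
  (FreeAlgebra.basisFreeMonoid k (Fin d)).reindex FreeMonoid.toList

theorem wordBasis_apply (w : List (Fin d)) : wordBasis k d w = wordElt k w := by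
  rw [wordBasis, Module.Basis.reindex_apply, FreeAlgebra.basisFreeMonoid, Module.Basis.map_apply]
  simp [wordElt, FreeAlgebra.equivMonoidAlgebraFreeMonoid, FreeMonoid.lift_apply]

variable {V W : Type*} [Fintype V] [DecidableEq V] [Fintype W] [DecidableEq W]

theorem lift_wordElt_cons (M : Fin d → Matrix V V k) (a : Fin d) (w : List (Fin d)) :
    FreeAlgebra.lift k M (wordElt k (a :: w)) = M a * FreeAlgebra.lift k M (wordElt k w) := by
  rw [wordElt, List.map_cons, List.prod_cons, map_mul, FreeAlgebra.lift_ι_apply]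
  rfl

theorem lift_wordElt_nil (M : Fin d → Matrix V V k) :
    FreeAlgebra.lift k M (wordElt k []) = 1 := by
  rw [wordElt, List.map_nil, List.prod_nil, map_one]

/-- The trace functional of a representation. -/
def traceOf (M : Fin d → Matrix V V k) : ANat k (NCPoly k d) →ₗ[k] k :=
  (commutators k (NCPoly k d)).liftQ
    (Matrix.traceLinearMap V k k ∘ₗ (FreeAlgebra.lift k M).toLinearMap) (by
      rw [commutators, Submodule.span_le]
      rintro _ ⟨a, b, rfl⟩
      simp [Matrix.trace_mul_comm (FreeAlgebra.lift k M a)])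

theorem traceOf_mkQ (M : Fin d → Matrix V V k) (f : NCPoly k d) :
    traceOf M ((commutators k (NCPoly k d)).mkQ f) = (FreeAlgebra.lift k M f).trace := by
  simp [traceOf]

/-- The direct sum of two representations. -/
def sumRep (M : Fin d → Matrix V V k) (M' : Fin d → Matrix W W k) (a : Fin d) :
    Matrix (V ⊕ W) (V ⊕ W) k :=
  Matrix.fromBlocks (M a) 0 0 (M' a)

theorem lift_sumRep (M : Fin d → Matrix V V k) (M' : Fin d → Matrix W W k) (f : NCPoly k d) :
    FreeAlgebra.lift k (sumRep M M') f =
      Matrix.fromBlocks (FreeAlgebra.lift k M f) 0 0 (FreeAlgebra.lift k M' f) := by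
  induction f using FreeAlgebra.induction with
  | grade0 c =>
    simp [Algebra.algebraMap_eq_smul_one, ← Matrix.fromBlocks_one, Matrix.fromBlocks_smul]
  | grade1 a => simp [sumRep]
  | mul f g hf hg => simp [hf, hg, Matrix.fromBlocks_multiply]
  | add f g hf hg => simp [hf, hg, Matrix.fromBlocks_add]

theorem traceOf_sumRep (M : Fin d → Matrix V V k) (M' : Fin d → Matrix W W k) :
    traceOf (sumRep M M') = traceOf M + traceOf M' := by
  refine Submodule.linearMap_qext _ (LinearMap.ext fun f => ?_)
  change traceOf _ ((commutators k (NCPoly k d)).mkQ f) =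
    traceOf _ ((commutators k (NCPoly k d)).mkQ f) + traceOf _ ((commutators k (NCPoly k d)).mkQ f)
  rw [traceOf_mkQ, traceOf_mkQ, traceOf_mkQ, lift_sumRep, Matrix.trace, Fintype.sum_sum_type]
  rfl

/-- The trace functionals of the finite-dimensional representations. -/
def traceFunctionals (k : Type*) [Field k] (d : ℕ) :
    AddSubmonoid (Module.Dual k (ANat k (NCPoly k d))) where
  carrier := {φ | ∃ (V : Type) (_ : Fintype V) (_ : DecidableEq V) (M : Fin d → Matrix V V k),
    φ = traceOf M}
  zero_mem' := by
    refine ⟨Empty, inferInstance, inferInstance, fun _ => (0 : Matrix Empty Empty k), ?_⟩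
    refine Submodule.linearMap_qext _ (LinearMap.ext fun f => ?_)
    change 0 = traceOf (fun _ => (0 : Matrix Empty Empty k)) ((commutators k (NCPoly k d)).mkQ f)
    rw [traceOf_mkQ]
    simp [Matrix.trace]
  add_mem' := by
    rintro _ _ ⟨V, _, _, M, rfl⟩ ⟨W, _, _, M', rfl⟩
    exact ⟨V ⊕ W, inferInstance, inferInstance, sumRep M M', (traceOf_sumRep M M').symm⟩

/-! ### Cyclic words -/

/-- The class of a cyclic word in `A_♮`. -/
theorem cycProd_coe (w : List (Fin d)) :
    cycProd (FreeAlgebra.ι k) (w : Cycle (Fin d)) = (commutators k (NCPoly k d)).mkQ (wordElt k w) :=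
  rfl

theorem exists_cycle_combination (x : ANat k (NCPoly k d)) :
    ∃ c : Cycle (Fin d) →₀ k, x = c.sum fun C t => t • cycProd (FreeAlgebra.ι k) C := by
  let Λ := Finsupp.linearCombination k (cycProd (k := k) (FreeAlgebra.ι (X := Fin d) k))
  suffices h : LinearMap.range Λ = ⊤ by
    obtain ⟨c, hc⟩ : x ∈ LinearMap.range Λ := h ▸ Submodule.mem_top
    exact ⟨c, hc.symm⟩
  rw [← Submodule.ker_mkQ (LinearMap.range Λ), LinearMap.ker_eq_top]
  refine Submodule.linearMap_qext _ ((wordBasis k d).ext fun w => ?_)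
  rw [LinearMap.comp_apply, wordBasis_apply, ← cycProd_coe, LinearMap.comp_apply,
    LinearMap.zero_apply, Submodule.mkQ_apply, Submodule.Quotient.mk_eq_zero]
  exact ⟨Finsupp.single w 1, by simp [Λ]⟩

section Necklace

variable {ℓ : ℕ} (a : ZMod ℓ → Fin d)

/-- The word of length `n` along the periodic sequence `a`, from a position. -/
def walkWord : ℕ → ZMod ℓ → List (Fin d)
  | 0, _ => []
  | n + 1, p => a p :: walkWord n (p + 1)

theorem length_walkWord (n : ℕ) (p : ZMod ℓ) : (walkWord a n p).length = n := by
  induction n generalizing p with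
  | zero => rfl
  | succ n ih => rw [walkWord, List.length_cons, ih]

theorem getElem_walkWord (n : ℕ) (p : ZMod ℓ) (i : ℕ) (hi : i < (walkWord a n p).length) :
    (walkWord a n p)[i] = a (p + i) := by
  induction n generalizing p i with
  | zero => simp [walkWord] at hi
  | succ n ih =>
    cases i with
    | zero => simp [walkWord]
    | succ i =>
      simp only [walkWord, List.getElem_cons_succ, ih]
      congr 1
      push_cast
      ring

variable [NeZero ℓ]

/-- The representation of a cyclic quiver along the periodic sequence `a`. -/
def cyclicRep (k : Type*) [Field k] (b : Fin d) : Matrix (ZMod ℓ) (ZMod ℓ) k :=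
  Matrix.of fun p q => if q = p + 1 ∧ b = a p then 1 else 0

/-- Each vertex of the quiver has one outgoing arrow, so a word acts along at most one walk from
`p`, namely the one that spells it. -/
theorem lift_cyclicRep (w : List (Fin d)) (p q : ZMod ℓ) :
    FreeAlgebra.lift k (cyclicRep a k) (wordElt k w) p q =
      if q = p + w.length ∧ w = walkWord a w.length p then 1 else 0 := by
  induction w generalizing p with
  | nil => simp [lift_wordElt_nil, Matrix.one_apply, walkWord, eq_comm]
  | cons b w ih =>
    rw [lift_wordElt_cons, Matrix.mul_apply, Finset.sum_eq_single (p + 1)]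
    · have h : p + 1 + (w.length : ZMod ℓ) = p + ((b :: w).length : ℕ) := by
        rw [List.length_cons]
        push_cast
        ring
      rw [ih, cyclicRep, Matrix.of_apply, h, List.length_cons]
      by_cases hb : b = a p <;> simp [hb, walkWord]
    · intro v _ hv
      simp [cyclicRep, hv]
    · simp

theorem traceOf_cyclicRep (w : List (Fin d)) :
    traceOf (cyclicRep a k) (cycProd (FreeAlgebra.ι k) (w : Cycle (Fin d))) =
      ((Finset.univ.filter fun p : ZMod ℓ => p = p + w.length ∧ w = walkWord a w.length p).card :
        k) := by
  rw [cycProd_coe, traceOf_mkQ, Matrix.trace, ← Finset.sum_boole]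
  exact Finset.sum_congr rfl fun p _ => lift_cyclicRep a w p p

/-- The periodic sequence of a word. -/
def periodicSeq (w : List (Fin d)) [NeZero w.length] (p : ZMod w.length) : Fin d :=
  w[p.val]'(ZMod.val_lt p)

theorem walkWord_periodicSeq (w : List (Fin d)) [NeZero w.length] (p : ZMod w.length) :
    walkWord (periodicSeq w) w.length p = w.rotate p.val := by
  refine List.ext_getElem (by simp [length_walkWord]) fun i h1 h2 => ?_
  rw [getElem_walkWord, List.getElem_rotate, periodicSeq]
  congr 1
  rw [ZMod.val_add, ZMod.val_natCast, Nat.add_mod_mod, add_comm]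

/-- A closed walk around the quiver has length divisible by `w₀.length`. For a nonempty word of at
most this length the walk goes round once, and the word is a rotation of `w₀`. -/
theorem isRotated_of_traceOf_ne_zero {w₀ w : List (Fin d)} [NeZero w₀.length] (hw : w ≠ [])
    (hle : w.length ≤ w₀.length)
    (h : traceOf (cyclicRep (periodicSeq w₀) k)
      (cycProd (FreeAlgebra.ι k) (w : Cycle (Fin d))) ≠ 0) :
    (w : Cycle (Fin d)) = w₀ := by
  rw [traceOf_cyclicRep] at h
  obtain ⟨p, hp⟩ := Finset.card_ne_zero.mp fun h0 => h (by rw [h0, Nat.cast_zero])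
  obtain ⟨h1, h2⟩ := (Finset.mem_filter.mp hp).2
  rw [left_eq_add, ZMod.natCast_eq_zero_iff] at h1
  have h3 : w.length = w₀.length :=
    le_antisymm hle (Nat.le_of_dvd (List.length_pos_iff.mpr hw) h1)
  rw [h3, walkWord_periodicSeq] at h2
  rw [h2]
  exact Cycle.coe_eq_coe.mpr (List.IsRotated.symm ⟨_, rfl⟩)

/-- The trace counts starting points from which the walk spells `w`; position `0` is one, and a
positive count stays nonzero in characteristic zero. -/
theorem traceOf_cyclicRep_self_ne_zero [CharZero k] (w : List (Fin d)) [NeZero w.length] :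
    traceOf (cyclicRep (periodicSeq w) k)
      (cycProd (FreeAlgebra.ι k) (w : Cycle (Fin d))) ≠ 0 := by
  rw [traceOf_cyclicRep, Nat.cast_ne_zero, Finset.card_ne_zero]
  refine ⟨0, Finset.mem_filter.mpr ⟨Finset.mem_univ _, ?_, ?_⟩⟩
  · simp
  · rw [walkWord_periodicSeq, ZMod.val_zero, List.rotate_zero]

end Necklace

/-- The one-dimensional zero representation detects the class of `1`, which the cyclic quivers,
needing words of positive length, do not treat. -/
theorem traceOf_zero_cycProd (C : Cycle (Fin d)) :
    traceOf (fun _ => (0 : Matrix Unit Unit k)) (cycProd (FreeAlgebra.ι k) C) =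
      if C = Cycle.nil then 1 else 0 := by
  induction C using Quotient.inductionOn' with
  | h w =>
    refine (traceOf_mkQ _ (wordElt k w)).trans ?_
    rcases w with _ | ⟨b, w⟩
    · rw [lift_wordElt_nil, if_pos]
      · simp
      · rfl
    · rw [lift_wordElt_cons, if_neg]
      · simp
      · exact fun h => List.cons_ne_nil b w ((Cycle.coe_eq_nil (l := b :: w)).1 h)

/-- The traces of finite-dimensional representations separate the elements of `A_♮`. -/
theorem eq_zero_of_forall_traceFunctionals [CharZero k] (x : ANat k (NCPoly k d))
    (h : ∀ φ ∈ traceFunctionals k d, φ x = 0) : x = 0 := by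
  obtain ⟨c, rfl⟩ := exists_cycle_combination x
  have hM : ∀ (V : Type) [Fintype V] [DecidableEq V] (M : Fin d → Matrix V V k),
      ∑ C ∈ c.support, c C * traceOf M (cycProd (FreeAlgebra.ι k) C) = 0 := by
    intro V _ _ M
    rw [← h _ ⟨V, _, _, M, rfl⟩, Finsupp.sum, map_sum]
    exact Finset.sum_congr rfl fun C _ => by rw [map_smul, smul_eq_mul]
  have hnil : c Cycle.nil = 0 := by
    have h1 := hM Unit fun _ => 0
    simp only [traceOf_zero_cycProd, mul_ite, mul_one, mul_zero] at h1
    rw [Finset.sum_ite_eq'] at h1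
    by_contra h0
    rw [if_pos (Finsupp.mem_support_iff.mpr h0)] at h1
    exact h0 h1
  rcases c.support.eq_empty_or_nonempty with hc | hc
  · rw [Finsupp.support_eq_empty.mp hc, Finsupp.sum_zero_index]
  exfalso
  -- For a longest cyclic word in the support, the trace of its cyclic quiver kills all the other
  -- words of the support, since none is longer and the empty one is already excluded.
  obtain ⟨C, hC, hmax⟩ := Finset.exists_max_image c.support Cycle.length hc
  have hcC := Finsupp.mem_support_iff.mp hC
  obtain ⟨w, rfl⟩ : ∃ w : List (Fin d), C = w := ⟨cycleList C, (coe_cycleList C).symm⟩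
  have hw : NeZero w.length := ⟨fun h0 => hcC (by
    rw [List.eq_nil_of_length_eq_zero h0, Cycle.coe_nil, hnil])⟩
  have h1 := hM (ZMod w.length) (cyclicRep (periodicSeq w) k)
  rw [Finset.sum_eq_single (w : Cycle (Fin d))] at h1
  · exact mul_ne_zero hcC (traceOf_cyclicRep_self_ne_zero w) h1
  · intro C' hC' hne
    obtain ⟨w', rfl⟩ : ∃ w' : List (Fin d), C' = w' := ⟨cycleList C', (coe_cycleList C').symm⟩
    by_contra h2
    refine hne (isRotated_of_traceOf_ne_zero ?_ (hmax _ hC') (right_ne_zero_of_mul h2))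
    rintro rfl
    exact Finsupp.mem_support_iff.mp hC' hnil
  · exact fun h2 => absurd hC h2

end Representations

/-! ## The functions `α_{𝐢𝐣}` determine `α` -/

section Paths

variable {k : Type*} [Field k] {d : ℕ}

/-- The words of bounded length. -/
abbrev BoundedWord (d M : ℕ) : Type := {w : List (Fin d) // w.length ≤ M}

instance (d M : ℕ) : Fintype (BoundedWord d M) :=
  @Fintype.ofFinite _ (List.finite_length_le (Fin d) M).to_subtype

/-- The representation in which `x_a` deletes the first letter `a` of a word. -/
def pathRep (k : Type*) [Field k] (Q : Type) [DecidableEq Q] (d M : ℕ) (a : Fin d) :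
    Matrix (Q × BoundedWord d M) (Q × BoundedWord d M) k :=
  Matrix.of fun x y => if x.1 = y.1 ∧ x.2.1 = a :: y.2.1 then 1 else 0

/-- A word acts by deleting itself as a prefix and preserves the copy in `Q`. From the state `w₀` to
the empty state only the word `w₀` itself has a nonzero entry. -/
theorem lift_pathRep (Q : Type) [Fintype Q] [DecidableEq Q] (M : ℕ) (w : List (Fin d))
    (x y : Q × BoundedWord d M) :
    FreeAlgebra.lift k (pathRep k Q d M) (wordElt k w) x y =
      if x.1 = y.1 ∧ x.2.1 = w ++ y.2.1 then 1 else 0 := by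
  induction w generalizing x with
  | nil => simp [lift_wordElt_nil, Matrix.one_apply, Prod.ext_iff, Subtype.ext_iff]
  | cons a w ih =>
    rw [lift_wordElt_cons, Matrix.mul_apply]
    simp only [ih, pathRep, Matrix.of_apply, ← ite_and, mul_ite, mul_one, mul_zero]
    split_ifs with h
    · have hlen : (w ++ y.2.1).length ≤ M := by
        have h1 := x.2.2
        rw [h.2] at h1
        simp only [List.cons_append, List.length_cons] at h1
        omega
      rw [Finset.sum_eq_single (y.1, ⟨w ++ y.2.1, hlen⟩)]
      · simp [h]
      · intro v _ hv
        rw [if_neg]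
        rintro ⟨⟨h1, h2⟩, h3, h4⟩
        exact hv (Prod.ext h1 (Subtype.ext h2))
      · simp
    · refine Finset.sum_eq_zero fun v _ => if_neg ?_
      rintro ⟨⟨h1, h2⟩, h3, h4⟩
      exact h ⟨h3.trans h1, by rw [h4, h2, List.cons_append]⟩

/-- A matrix representation is a point of a representation space, and `φ` is evaluation of functions
at this point. Nonemptiness of `V` makes `N` positive. -/
theorem exists_evaluation {V : Type*} [Fintype V] [DecidableEq V] [Nonempty V]
    (M : Fin d → Matrix V V k) :
    ∃ N, 0 < N ∧ ∃ (e : V ≃ Fin N) (φ : RepRing k d N →ₐ[k] k),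
      (∀ p q f, φ (entry k d N (e p) (e q) f) = FreeAlgebra.lift k M f p q) ∧
      φ.toLinearMap ∘ₗ trace k d N = traceOf M := by
  let e := Fintype.equivFin V
  let φ : RepRing k d (Fintype.card V) →ₐ[k] k :=
    MvPolynomial.aeval fun s => M s.1 (e.symm s.2.1) (e.symm s.2.2)
  have hφ : ∀ p q f, φ (entry k d _ (e p) (e q) f) = FreeAlgebra.lift k M f p q := by
    intro p q f
    induction f using FreeAlgebra.induction generalizing p q with
    | grade0 c =>
      rw [Algebra.algebraMap_eq_smul_one, map_smul, map_smul, entry_one, map_smul, map_one]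
      by_cases h : p = q <;> simp [h]
    | grade1 a => simp [generic_ι, φ]
    | mul f g hf hg =>
      rw [entry_mul, map_sum, map_mul, Matrix.mul_apply, ← e.sum_comp]
      exact Finset.sum_congr rfl fun c _ => by rw [map_mul, hf, hg]
    | add f g hf hg => rw [map_add, map_add, hf, hg, map_add, Matrix.add_apply]
  refine ⟨_, Fintype.card_pos, e, φ, hφ, ?_⟩
  refine Submodule.linearMap_qext _ (LinearMap.ext fun f => ?_)
  change φ (trace k d _ ((commutators k (NCPoly k d)).mkQ f)) =
    traceOf M ((commutators k (NCPoly k d)).mkQ f)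
  rw [trace_mkQ, traceOf_mkQ, map_sum, Matrix.trace, ← e.sum_comp]
  exact Finset.sum_congr rfl fun p _ => hφ p p f

theorem OComp.eq_top_of_forall_tmul_mem {A : Type*} [Ring A] [Algebra k A] {m : ℕ}
    (R : Submodule k (OComp k A m))
    (h : ∀ a s u, (a ⊗ₜ[k] s) ⊗ₜ[k] MonoidAlgebra.of k _ u ∈ R) : R = ⊤ := by
  rw [Submodule.eq_top_iff']
  intro x
  induction x using TensorProduct.induction_on with
  | zero => exact Submodule.zero_mem _
  | add x y hx hy => exact Submodule.add_mem _ hx hy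
  | tmul x y =>
    induction y using MonoidAlgebra.induction_linear with
    | zero => rw [TensorProduct.tmul_zero]; exact Submodule.zero_mem _
    | add y y' hy hy' => rw [TensorProduct.tmul_add]; exact Submodule.add_mem _ hy hy'
    | single u c =>
      rw [show MonoidAlgebra.single u c = c • MonoidAlgebra.of k _ u by simp,
        TensorProduct.tmul_smul]
      refine Submodule.smul_mem _ _ ?_
      induction x using TensorProduct.induction_on with
      | zero => rw [TensorProduct.zero_tmul]; exact Submodule.zero_mem _
      | add x y hx hy => rw [TensorProduct.add_tmul]; exact Submodule.add_mem _ hx hy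
      | tmul a s => exact h a s u

theorem exists_word_combination {m : ℕ} (γ : OComp k (NCPoly k d) m) :
    ∃ g : ((Fin m → List (Fin d)) × Equiv.Perm (Fin m)) →₀
        SymmetricAlgebra k (ANat k (NCPoly k d)),
      γ = g.sum fun x s => (PiTensorProduct.tprod k (fun t => wordElt k (x.1 t)) ⊗ₜ[k] s) ⊗ₜ[k]
        MonoidAlgebra.of k _ x.2 := by
  let Λ : (((Fin m → List (Fin d)) × Equiv.Perm (Fin m)) →₀
      SymmetricAlgebra k (ANat k (NCPoly k d))) →ₗ[k] OComp k (NCPoly k d) m :=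
    Finsupp.lsum k fun x => (TensorProduct.mk k _ _).flip (MonoidAlgebra.of k _ x.2) ∘ₗ
      TensorProduct.mk k _ _ (PiTensorProduct.tprod k (fun t => wordElt k (x.1 t)))
  suffices h : LinearMap.range Λ = ⊤ by
    obtain ⟨g, hg⟩ : γ ∈ LinearMap.range Λ := h ▸ Submodule.mem_top
    exact ⟨g, hg.symm⟩
  have h1 : ∀ a s u, (a ⊗ₜ[k] s) ⊗ₜ[k] MonoidAlgebra.of k _ u ∈ LinearMap.range Λ := by
    intro a s u
    let b := Basis.piTensorProduct fun _ : Fin m => wordBasis k d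
    have h2 : ⊤ ≤ (LinearMap.range Λ).comap ((TensorProduct.mk k _ _).flip
        (MonoidAlgebra.of k _ u) ∘ₗ (TensorProduct.mk k (TPow k (NCPoly k d) m) _).flip s) := by
      rw [← b.span_eq, Submodule.span_le]
      rintro _ ⟨w, rfl⟩
      refine ⟨Finsupp.single (w, u) s, ?_⟩
      simp [Λ, b, wordBasis_apply]
    exact h2 Submodule.mem_top
  exact OComp.eq_top_of_forall_tmul_mem _ h1

/-- An element of `O(A)` is determined by its functions on the representation spaces. -/
theorem eq_zero_of_indexed_eq_zero [CharZero k] {m : ℕ} (γ : OComp k (NCPoly k d) m)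
    (h : ∀ N, 0 < N → ∀ i j : Fin m → Fin N, indexed N i j γ = 0) : γ = 0 := by
  obtain ⟨g, rfl⟩ := exists_word_combination γ
  suffices hg : g = 0 by rw [hg, Finsupp.sum_zero_index]
  refine Finsupp.ext fun x₀ => ?_
  obtain ⟨w₀, u₀⟩ := x₀
  have hlen : ∀ t, (w₀ t).length ≤ ∑ t, (w₀ t).length := fun t =>
    Finset.single_le_sum (f := fun t => (w₀ t).length) (fun _ _ => Nat.zero_le _)
      (Finset.mem_univ t)
  -- The trace of the path representation is the base point `φ₀`, and arbitrary summands `M'` supply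
  -- the translations. All words of `w₀` fit within the sum of their lengths.
  refine eq_zero_of_lift_add_eq_zero (traceFunctionals k d) eq_zero_of_forall_traceFunctionals
    (traceOf (pathRep k (Option (Fin m)) d (∑ t, (w₀ t).length))) _ ?_
  rintro _ ⟨W, _, _, M', rfl⟩
  rw [← traceOf_sumRep]
  set M := sumRep (pathRep k (Option (Fin m)) d (∑ t, (w₀ t).length)) M' with hM
  -- The copy `none` ensures that the space is nonzero also for `m = 0`.
  have : Nonempty ((Option (Fin m) × BoundedWord d (∑ t, (w₀ t).length)) ⊕ W) :=
    ⟨.inl (none, ⟨[], Nat.zero_le _⟩)⟩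
  obtain ⟨N, hN, e, φ, hφ, hφtr⟩ := exists_evaluation M
  -- In the factor `t` the row index is taken at `u⁻¹ t` and lies in the copy `u₀ (u⁻¹ t)`, while
  -- the column lies in the copy `t`. A nonzero product forces `u = u₀`, and then deletion down to
  -- the empty word forces the words to be `w₀`.
  let i : Fin m → (Option (Fin m) × BoundedWord d (∑ t, (w₀ t).length)) ⊕ W := fun s =>
    .inl (some (u₀ s), ⟨w₀ (u₀ s), hlen _⟩)
  let j : Fin m → (Option (Fin m) × BoundedWord d (∑ t, (w₀ t).length)) ⊕ W := fun t =>
    .inl (some t, ⟨[], Nat.zero_le _⟩)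
  have hlift : ∀ s, φ (SymmetricAlgebra.lift (trace k d N) s) =
      SymmetricAlgebra.lift (traceOf M) s := by
    intro s
    rw [← AlgHom.comp_apply, ← hφtr]
    congr 1
    exact SymmetricAlgebra.algHom_ext (LinearMap.ext fun x => by simp)
  have hterm : ∀ (x : (Fin m → List (Fin d)) × Equiv.Perm (Fin m)) s,
      φ (indexed N (fun t => e (i t)) (fun t => e (j t))
        ((PiTensorProduct.tprod k (fun t => wordElt k (x.1 t)) ⊗ₜ[k] s) ⊗ₜ[k]
          MonoidAlgebra.of k _ x.2)) =
      if x = (w₀, u₀) then SymmetricAlgebra.lift (traceOf M) s else 0 := by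
    intro x s
    rw [indexed_tmul_of, indexedId_tmul, map_mul, map_prod, hlift]
    simp only [hφ, hM, lift_sumRep, i, j, Matrix.fromBlocks_apply₁₁, lift_pathRep,
      List.append_nil, Option.some.injEq]
    rw [Fintype.prod_ite_zero]
    have hiff : (∀ t, u₀ (x.2⁻¹ t) = t ∧ w₀ (u₀ (x.2⁻¹ t)) = x.1 t) ↔ x = (w₀, u₀) := by
      constructor
      · intro h
        refine Prod.ext (funext fun t => ?_) (Equiv.ext fun t => ?_)
        · rw [← (h t).2, (h t).1]
        · have := (h (x.2 t)).1
          rw [show x.2⁻¹ (x.2 t) = t from x.2.symm_apply_apply t] at this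
          exact this.symm
      · rintro rfl t
        simp
    simp only [hiff, Finset.prod_const_one, ite_mul, one_mul, zero_mul]
  have h0 := congrArg φ (h N hN (fun t => e (i t)) fun t => e (j t))
  rw [map_zero, Finsupp.sum, map_sum, map_sum] at h0
  simp only [hterm] at h0
  rw [Finset.sum_ite_eq'] at h0
  by_cases hx : (w₀, u₀) ∈ g.support
  · rwa [if_pos hx] at h0
  · rw [Finsupp.notMem_support_iff.mp hx, map_zero]

end Paths

/-! ## The operator on `O(A)` -/

section Generators

variable {k A : Type*} [Field k] [Ring A] [Algebra k A]

-- The products of classes are closed under multiplication by concatenation and include `1` and all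
-- the generators.
open scoped Pointwise in
theorem span_symProd_eq_top :
    Submodule.span k (Set.range fun x : Σ m : ℕ, Fin m → A =>
      symProd x.1 (PiTensorProduct.tprod k x.2)) = ⊤ := by
  set X := Set.range fun x : Σ m : ℕ, Fin m → A =>
    symProd (k := k) x.1 (PiTensorProduct.tprod k x.2)
  have hXX : X * X ⊆ X := by
    rintro _ ⟨_, ⟨⟨m, f⟩, rfl⟩, _, ⟨⟨m', f'⟩, rfl⟩, rfl⟩
    refine ⟨⟨m + m', Fin.append f f'⟩, ?_⟩
    simp [symProd_tprod, Fin.prod_univ_add]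
  have h1 : (1 : SymmetricAlgebra k (ANat k A)) ∈ Submodule.span k X :=
    Submodule.subset_span ⟨⟨0, Fin.elim0⟩, by simp [symProd_tprod]⟩
  rw [Submodule.eq_top_iff']
  intro s
  induction s using SymmetricAlgebra.induction with
  | algebraMap c =>
    rw [Algebra.algebraMap_eq_smul_one]
    exact Submodule.smul_mem _ _ h1
  | ι x =>
    obtain ⟨f, rfl⟩ := (commutators k A).mkQ_surjective x
    exact Submodule.subset_span ⟨⟨1, fun _ => f⟩, by simp [symProd_tprod]⟩
  | mul s s' hs hs' =>
    have := Submodule.mul_mem_mul hs hs'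
    rw [Submodule.span_mul_span] at this
    exact Submodule.span_mono hXX this
  | add s s' hs hs' => exact Submodule.add_mem _ hs hs'

/-- Representatives with any number of trace factors span `O(A)^{(p)}`; linear identities on it may
be tested on them. -/
theorem OComp.eq_top_of_forall_preToOComp_mem {p : ℕ} (R : Submodule k (OComp k A p))
    (h : ∀ s (x : PreComp k A (p, s)), preToOComp (p, s) x ∈ R) : R = ⊤ := by
  refine OComp.eq_top_of_forall_tmul_mem R fun a s u => ?_
  have h1 : (⊤ : Submodule k (SymmetricAlgebra k (ANat k A))) ≤
      R.comap ((TensorProduct.mk k _ _).flip (MonoidAlgebra.of k _ u) ∘ₗ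
        TensorProduct.mk k (TPow k A p) _ a) := by
    rw [← span_symProd_eq_top, Submodule.span_le]
    rintro _ ⟨⟨m, f⟩, rfl⟩
    exact h m ((a ⊗ₜ[k] PiTensorProduct.tprod k f) ⊗ₜ[k] MonoidAlgebra.of k _ u)
  exact h1 (Submodule.mem_top : s ∈ _)

theorem OComp.hom_ext_preToOComp {M : Type*} [AddCommMonoid M] [Module k M] {p : ℕ}
    {φ ψ : OComp k A p →ₗ[k] M}
    (h : ∀ s (x : PreComp k A (p, s)), φ (preToOComp (p, s) x) = ψ (preToOComp (p, s) x)) :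
    φ = ψ :=
  LinearMap.eqLocus_eq_top.mp (OComp.eq_top_of_forall_preToOComp_mem _ h)

theorem preToO_surjective : Function.Surjective (preToO (k := k) (A := A)) := by
  intro x
  change x ∈ LinearMap.range (preToO (k := k) (A := A))
  induction x using DirectSum.induction_on with
  | zero => exact Submodule.zero_mem _
  | of p α =>
    have h := OComp.eq_top_of_forall_preToOComp_mem
      ((LinearMap.range (preToO (k := k) (A := A))).comap
        (DirectSum.lof k ℕ (OComp k A) p)) fun s x =>
          ⟨DirectSum.lof k (ℕ × ℕ) (PreComp k A) (p, s) x, preToO_lof _ _⟩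
    exact (h ▸ Submodule.mem_top : α ∈ _)
  | add x y hx hy => exact Submodule.add_mem _ hx hy

/-- Bilinear maps factor through surjective linear maps. -/
theorem exists_comp_map_eq {M M' Z : Type*} [AddCommMonoid M] [Module k M] [AddCommMonoid M']
    [Module k M'] [AddCommMonoid Z] [Module k Z] (f : M →ₗ[k] M') (hf : Function.Surjective f)
    (β : M ⊗[k] M →ₗ[k] Z) (h₁ : ∀ x x' y, f x = f x' → β (x ⊗ₜ[k] y) = β (x' ⊗ₜ[k] y))
    (h₂ : ∀ x y y', f y = f y' → β (x ⊗ₜ[k] y) = β (x ⊗ₜ[k] y')) :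
    ∃ B : M' ⊗[k] M' →ₗ[k] Z, B ∘ₗ TensorProduct.map f f = β := by
  -- The section `s` need not be linear; bilinearity of `B` comes from the independence of `β` from
  -- representatives.
  let s := Function.surjInv hf
  have hs : ∀ x, f (s x) = x := Function.surjInv_eq hf
  have h₁' : ∀ x x' y, f x = f x' → β (x ⊗ₜ[k] s y) = β (x' ⊗ₜ[k] s y) := fun _ _ _ => h₁ _ _ _
  let B : M' →ₗ[k] M' →ₗ[k] Z := LinearMap.mk₂ k (fun x y => β (s x ⊗ₜ[k] s y))
    (fun x x' y => by
      rw [← map_add, ← TensorProduct.add_tmul]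
      exact h₁ _ _ _ (by simp only [map_add, hs]))
    (fun c x y => by
      rw [← map_smul, TensorProduct.smul_tmul']
      exact h₁ _ _ _ (by simp only [map_smul, hs]))
    (fun x y y' => by
      rw [← map_add, ← TensorProduct.tmul_add]
      exact h₂ _ _ _ (by simp only [map_add, hs]))
    (fun c x y => by
      rw [← map_smul, ← TensorProduct.tmul_smul]
      exact h₂ _ _ _ (by simp only [map_smul, hs]))
  refine ⟨TensorProduct.lift B, TensorProduct.ext' fun x y => ?_⟩
  change β (s (f x) ⊗ₜ[k] s (f y)) = _
  rw [h₁ _ _ _ (hs (f x)), h₂ _ _ _ (hs (f y))]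

end Generators

/-! ### Descent of the operator to `O(A)`. -/

section Final

variable {k : Type*} [Field k] {d : ℕ} {n : ℕ}
variable (P : DoublePoissonBracket k (NCPoly k d)) (Γ : AdmissibleGraph n)

theorem BB_lof_tmul_lof (l r : ℕ × ℕ) (x : PreComp k (NCPoly k d) l)
    (y : PreComp k (NCPoly k d) r) :
    BB P Γ (DirectSum.lof k (ℕ × ℕ) (PreComp k (NCPoly k d)) l x ⊗ₜ[k]
        DirectSum.lof k (ℕ × ℕ) (PreComp k (NCPoly k d)) r y) =
      DirectSum.lof k ℕ (OComp k (NCPoly k d)) (l.1 + r.1) (BBcomp P Γ l r (x ⊗ₜ[k] y)) := by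
  rw [BB, TensorProduct.lift.tmul, DirectSum.toModule_lof, LinearMap.flip_apply,
    DirectSum.toModule_lof, LinearMap.flip_apply, TensorProduct.curry_apply, LinearMap.comp_apply]

theorem eq_of_indexed_eq [CharZero k] {m : ℕ} {γ γ' : OComp k (NCPoly k d) m}
    (h : ∀ N, 0 < N → ∀ i j : Fin m → Fin N, indexed N i j γ = indexed N i j γ') : γ = γ' := by
  have h0 : γ + (-1 : k) • γ' = 0 := eq_zero_of_indexed_eq_zero _ fun N hN i j => by
    rw [map_add, map_smul, h N hN, neg_one_smul, add_neg_cancel]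
  have h1 : (-1 : k) • γ' + γ' = 0 := by
    conv_lhs => rw [← one_smul k γ', smul_smul, ← add_smul]
    simp
  rw [← add_zero γ, ← h1, ← add_assoc, h0, zero_add]

theorem component_lof_eq_zero {p q : ℕ} (h : p ≠ q) (α : OComp k (NCPoly k d) p) :
    DirectSum.component k ℕ (OComp k (NCPoly k d)) q
      (DirectSum.lof k ℕ (OComp k (NCPoly k d)) p α) = 0 := by
  rw [DirectSum.component.of, dif_neg h]

/-- The functions on the representation spaces of the components of `𝔹_Γ`. -/
theorem kontsevichB_component_left (p : ℕ) (r : ℕ × ℕ) (x : PreORing k (NCPoly k d))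
    (y : PreComp k (NCPoly k d) r) {N : ℕ} (i₁ j₁ : Fin p → Fin N) (i₂ j₂ : Fin r.1 → Fin N) :
    kontsevichB P Γ
      (indexed N i₁ j₁ (DirectSum.component k ℕ (OComp k (NCPoly k d)) p (preToO x)))
      (indexed N i₂ j₂ (preToOComp r y)) =
    indexed N (Fin.append i₁ i₂) (Fin.append j₁ j₂)
      (DirectSum.component k ℕ (OComp k (NCPoly k d)) (p + r.1)
        (BB P Γ (x ⊗ₜ[k] DirectSum.lof k (ℕ × ℕ) (PreComp k (NCPoly k d)) r y))) := by
  have h : (kontsevichMap P Γ).flip (indexed N i₂ j₂ (preToOComp r y)) ∘ₗ indexed N i₁ j₁ ∘ₗ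
      DirectSum.component k ℕ (OComp k (NCPoly k d)) p ∘ₗ preToO =
      indexed N (Fin.append i₁ i₂) (Fin.append j₁ j₂) ∘ₗ
        DirectSum.component k ℕ (OComp k (NCPoly k d)) (p + r.1) ∘ₗ BB P Γ ∘ₗ
          (TensorProduct.mk k _ _).flip
            (DirectSum.lof k (ℕ × ℕ) (PreComp k (NCPoly k d)) r y) := by
    refine DirectSum.linearMap_ext _ fun l => LinearMap.ext fun x => ?_
    simp only [LinearMap.comp_apply, LinearMap.flip_apply, TensorProduct.mk_apply, preToO_lof,
      BB_lof_tmul_lof]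
    -- If the degrees differ, the component of `x` and the component of the value both vanish.
    by_cases hl : l.1 = p
    · subst hl
      rw [DirectSum.component.lof_self, DirectSum.component.lof_self, kontsevichMap_apply,
        kontsevichB_indexed]
    · rw [component_lof_eq_zero hl, component_lof_eq_zero (fun h => hl (by omega))]
      simp
  rw [← kontsevichMap_apply]
  exact LinearMap.congr_fun h x

theorem kontsevichB_component_right (l : ℕ × ℕ) (q : ℕ) (x : PreComp k (NCPoly k d) l)
    (y : PreORing k (NCPoly k d)) {N : ℕ} (i₁ j₁ : Fin l.1 → Fin N) (i₂ j₂ : Fin q → Fin N) :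
    kontsevichB P Γ (indexed N i₁ j₁ (preToOComp l x))
      (indexed N i₂ j₂ (DirectSum.component k ℕ (OComp k (NCPoly k d)) q (preToO y))) =
    indexed N (Fin.append i₁ i₂) (Fin.append j₁ j₂)
      (DirectSum.component k ℕ (OComp k (NCPoly k d)) (l.1 + q)
        (BB P Γ (DirectSum.lof k (ℕ × ℕ) (PreComp k (NCPoly k d)) l x ⊗ₜ[k] y))) := by
  have h : kontsevichMap P Γ (indexed N i₁ j₁ (preToOComp l x)) ∘ₗ indexed N i₂ j₂ ∘ₗ
      DirectSum.component k ℕ (OComp k (NCPoly k d)) q ∘ₗ preToO =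
      indexed N (Fin.append i₁ i₂) (Fin.append j₁ j₂) ∘ₗ
        DirectSum.component k ℕ (OComp k (NCPoly k d)) (l.1 + q) ∘ₗ BB P Γ ∘ₗ
          TensorProduct.mk k _ _ (DirectSum.lof k (ℕ × ℕ) (PreComp k (NCPoly k d)) l x) := by
    refine DirectSum.linearMap_ext _ fun r => LinearMap.ext fun y => ?_
    simp only [LinearMap.comp_apply, TensorProduct.mk_apply, preToO_lof, BB_lof_tmul_lof]
    by_cases hr : r.1 = q
    · subst hr
      rw [DirectSum.component.lof_self, DirectSum.component.lof_self, kontsevichMap_apply,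
        kontsevichB_indexed]
    · rw [component_lof_eq_zero hr, component_lof_eq_zero (fun h => hr (by omega))]
      simp
  rw [← kontsevichMap_apply]
  exact LinearMap.congr_fun h y

/-- Degrees add under the operator, so nothing lands below `r.1`. The remaining degrees have the
form `p + r.1` and are covered by `kontsevichB_component_left`. -/
theorem component_BB_left_eq_zero {m : ℕ} {r : ℕ × ℕ} (hm : m < r.1)
    (x : PreORing k (NCPoly k d)) (y : PreComp k (NCPoly k d) r) :
    DirectSum.component k ℕ (OComp k (NCPoly k d)) m
      (BB P Γ (x ⊗ₜ[k] DirectSum.lof k (ℕ × ℕ) (PreComp k (NCPoly k d)) r y)) = 0 := by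
  have h : DirectSum.component k ℕ (OComp k (NCPoly k d)) m ∘ₗ BB P Γ ∘ₗ
      (TensorProduct.mk k _ _).flip
        (DirectSum.lof k (ℕ × ℕ) (PreComp k (NCPoly k d)) r y) = 0 := by
    refine DirectSum.linearMap_ext _ fun l => LinearMap.ext fun x => ?_
    simp only [LinearMap.comp_apply, LinearMap.flip_apply, TensorProduct.mk_apply,
      BB_lof_tmul_lof]
    rw [component_lof_eq_zero (fun h => by omega)]
    simp
  exact LinearMap.congr_fun h x

theorem component_BB_right_eq_zero {m : ℕ} {l : ℕ × ℕ} (hm : m < l.1)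
    (x : PreComp k (NCPoly k d) l) (y : PreORing k (NCPoly k d)) :
    DirectSum.component k ℕ (OComp k (NCPoly k d)) m
      (BB P Γ (DirectSum.lof k (ℕ × ℕ) (PreComp k (NCPoly k d)) l x ⊗ₜ[k] y)) = 0 := by
  have h : DirectSum.component k ℕ (OComp k (NCPoly k d)) m ∘ₗ BB P Γ ∘ₗ
      TensorProduct.mk k _ _ (DirectSum.lof k (ℕ × ℕ) (PreComp k (NCPoly k d)) l x) = 0 := by
    refine DirectSum.linearMap_ext _ fun r => LinearMap.ext fun y => ?_
    simp only [LinearMap.comp_apply, TensorProduct.mk_apply, BB_lof_tmul_lof]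
    rw [component_lof_eq_zero (fun h => by omega)]
    simp
  exact LinearMap.congr_fun h y

theorem eq_append {p q N : ℕ} (i : Fin (p + q) → Fin N) :
    i = Fin.append (fun t => i (Fin.castAdd q t)) fun t => i (Fin.natAdd p t) :=
  (Fin.append_castAdd_natAdd (f := i)).symm

/-- Every function on a representation space given by a component of the value depends on `x` only
through `preToO x`, and these functions determine the component. -/
theorem BB_congr_left [CharZero k] (x x' y : PreORing k (NCPoly k d)) (h : preToO x = preToO x') :
    BB P Γ (x ⊗ₜ[k] y) = BB P Γ (x' ⊗ₜ[k] y) := by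
  have h1 : BB P Γ ∘ₗ TensorProduct.mk k _ _ x = BB P Γ ∘ₗ TensorProduct.mk k _ _ x' := by
    refine DirectSum.linearMap_ext _ fun r => LinearMap.ext fun y => ?_
    refine DirectSum.ext_component k fun m => ?_
    simp only [LinearMap.comp_apply, TensorProduct.mk_apply]
    rcases lt_or_ge m r.1 with hm | hm
    · rw [component_BB_left_eq_zero P Γ hm, component_BB_left_eq_zero P Γ hm]
    · obtain ⟨p, rfl⟩ := Nat.exists_eq_add_of_le' hm
      refine eq_of_indexed_eq fun N _ i j => ?_
      rw [eq_append i, eq_append j, ← kontsevichB_component_left, ← kontsevichB_component_left, h]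
  exact LinearMap.congr_fun h1 y

theorem BB_congr_right [CharZero k] (x y y' : PreORing k (NCPoly k d)) (h : preToO y = preToO y') :
    BB P Γ (x ⊗ₜ[k] y) = BB P Γ (x ⊗ₜ[k] y') := by
  have h1 : BB P Γ ∘ₗ (TensorProduct.mk k _ _).flip y =
      BB P Γ ∘ₗ (TensorProduct.mk k _ _).flip y' := by
    refine DirectSum.linearMap_ext _ fun l => LinearMap.ext fun x => ?_
    refine DirectSum.ext_component k fun m => ?_
    simp only [LinearMap.comp_apply, LinearMap.flip_apply, TensorProduct.mk_apply]
    rcases lt_or_ge m l.1 with hm | hm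
    · rw [component_BB_right_eq_zero P Γ hm, component_BB_right_eq_zero P Γ hm]
    · obtain ⟨q, rfl⟩ := Nat.exists_eq_add_of_le hm
      refine eq_of_indexed_eq fun N _ i j => ?_
      rw [eq_append i, eq_append j, ← kontsevichB_component_right, ← kontsevichB_component_right,
        h]
  exact LinearMap.congr_fun h1 x

variable {P Γ}
variable {B : ORing k (NCPoly k d) ⊗[k] ORing k (NCPoly k d) →ₗ[k] ORing k (NCPoly k d)}

theorem apply_preToOComp (hB : B ∘ₗ TensorProduct.map preToO preToO = BB P Γ) (l r : ℕ × ℕ)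
    (x : PreComp k (NCPoly k d) l) (y : PreComp k (NCPoly k d) r) :
    B (DirectSum.lof k ℕ (OComp k (NCPoly k d)) l.1 (preToOComp l x) ⊗ₜ[k]
        DirectSum.lof k ℕ (OComp k (NCPoly k d)) r.1 (preToOComp r y)) =
      DirectSum.lof k ℕ (OComp k (NCPoly k d)) (l.1 + r.1) (BBcomp P Γ l r (x ⊗ₜ[k] y)) := by
  rw [← BB_lof_tmul_lof, ← hB, LinearMap.comp_apply, TensorProduct.map_tmul, preToO_lof,
    preToO_lof]

/-- Both sides are bilinear in `α` and `β`, and on representatives the value is visibly homogeneous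
of degree `p + q`. -/
theorem apply_lof_tmul_lof (hB : B ∘ₗ TensorProduct.map preToO preToO = BB P Γ) (p q : ℕ)
    (α : OComp k (NCPoly k d) p) (β : OComp k (NCPoly k d) q) :
    DirectSum.lof k ℕ (OComp k (NCPoly k d)) (p + q)
      (DirectSum.component k ℕ (OComp k (NCPoly k d)) (p + q)
        (B (DirectSum.lof k ℕ (OComp k (NCPoly k d)) p α ⊗ₜ[k]
          DirectSum.lof k ℕ (OComp k (NCPoly k d)) q β))) =
      B (DirectSum.lof k ℕ (OComp k (NCPoly k d)) p α ⊗ₜ[k]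
        DirectSum.lof k ℕ (OComp k (NCPoly k d)) q β) := by
  let C : OComp k (NCPoly k d) p →ₗ[k] OComp k (NCPoly k d) q →ₗ[k] ORing k (NCPoly k d) :=
    (TensorProduct.curry B).compl₁₂ (DirectSum.lof k ℕ (OComp k (NCPoly k d)) p)
      (DirectSum.lof k ℕ (OComp k (NCPoly k d)) q)
  have h : C.compr₂ (DirectSum.lof k ℕ (OComp k (NCPoly k d)) (p + q) ∘ₗ
      DirectSum.component k ℕ (OComp k (NCPoly k d)) (p + q)) = C := by
    refine OComp.hom_ext_preToOComp fun s x => OComp.hom_ext_preToOComp fun s' y => ?_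
    change DirectSum.lof k ℕ _ (p + q) (DirectSum.component k ℕ _ (p + q) (B (_ ⊗ₜ[k] _))) =
      B (_ ⊗ₜ[k] _)
    have := apply_preToOComp hB (p, s) (q, s') x y
    simp only at this
    rw [this, DirectSum.component.lof_self]
  exact LinearMap.congr_fun₂ h α β

theorem kontsevichB_indexed_apply (hB : B ∘ₗ TensorProduct.map preToO preToO = BB P Γ) (p q : ℕ)
    (α : OComp k (NCPoly k d) p) (β : OComp k (NCPoly k d) q) {N : ℕ} (i₁ j₁ : Fin p → Fin N)
    (i₂ j₂ : Fin q → Fin N) :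
    kontsevichB P Γ (indexed N i₁ j₁ α) (indexed N i₂ j₂ β) =
      indexed N (Fin.append i₁ i₂) (Fin.append j₁ j₂)
        (DirectSum.component k ℕ (OComp k (NCPoly k d)) (p + q)
          (B (DirectSum.lof k ℕ (OComp k (NCPoly k d)) p α ⊗ₜ[k]
            DirectSum.lof k ℕ (OComp k (NCPoly k d)) q β))) := by
  let C : OComp k (NCPoly k d) p →ₗ[k] OComp k (NCPoly k d) q →ₗ[k] ORing k (NCPoly k d) :=
    (TensorProduct.curry B).compl₁₂ (DirectSum.lof k ℕ (OComp k (NCPoly k d)) p)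
      (DirectSum.lof k ℕ (OComp k (NCPoly k d)) q)
  have h : (kontsevichMap P Γ).compl₁₂ (indexed N i₁ j₁) (indexed N i₂ j₂) =
      C.compr₂ (indexed N (Fin.append i₁ i₂) (Fin.append j₁ j₂) ∘ₗ
        DirectSum.component k ℕ (OComp k (NCPoly k d)) (p + q)) := by
    refine OComp.hom_ext_preToOComp fun s x => OComp.hom_ext_preToOComp fun s' y => ?_
    change kontsevichMap P Γ _ _ = indexed N _ _ (DirectSum.component k ℕ _ (p + q) (B (_ ⊗ₜ[k] _)))
    have := apply_preToOComp hB (p, s) (q, s') x y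
    simp only at this
    rw [this, DirectSum.component.lof_self, kontsevichMap_apply]
    exact kontsevichB_indexed P Γ (l := (p, s)) (r := (q, s')) i₁ j₁ i₂ j₂ x y
  rw [← kontsevichMap_apply]
  exact LinearMap.congr_fun₂ h α β

theorem hom_ext_of_comp_map_preToO
    {B' : ORing k (NCPoly k d) ⊗[k] ORing k (NCPoly k d) →ₗ[k] ORing k (NCPoly k d)}
    (h : B ∘ₗ TensorProduct.map preToO preToO = B' ∘ₗ TensorProduct.map preToO preToO) :
    B = B' := by
  refine TensorProduct.ext' fun x y => ?_
  obtain ⟨x, rfl⟩ := preToO_surjective x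
  obtain ⟨y, rfl⟩ := preToO_surjective y
  exact LinearMap.congr_fun h (x ⊗ₜ[k] y)

end Final

end DiTwisted

end

theorem mainTheorem6 {k : Type*} [Field k] [IsAlgClosed k] [CharZero k] (d : ℕ)
    (P : DiTwisted.DoublePoissonBracket k (DiTwisted.NCPoly k d)) (n : ℕ)
    (Γ : DiTwisted.AdmissibleGraph n) :
    (∃! B : DiTwisted.ORing k (DiTwisted.NCPoly k d) ⊗[k] DiTwisted.ORing k (DiTwisted.NCPoly k d)
        →ₗ[k] DiTwisted.ORing k (DiTwisted.NCPoly k d),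
      B ∘ₗ TensorProduct.map DiTwisted.preToO DiTwisted.preToO = DiTwisted.BB P Γ) ∧
    ∀ B : DiTwisted.ORing k (DiTwisted.NCPoly k d) ⊗[k] DiTwisted.ORing k (DiTwisted.NCPoly k d)
        →ₗ[k] DiTwisted.ORing k (DiTwisted.NCPoly k d),
      B ∘ₗ TensorProduct.map DiTwisted.preToO DiTwisted.preToO = DiTwisted.BB P Γ →
      ∀ (p q : ℕ) (α : DiTwisted.OComp k (DiTwisted.NCPoly k d) p)
        (β : DiTwisted.OComp k (DiTwisted.NCPoly k d) q),
        ∃ γ : DiTwisted.OComp k (DiTwisted.NCPoly k d) (p + q),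
          B (DirectSum.lof k ℕ (DiTwisted.OComp k (DiTwisted.NCPoly k d)) p α ⊗ₜ[k]
              DirectSum.lof k ℕ (DiTwisted.OComp k (DiTwisted.NCPoly k d)) q β) =
            DirectSum.lof k ℕ (DiTwisted.OComp k (DiTwisted.NCPoly k d)) (p + q) γ ∧
          ∀ (N : ℕ), 0 < N → ∀ (i₁ j₁ : Fin p → Fin N) (i₂ j₂ : Fin q → Fin N),
            DiTwisted.kontsevichB P Γ (DiTwisted.indexed N i₁ j₁ α) (DiTwisted.indexed N i₂ j₂ β) =
              DiTwisted.indexed N (Fin.append i₁ i₂) (Fin.append j₁ j₂) γ := by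
  refine ⟨?_, fun B hB p q α β => ⟨_, (DiTwisted.apply_lof_tmul_lof hB p q α β).symm,
    fun N _ i₁ j₁ i₂ j₂ => DiTwisted.kontsevichB_indexed_apply hB p q α β i₁ j₁ i₂ j₂⟩⟩
  obtain ⟨B, hB⟩ := DiTwisted.exists_comp_map_eq DiTwisted.preToO DiTwisted.preToO_surjective
    (DiTwisted.BB P Γ) (DiTwisted.BB_congr_left P Γ) (DiTwisted.BB_congr_right P Γ)
  exact ⟨B, hB, fun B' hB' => DiTwisted.hom_ext_of_comp_map_preToO (hB'.trans hB.symm)⟩
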